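/- **Conventions.** Let $\mathbb O=\mathbb R^8$ be the octonions with orthonormal basis $e^0_1,\dots,e^0_8$, $e^0_8=1$, and products $e^0_5e^0_1=e^0_2$, $e^0_5e^0_3=e^0_4$, $e^0_6e^0_1=e^0_3$, $e^0_6e^0_4=e^0_2$, $e^0_7e^0_1=e^0_4$, $e^0_7e^0_2=e^0_3$, $e^0_6e^0_5=e^0_7$ (and cyclic permutations of these). Put $x\times y\times z=\tfrac12((x\bar y)z-(z\bar y)x)$ and $$x\times y\times z\times w=\tfrac14\big((y\times z\times w)\bar x+(z\times x\times w)\bar y+(x\times y\times w)\bar z+(y\times x\times z)\bar w\big),$$ $\Phi(x,y,z,w)=\langle 1,x\times y\times z\times w\rangle$ and $\psi_m(x,y,z,w)=\langle e^0_m,x\times y\times z\times w\rangle$ for $1\le m\le 7$. Let $\mathrm{Spin}(7)\subset \mathrm{SO}(8)$ be the stabilizer of $\Phi$, and let $\mathrm G(2,\mathbb O)$ be the Grassmannian of oriented $2$-planes in $\mathbb O$, embedded in $\Lambda^2\mathbb O$ by $E\mapsto e_1\wedge e_2$ for an oriented orthonormal basis $e_1,e_2$ of $E$. For such an $E$ let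 $I_E$ be the endomorphism of $\mathbb O$ with $\langle I_Ev,w\rangle=\Phi(e_1,e_2,v,w)$. Define $J$ on $T_E\mathrm G(2,\mathbb O)=\{u\wedge e_2+e_1\wedge v: u,v\in E^\perp\}$ by $J(u\wedge e_2+e_1\wedge v)=I_Eu\wedge e_2+e_1\wedge I_Ev$. A *pseudoholomorphic curve* in $(\mathrm G(2,\mathbb O),J)$ is a smooth map $\gamma$ from a smooth surface $\Sigma$ such that $d\gamma(T_\sigma\Sigma)$ is a $J$-complex line whenever it has real dimension two. An *r-oriented 2-ruled cone* over $\Sigma$ is a family of oriented $2$-dimensional linear subspaces $P_\sigma\subset\mathbb O$, $\sigma\in\Sigma$, which near every point of $\Sigma$ has a smooth oriented frame $e_1,e_2$. The $4$-fold is $M=\{(\sigma,x):x\in P_\sigma\}$, with projection to $\Sigma$ and the map $(\sigma,x)\mapsto x$ to $\mathbb O$. It is *Cayley* if $\psi_1,\dots,\psi_7$ pull back to $0$ on $M$, i.e. under the local parametrizations $(r_1,r_2,\sigma)\mapsto r_1e_1(\sigma)+r_2e_2(\sigma)$. It is *nondegenerate* if the associated map $\gamma:\Sigma\to \mathrm G(2,\mathbb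 O)$, $\gamma(\sigma)=P_\sigma$, is an immersion. It is *planar near* $\sigma$ if there are a neighbourhood $U$ of $\sigma$ and a $4$-dimensional linear subspace of $\mathbb O$ that contains $P_\tau$ for all $\tau\in U$. **Proposition.** 1. $\mathrm G(2,\mathbb O)$ is a smooth $12$-dimensional submanifold of $\Lambda^2\mathbb O$ and is the homogeneous space $\mathrm{Spin}(7)/\mathrm U(3)$: the orbit map of $e^0_1\wedge e^0_2$ induces a homeomorphism from $\mathrm{Spin}(7)/\mathrm{Stab}(e^0_1\wedge e^0_2)$ onto $\mathrm G(2,\mathbb O)$, it has smooth local sections, and $\mathrm{Stab}(e^0_1\wedge e^0_2)$ is isomorphic, as a topological group, to $\mathrm U(3)$, acting in the standard way on $\langle e^0_1,e^0_2\rangle^\perp\cong\mathbb C^3$ with complex coordinates $(x^3+ix^4,\,x^6-ix^7,\,x^5-ix^8)$. 2. $J$ is a smooth almost complex structure on $\mathrm G(2,\mathbb O)$. For every $\mathrm{Spin}(7)$-frame $e_i=g\,e^0_i$ with $de_j=\sum_i e_i\,\omega_{ij}$, its forms of type $(1,0)$ are those spanned by $\omega_{3a}+i\omega_{4a}$, $\omega_{6a}-i\omega_{7a}$,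 $\omega_{5a}-i\omega_{8a}$, $a=1,2$. $J$ is $\mathrm{Spin}(7)$-invariant and not integrable. 3. For every smooth surface $\Sigma$, sending a cone to its associated map $\gamma$ is a bijection from the r-oriented 2-ruled cones over $\Sigma$ to the smooth maps $\Sigma\to\mathrm G(2,\mathbb O)$. A cone that is planar near no point is a nondegenerate Cayley cone if and only if $\gamma$ is an immersed pseudoholomorphic curve. Moreover, if $\gamma$ is an immersed pseudoholomorphic curve, then the cone is always a nondegenerate Cayley cone; and if the cone is nondegenerate and Cayley, then $d\gamma(T_\sigma\Sigma)$ is a $J$-complex line at every $\sigma$ near which the cone is not planar. -/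

import Mathlib

open scoped Manifold ContDiff InnerProductSpace Topology

noncomputable section

namespace CayleyCone

/-! ### Octonions, cross products, the Cayley form -/

/-- The octonions as a Euclidean vector space. The standard basis vectors `ε 0, …, ε 7` are the
classical `e₁, …, e₈`; the last one is the unit `1`. -/
abbrev Oct : Type := EuclideanSpace ℝ (Fin 8)

/-- The standard orthonormal basis of `𝕆`. -/
def ε (i : Fin 8) : Oct := EuclideanSpace.single i 1

/-- Octonion multiplication; `ε 7` is the unit, and `e₅e₁ = e₂`, `e₅e₃ = e₄`, `e₆e₁ = e₃`,
`e₆e₄ = e₂`, `e₇e₁ = e₄`, `e₇e₂ = e₃`, `e₆e₅ = e₇` (with their cyclic permutations). -/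
def octMul (x y : Oct) : Oct :=
  !₂[x 0 * y 7 + x 7 * y 0 + (x 1 * y 4 - x 4 * y 1) + (x 2 * y 5 - x 5 * y 2)
      + (x 3 * y 6 - x 6 * y 3),
    x 1 * y 7 + x 7 * y 1 + (x 4 * y 0 - x 0 * y 4) + (x 5 * y 3 - x 3 * y 5)
      + (x 2 * y 6 - x 6 * y 2),
    x 2 * y 7 + x 7 * y 2 + (x 3 * y 4 - x 4 * y 3) + (x 5 * y 0 - x 0 * y 5)
      + (x 6 * y 1 - x 1 * y 6),
    x 3 * y 7 + x 7 * y 3 + (x 4 * y 2 - x 2 * y 4) + (x 1 * y 5 - x 5 * y 1)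
      + (x 6 * y 0 - x 0 * y 6),
    x 4 * y 7 + x 7 * y 4 + (x 0 * y 1 - x 1 * y 0) + (x 2 * y 3 - x 3 * y 2)
      + (x 6 * y 5 - x 5 * y 6),
    x 5 * y 7 + x 7 * y 5 + (x 0 * y 2 - x 2 * y 0) + (x 3 * y 1 - x 1 * y 3)
      + (x 4 * y 6 - x 6 * y 4),
    x 6 * y 7 + x 7 * y 6 + (x 0 * y 3 - x 3 * y 0) + (x 1 * y 2 - x 2 * y 1)
      + (x 5 * y 4 - x 4 * y 5),
    x 7 * y 7 - x 0 * y 0 - x 1 * y 1 - x 2 * y 2 - x 3 * y 3 - x 4 * y 4 - x 5 * y 5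
      - x 6 * y 6]

/-- Octonion conjugation. -/
def octConj (x : Oct) : Oct := !₂[-x 0, -x 1, -x 2, -x 3, -x 4, -x 5, -x 6, x 7]

/-- The triple cross product `x × y × z = ½ ((x ȳ) z - (z ȳ) x)`. -/
def cross3 (x y z : Oct) : Oct :=
  (1 / 2 : ℝ) • (octMul (octMul x (octConj y)) z - octMul (octMul z (octConj y)) x)

/-- The (totally skew) quadruple cross product. -/
def cross4 (x y z w : Oct) : Oct :=
  (1 / 4 : ℝ) • (octMul (cross3 y z w) (octConj x) + octMul (cross3 z x w) (octConj y)
    + octMul (cross3 x y w) (octConj z) + octMul (cross3 y x z) (octConj w))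

/-- The Cayley form `Φ`, the real part of the quadruple cross product. -/
def cayleyForm (x y z w : Oct) : ℝ := ⟪ε 7, cross4 x y z w⟫_ℝ

/-- The forms `ψ₁, …, ψ₇` are `psi 0, …, psi 6`, the imaginary components of the quadruple
cross product. -/
def psi (m : Fin 7) (x y z w : Oct) : ℝ := ⟪ε m.castSucc, cross4 x y z w⟫_ℝ

/-! ### Submanifolds of a normed space -/

section Submanifold

variable {V : Type*} [NormedAddCommGroup V] [NormedSpace ℝ V]

/-- `S` is a smooth (embedded) `k`-dimensional submanifold of `V`: near each of its points it is
diffeomorphic to an open subset of `ℝᵏ`, a map on a subset being smooth if it extends smoothly to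
an open set. -/
def IsSubmanifold (k : ℕ) (S : Set V) : Prop :=
  ∀ p ∈ S, ∃ (U : Set V) (W : Set (EuclideanSpace ℝ (Fin k)))
    (ψ : EuclideanSpace ℝ (Fin k) → V) (ρ : V → EuclideanSpace ℝ (Fin k)),
    IsOpen U ∧ p ∈ U ∧ IsOpen W ∧ ContDiffOn ℝ ∞ ψ W ∧ ContDiffOn ℝ ∞ ρ U ∧
    Set.MapsTo ψ W (S ∩ U) ∧ Set.MapsTo ρ (S ∩ U) W ∧
    (∀ y ∈ W, ρ (ψ y) = y) ∧ ∀ q ∈ S ∩ U, ψ (ρ q) = q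

/-- The tangent space of `S` at `p`: velocities of smooth curves in `S` through `p`. -/
def tangent (S : Set V) (p : V) : Set V :=
  {v | ∃ c : ℝ → V, ContDiff ℝ ∞ c ∧ (∀ t, c t ∈ S) ∧ c 0 = p ∧ deriv c 0 = v}

/-- `J` restricts to a smooth almost complex structure on the submanifold `S`. -/
structure IsAlmostComplex (S : Set V) (J : V → V →L[ℝ] V) : Prop where
  smooth : ∃ U, IsOpen U ∧ S ⊆ U ∧ ContDiffOn ℝ ∞ J U
  mapsTo : ∀ p ∈ S, Set.MapsTo (J p) (tangent S p) (tangent S p)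
  sq : ∀ p ∈ S, ∀ v ∈ tangent S p, J p (J p v) = -v

/-- The almost complex structure `J` on the `2n`-dimensional submanifold `S` is integrable: around
every point there are local holomorphic coordinates with values in `ℂⁿ`. -/
def IsIntegrable (n : ℕ) (S : Set V) (J : V → V →L[ℝ] V) : Prop :=
  ∀ p ∈ S, ∃ (U : Set V) (φ : V → (Fin n → ℂ)),
    IsOpen U ∧ p ∈ U ∧ ContDiffOn ℝ ∞ φ U ∧
    Set.BijOn (fderiv ℝ φ p) (tangent S p) Set.univ ∧
    ∀ q ∈ S ∩ U, ∀ v ∈ tangent S q,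
      fderiv ℝ φ q (J q v) = Complex.I • fderiv ℝ φ q v

variable {M : Type*} [TopologicalSpace M] [ChartedSpace (EuclideanSpace ℝ (Fin 2)) M]

/-- The differential of a `V`-valued map on a surface. -/
def differential (γ : M → V) (σ : M) : TangentSpace (𝓡 2) σ →L[ℝ] V :=
  mfderiv (𝓡 2) 𝓘(ℝ, V) γ σ

/-- `γ` is a smooth map from the surface `M` to the submanifold `S`. -/
def IsSmoothInto (S : Set V) (γ : M → V) : Prop :=
  ContMDiff (𝓡 2) 𝓘(ℝ, V) ∞ γ ∧ ∀ σ, γ σ ∈ S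

/-- The differential of `γ` is injective at every point. -/
def IsImmersed (γ : M → V) : Prop := ∀ σ, Function.Injective (differential γ σ)

/-- The image of the differential of `γ` at `σ` is invariant under `J`. -/
def HasComplexTangent (J : V → V →L[ℝ] V) (γ : M → V) (σ : M) : Prop :=
  ∀ ξ, ∃ η, differential γ σ η = J (γ σ) (differential γ σ ξ)

/-- Pseudoholomorphic curves in `(S, J)`: smooth maps from a surface such that the image of the
differential is a complex line whenever it has real dimension two. -/
def IsPseudoholomorphic (S : Set V) (J : V → V →L[ℝ] V) (γ : M → V) : Prop :=
  IsSmoothInto S γ ∧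
    ∀ σ, Function.Injective (differential γ σ) → HasComplexTangent J γ σ

end Submanifold

/-! ### The group `Spin(7)` and the Grassmannian of oriented two-planes -/

/-- Bivectors are regarded as skew endomorphisms, `x ∧ y` being `v ↦ ⟪x, v⟫ y - ⟪y, v⟫ x`. -/
abbrev Endo : Type := Oct →L[ℝ] Oct

/-- `x ∧ y`. -/
def wedge (x y : Oct) : Endo :=
  InnerProductSpace.rankOne ℝ y x - InnerProductSpace.rankOne ℝ x y

/-- `G(2,𝕆)`: an oriented two-plane with oriented orthonormal basis `x, y` is the point `x ∧ y`. -/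
def grass : Set Endo :=
  {p | ∃ x y : Oct, ‖x‖ = 1 ∧ ‖y‖ = 1 ∧ ⟪x, y⟫_ℝ = 0 ∧ p = wedge x y}

/-- `Spin(7) ⊂ O(8)`, the stabilizer of `Φ`. -/
def Spin7 : Subgroup (unitary Endo) where
  carrier := {g | ∀ x y z w, cayleyForm ((g : Endo) x) ((g : Endo) y) ((g : Endo) z)
    ((g : Endo) w) = cayleyForm x y z w}
  one_mem' := by intro x y z w; simp
  mul_mem' := by
    intro a b ha hb x y z w
    have h1 := ha ((b : Endo) x) ((b : Endo) y) ((b : Endo) z) ((b : Endo) w)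
    have h2 := hb x y z w
    simpa using h1.trans h2
  inv_mem' := by
    intro a ha x y z w
    have key : ∀ v, (a : Endo) (((a⁻¹ : unitary Endo) : Endo) v) = v := by
      intro v
      have h : ((a * a⁻¹ : unitary Endo) : Endo) v = v := by rw [mul_inv_cancel]; rfl
      exact h
    have h := ha (((a⁻¹ : unitary Endo) : Endo) x) (((a⁻¹ : unitary Endo) : Endo) y)
      (((a⁻¹ : unitary Endo) : Endo) z) (((a⁻¹ : unitary Endo) : Endo) w)
    rw [key, key, key, key] at h
    exact h.symm

/-- An element of `Spin(7)` as an endomorphism of `𝕆`. -/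
def toEndo (g : Spin7) : Endo := ((g : unitary Endo) : Endo)

/-- The action of `g` on bivectors, `g (x ∧ y) = g x ∧ g y`. -/
def conjAct (g : Spin7) (B : Endo) : Endo := toEndo g * B * star (toEndo g)

theorem conjAct_wedge (g : Spin7) (x y : Oct) :
    conjAct g (wedge x y) = wedge (toEndo g x) (toEndo g y) := by
  ext1 v
  simp [conjAct, wedge, ContinuousLinearMap.star_eq_adjoint,
    ContinuousLinearMap.adjoint_inner_right]

theorem inner_toEndo (g : Spin7) (x y : Oct) : ⟪toEndo g x, toEndo g y⟫_ℝ = ⟪x, y⟫_ℝ := by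
  rw [← ContinuousLinearMap.adjoint_inner_right, ← ContinuousLinearMap.star_eq_adjoint]
  have h : star (toEndo g) * toEndo g = 1 := (g : unitary Endo).2.1
  have h2 : (star (toEndo g)) (toEndo g y) = y := by
    exact congrArg (fun T : Endo => T y) h
  rw [h2]

theorem conjAct_mem (g : Spin7) {p : Endo} (hp : p ∈ grass) : conjAct g p ∈ grass := by
  obtain ⟨x, y, hx, hy, hxy, rfl⟩ := hp
  have hn : ∀ z, ‖toEndo g z‖ = ‖z‖ := fun z => by
    rw [@norm_eq_sqrt_real_inner Oct, @norm_eq_sqrt_real_inner Oct, inner_toEndo]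
  exact ⟨_, _, (hn x).trans hx, (hn y).trans hy, (inner_toEndo g x y).trans hxy,
    conjAct_wedge g x y⟩

/-- `Spin(7)` acts on `G(2,𝕆)`. -/
instance : MulAction Spin7 grass where
  smul g p := ⟨conjAct g p, conjAct_mem g p.2⟩
  one_smul p := by
    apply Subtype.ext
    change conjAct 1 p.1 = p.1
    simp [conjAct, toEndo]
  mul_smul g h p := by
    apply Subtype.ext
    change conjAct (g * h) p.1 = conjAct g (conjAct h p.1)
    simp [conjAct, toEndo, mul_assoc]

theorem basePoint_mem : wedge (ε 0) (ε 1) ∈ grass :=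
  ⟨ε 0, ε 1, by simp [ε], by simp [ε], by simp [ε, EuclideanSpace.inner_single_left], rfl⟩

/-- The base point `e₁ ∧ e₂`. -/
def basePoint : grass := ⟨wedge (ε 0) (ε 1), basePoint_mem⟩

/-- The complex coordinates `(x³ + i x⁴, x⁶ - i x⁷, x⁵ - i x⁸)` (indices from one), which identify
the orthogonal complement of `e₁, e₂` with `ℂ³`. -/
def complexCoord (x : Oct) : Fin 3 → ℂ :=
  ![x 2 + x 3 * Complex.I, x 5 - x 6 * Complex.I, x 4 - x 7 * Complex.I]

/-! ### The almost complex structure -/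

/-- For `p = x ∧ y` this is the endomorphism `I` of `𝕆` with `⟪I v, w⟫ = Φ(x, y, v, w)`. -/
def contract (p : Endo) : Endo :=
  (1 / 2 : ℝ) • ∑ i, ∑ j, ∑ k, ∑ l, (⟪p (ε i), ε j⟫_ℝ * cayleyForm (ε i) (ε j) (ε k) (ε l)) •
    InnerProductSpace.rankOne ℝ (ε l) (ε k)

/-- The almost complex structure of `G(2,𝕆)`. At `p = x ∧ y` it is the commutator with
`I = contract p`, so that it sends the tangent vector `u ∧ y + x ∧ v` (with `u`, `v` orthogonal to
the plane) to `I u ∧ y + x ∧ I v`. -/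
def acs (p : Endo) : Endo →L[ℝ] Endo :=
  ContinuousLinearMap.compL ℝ Oct Oct Oct (contract p) -
    (ContinuousLinearMap.compL ℝ Oct Oct Oct).flip (contract p)

/-- `Spin(7)` as a set of endomorphisms. -/
def spin7Set : Set Endo := Set.range toEndo

/-- The connection form `ω_{ij}` of the frame `e_i = g (ε i)`, at a vector `X` tangent to `Spin(7)`
at `g`; it is given by `d e_j = ∑ e_i ω_{ij}`. -/
def omega (g : Spin7) (i j : Fin 8) (X : Endo) : ℝ := ⟪toEndo g (ε i), X (ε j)⟫_ℝ

/-- The forms `ζ₃, ζ₆, ζ₅` (for `a = 0`) and `ζ₄, ζ₇, ζ₈` (for `a = 1`); for example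
`ζ₃ = ω₃₁ + i ω₄₁`, `ζ₆ = ω₆₁ - i ω₇₁`, `ζ₅ = ω₅₁ - i ω₈₁` with indices from one. -/
def zeta (g : Spin7) (a : Fin 2) (X : Endo) : Fin 3 → ℂ :=
  let b : Fin 8 := a.castLE (by decide)
  ![omega g 2 b X + omega g 3 b X * Complex.I,
    omega g 5 b X - omega g 6 b X * Complex.I,
    omega g 4 b X - omega g 7 b X * Complex.I]

/-- The differential of `Spin(7) → G(2,𝕆)`, `g ↦ g e₁ ∧ g e₂`, at `g`. -/
def dOrbit (g : Spin7) (X : Endo) : Endo :=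
  wedge (X (ε 0)) (toEndo g (ε 1)) + wedge (toEndo g (ε 0)) (X (ε 1))

/-! ### Cones ruled by oriented two-planes -/

section Cone

variable {S : Type*} [TopologicalSpace S] [ChartedSpace (EuclideanSpace ℝ (Fin 2)) S]

/-- The vectors `e 0, e 1` form a positively oriented basis of the oriented plane `(P, o)`. -/
def IsOrientedBasis (P : Submodule ℝ Oct) (o : Orientation ℝ P (Fin 2)) (e : Fin 2 → Oct) :
    Prop :=
  ∃ b : Module.Basis (Fin 2) ℝ P, b.orientation = o ∧ ∀ i, (b i : Oct) = e i

variable (S) in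
/-- An r-oriented 2-ruled cone `(M, π, S)` over the surface `S`. The (immersed) four-fold is
`M = {(σ, x) | x ∈ plane σ}`, with `π (σ, x) = σ` and with the map `(σ, x) ↦ x` to `𝕆`; its
rulings `π⁻¹(σ)` are two-planes through the vertex, they depend smoothly on `σ`, and they carry
orientations that depend continuously on `σ`: near each point of the surface there is a smooth
positively oriented frame. -/
@[ext]
structure RuledCone where
  plane : S → Submodule ℝ Oct
  finrank_plane : ∀ σ, Module.finrank ℝ (plane σ) = 2
  orientation : ∀ σ, Orientation ℝ (plane σ) (Fin 2)
  exists_frame : ∀ σ₀, ∃ (U : Set S) (e : Fin 2 → S → Oct), IsOpen U ∧ σ₀ ∈ U ∧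
    (∀ i, ContMDiffOn (𝓡 2) 𝓘(ℝ, Oct) ∞ (e i) U) ∧
    ∀ σ ∈ U, IsOrientedBasis (plane σ) (orientation σ) fun i => e i σ

namespace RuledCone

variable (C : RuledCone S)

/-- The associated map `γ` to `G(2,𝕆)`, `γ(σ) = e₁ ∧ e₂` for an oriented orthonormal basis of the
ruling over `σ`. -/
def gauss (σ : S) : Endo :=
  let b := (C.orientation σ).finOrthonormalBasis (by norm_num) (C.finrank_plane σ)
  wedge (b 0 : C.plane σ) (b 1 : C.plane σ)

/-- The cone is nondegenerate if the associated map to `G(2,𝕆)` is an immersion. -/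
def Nondegenerate : Prop := IsImmersed C.gauss

/-- The parametrization `(r₁, r₂, σ) ↦ r₁ e₁(σ) + r₂ e₂(σ)` of the cone by a frame. -/
def param (e : Fin 2 → S → Oct) (q : (ℝ × ℝ) × S) : Oct := q.1.1 • e 0 q.2 + q.1.2 • e 1 q.2

/-- The differential of `param`. -/
def dparam (e : Fin 2 → S → Oct) (q : (ℝ × ℝ) × S) :
    TangentSpace (𝓘(ℝ, ℝ × ℝ).prod (𝓡 2)) q →L[ℝ] Oct :=
  mfderiv (𝓘(ℝ, ℝ × ℝ).prod (𝓡 2)) 𝓘(ℝ, Oct) (param e) q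

/-- The cone is Cayley: the forms `ψ₁, …, ψ₇` pull back to zero under its local
parametrizations. -/
def IsCayley : Prop :=
  ∀ (U : Set S) (e : Fin 2 → S → Oct), IsOpen U →
    (∀ i, ContMDiffOn (𝓡 2) 𝓘(ℝ, Oct) ∞ (e i) U) →
    (∀ σ ∈ U, IsOrientedBasis (C.plane σ) (C.orientation σ) fun i => e i σ) →
    ∀ (r : ℝ × ℝ), ∀ σ ∈ U, ∀ (X Y Z W : TangentSpace (𝓘(ℝ, ℝ × ℝ).prod (𝓡 2)) (r, σ)),
      ∀ m, psi m (dparam e (r, σ) X) (dparam e (r, σ) Y) (dparam e (r, σ) Z)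
        (dparam e (r, σ) W) = 0

/-- Near `σ` the cone is planar: the rulings lie in a fixed four-dimensional linear subspace. -/
def IsPlanarNear (σ : S) : Prop :=
  ∃ U ∈ 𝓝 σ, ∃ W : Submodule ℝ Oct, Module.finrank ℝ W = 4 ∧ ∀ τ ∈ U, C.plane τ ≤ W

end RuledCone

end Cone

end CayleyCone

end

open CayleyCone

open scoped Manifold ContDiff InnerProductSpace Topology

namespace CayleyCone

/-! ### Octonion algebra -/

/-! The starting point is the identity Φ(x,y,z,w) = -⟪x × y × z, w⟫ (`cayleyForm_eq`): Spin(7)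
consists of the isometries that commute with the triple cross product. By the Moufang identities,
left multiplications by imaginary unit octonions are such isometries. Products of them carry any
orthonormal a, b, c, d with d ⟂ a × b × c to any other such system (`IsSpinFrame.exists_map`). The
other four standard basis vectors are, up to sign, triple products of ε 0, ε 1, ε 2, ε 4, so an
element of Spin(7) is a polynomial in the images of these four (`frameMap`). This yields
transitivity on oriented planes, smooth local sections, and the stabilizer: I_E v = -(e₁ × e₂ × v)
is a complex structure on E^⊥, elements fixing E commute with it and are therefore unitary on E^⊥,
and every unitary matrix arises by composing an element fixing e₁ and e₂ with one that rotates E.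

With bivectors viewed as skew endomorphisms, J is the commutator with I_E. It is equivariant, so
pointwise questions reduce to the base point. Non-integrability is a Nijenhuis computation: the
Cauchy-Riemann equations of a holomorphic chart φ are differentiated along curves in the
Grassmannian, and the symmetry of the second derivative leaves dφ(ε 0 ∧ ε 5) = 0, although ε 0 ∧ ε 5
is a nonzero tangent vector.

For cones, the derivative of a section s of the rulings is -dγ(γ s) modulo the ruling. For an
orthonormal basis x, y of the ruling and z, w orthogonal to it, Σ ψ_m² = |x × y × z × w|² - Φ² is,
by Lagrange's identity, the sum of the squared moduli of the 2×2 minors of z, w in complex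
coordinates (`psi_eq_zero_iff`). Hence the cone is Cayley iff dγ(ξ)s and dγ(η)s are complex
dependent for all s in the ruling. If dγ(TΣ) is a complex line, the two are proportional by a
constant, so the cone is Cayley.

Conversely, two linear families in ℂ³ that are pointwise dependent are either proportional by one
constant, which makes dγ(TΣ) complex, or have all their values in one complex line L
(`exists_smul_of_pencil`). If dγ(TΣ) is not complex at a point, the second case holds near it, and
P_σ ⊕ L is a four-plane with orthogonal projection `lineProj`. Symmetry of the second derivatives of
γ, together with complex linearity on L, forces the derivative of this projection to vanish
(`fderiv_lineProj_eq_zero`). The four-plane is then constant and the cone is planar there. -/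

theorem oct_ext {x y : Oct} (h0 : x 0 = y 0) (h1 : x 1 = y 1) (h2 : x 2 = y 2) (h3 : x 3 = y 3)
    (h4 : x 4 = y 4) (h5 : x 5 = y 5) (h6 : x 6 = y 6) (h7 : x 7 = y 7) : x = y := by
  ext i; fin_cases i <;> assumption

theorem octMul_coords (x y : Oct) :
    (octMul x y 0 = x 0 * y 7 + x 7 * y 0 + (x 1 * y 4 - x 4 * y 1) + (x 2 * y 5 - x 5 * y 2)
      + (x 3 * y 6 - x 6 * y 3)) ∧
    (octMul x y 1 = x 1 * y 7 + x 7 * y 1 + (x 4 * y 0 - x 0 * y 4) + (x 5 * y 3 - x 3 * y 5)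
      + (x 2 * y 6 - x 6 * y 2)) ∧
    (octMul x y 2 = x 2 * y 7 + x 7 * y 2 + (x 3 * y 4 - x 4 * y 3) + (x 5 * y 0 - x 0 * y 5)
      + (x 6 * y 1 - x 1 * y 6)) ∧
    (octMul x y 3 = x 3 * y 7 + x 7 * y 3 + (x 4 * y 2 - x 2 * y 4) + (x 1 * y 5 - x 5 * y 1)
      + (x 6 * y 0 - x 0 * y 6)) ∧
    (octMul x y 4 = x 4 * y 7 + x 7 * y 4 + (x 0 * y 1 - x 1 * y 0) + (x 2 * y 3 - x 3 * y 2)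
      + (x 6 * y 5 - x 5 * y 6)) ∧
    (octMul x y 5 = x 5 * y 7 + x 7 * y 5 + (x 0 * y 2 - x 2 * y 0) + (x 3 * y 1 - x 1 * y 3)
      + (x 4 * y 6 - x 6 * y 4)) ∧
    (octMul x y 6 = x 6 * y 7 + x 7 * y 6 + (x 0 * y 3 - x 3 * y 0) + (x 1 * y 2 - x 2 * y 1)
      + (x 5 * y 4 - x 4 * y 5)) ∧
    (octMul x y 7 = x 7 * y 7 - x 0 * y 0 - x 1 * y 1 - x 2 * y 2 - x 3 * y 3 - x 4 * y 4
      - x 5 * y 5 - x 6 * y 6) :=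
  ⟨rfl, rfl, rfl, rfl, rfl, rfl, rfl, rfl⟩

theorem octConj_coords (x : Oct) : octConj x 0 = -x 0 ∧ octConj x 1 = -x 1 ∧
    octConj x 2 = -x 2 ∧ octConj x 3 = -x 3 ∧ octConj x 4 = -x 4 ∧ octConj x 5 = -x 5 ∧
    octConj x 6 = -x 6 ∧ octConj x 7 = x 7 :=
  ⟨rfl, rfl, rfl, rfl, rfl, rfl, rfl, rfl⟩

theorem inner_eq_sum (x y : Oct) : ⟪x, y⟫_ℝ = x 0 * y 0 + x 1 * y 1 + x 2 * y 2 + x 3 * y 3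
    + x 4 * y 4 + x 5 * y 5 + x 6 * y 6 + x 7 * y 7 := by
  simp only [PiLp.inner_apply, Fin.sum_univ_eight, RCLike.inner_apply, conj_trivial]; ring

@[simp] theorem ε_apply (i j : Fin 8) : ε i j = if j = i then 1 else 0 := by
  simp [ε]

@[simp] theorem inner_ε_left (i : Fin 8) (x : Oct) : ⟪ε i, x⟫_ℝ = x i := by
  simp [ε, EuclideanSpace.inner_single_left]

@[simp] theorem inner_ε_right (i : Fin 8) (x : Oct) : ⟪x, ε i⟫_ℝ = x i := by
  rw [real_inner_comm]; exact inner_ε_left i x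

@[simp] theorem norm_ε (i : Fin 8) : ‖ε i‖ = 1 := by simp [ε]

theorem sum_smul_ε (x : Oct) : ∑ i, x i • ε i = x := by
  ext j; simp

section Linearity
variable (x y z : Oct) (c : ℝ)

theorem octMul_add_left : octMul (x + y) z = octMul x z + octMul y z := by
  refine oct_ext ?_ ?_ ?_ ?_ ?_ ?_ ?_ ?_ <;>
  · simp only [octMul_coords, PiLp.add_apply]; ring

theorem octMul_add_right : octMul x (y + z) = octMul x y + octMul x z := by
  refine oct_ext ?_ ?_ ?_ ?_ ?_ ?_ ?_ ?_ <;>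
  · simp only [octMul_coords, PiLp.add_apply]; ring

theorem octMul_smul_left : octMul (c • x) y = c • octMul x y := by
  refine oct_ext ?_ ?_ ?_ ?_ ?_ ?_ ?_ ?_ <;>
  · simp only [octMul_coords, PiLp.smul_apply, smul_eq_mul]; ring

theorem octMul_smul_right : octMul x (c • y) = c • octMul x y := by
  refine oct_ext ?_ ?_ ?_ ?_ ?_ ?_ ?_ ?_ <;>
  · simp only [octMul_coords, PiLp.smul_apply, smul_eq_mul]; ring

theorem octConj_add : octConj (x + y) = octConj x + octConj y := by
  refine oct_ext ?_ ?_ ?_ ?_ ?_ ?_ ?_ ?_ <;>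
  · simp only [octConj_coords, PiLp.add_apply]; try ring

theorem octConj_smul : octConj (c • x) = c • octConj x := by
  refine oct_ext ?_ ?_ ?_ ?_ ?_ ?_ ?_ ?_ <;>
  · simp only [octConj_coords, PiLp.smul_apply, smul_eq_mul]; try ring

end Linearity

/-- Octonion multiplication as a bilinear map. -/
noncomputable def octMulL : Oct →ₗ[ℝ] Oct →ₗ[ℝ] Oct :=
  LinearMap.mk₂ ℝ octMul octMul_add_left (fun c x y => octMul_smul_left x y c)
    octMul_add_right (fun c x y => octMul_smul_right x y c)

/-- Octonion conjugation as a linear map. -/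
noncomputable def octConjL : Oct →ₗ[ℝ] Oct where
  toFun := octConj
  map_add' := octConj_add
  map_smul' c x := octConj_smul x c

theorem octMulL_apply (x y : Oct) : octMulL x y = octMul x y := rfl
theorem octConjL_apply (x : Oct) : octConjL x = octConj x := rfl

theorem octMul_neg_left (x y : Oct) : octMul (-x) y = -octMul x y := by
  simp [← octMulL_apply]
theorem octMul_neg_right (x y : Oct) : octMul x (-y) = -octMul x y := by
  simp [← octMulL_apply]

theorem octConj_of_imag {u : Oct} (hu : u 7 = 0) : octConj u = -u := by
  refine oct_ext ?_ ?_ ?_ ?_ ?_ ?_ ?_ ?_ <;>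
  simp [octConj_coords, hu]

theorem octMul_one (x : Oct) : octMul x (ε 7) = x := by
  refine oct_ext ?_ ?_ ?_ ?_ ?_ ?_ ?_ ?_ <;> simp [octMul_coords]

theorem octMul_alternative (u x : Oct) : octMul u (octMul u x) = octMul (octMul u u) x := by
  refine oct_ext ?_ ?_ ?_ ?_ ?_ ?_ ?_ ?_ <;>
  · simp only [octMul_coords]; ring

/-- Polarization of the left alternative law. -/
theorem octMul_octMul_add_swap (u v x : Oct) : octMul u (octMul v x) + octMul v (octMul u x) =
    octMul (octMul u v + octMul v u) x := by
  have h := octMul_alternative (u + v) x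
  simp only [octMul_add_left, octMul_add_right, octMul_alternative u, octMul_alternative v] at h
  rw [octMul_add_left]
  rw [← sub_eq_zero] at h ⊢
  rw [← h]; abel

theorem octMul_add_swap_of_imag {u v : Oct} (hu : u 7 = 0) (hv : v 7 = 0) :
    octMul u v + octMul v u = (-2 * ⟪u, v⟫_ℝ) • ε 7 := by
  refine oct_ext ?_ ?_ ?_ ?_ ?_ ?_ ?_ ?_ <;>
  simp [octMul_coords, inner_eq_sum, hu, hv] <;> ring

theorem one_octMul (x : Oct) : octMul (ε 7) x = x := by
  refine oct_ext ?_ ?_ ?_ ?_ ?_ ?_ ?_ ?_ <;> simp [octMul_coords]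

/-- The Clifford relation: left multiplications by orthogonal imaginary octonions anticommute,
although the algebra is not associative. -/
theorem octMul_octMul_add_swap_of_imag {u v : Oct} (hu : u 7 = 0) (hv : v 7 = 0) (x : Oct) :
    octMul u (octMul v x) + octMul v (octMul u x) = (-2 * ⟪u, v⟫_ℝ) • x := by
  rw [octMul_octMul_add_swap, octMul_add_swap_of_imag hu hv, octMul_smul_left, one_octMul]

theorem octMul_octMul_self {u : Oct} (hu : u 7 = 0) (x : Oct) :
    octMul u (octMul u x) = -(⟪u, u⟫_ℝ • x) := by
  have h := octMul_octMul_add_swap_of_imag hu hu x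
  have h2 : (2 : ℝ) • octMul u (octMul u x) = (2 : ℝ) • (-(⟪u, u⟫_ℝ • x)) := by
    rw [two_smul, h]; module
  exact smul_right_injective _ two_ne_zero h2

/-- Polarized form of (a x) x̄ = |x|² a. It yields both the multiplicativity of the norm and the
sign rule for exchanging orthogonal factors. -/
theorem octMul_octConj_add_swap (a x y : Oct) :
    octMul (octMul a y) (octConj x) + octMul (octMul a x) (octConj y) = (2 * ⟪x, y⟫_ℝ) • a := by
  refine oct_ext ?_ ?_ ?_ ?_ ?_ ?_ ?_ ?_ <;>
  · simp only [octMul_coords, octConj_coords, inner_eq_sum, PiLp.add_apply, PiLp.smul_apply,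
      smul_eq_mul]; ring

theorem octMul_octConj_swap {x y : Oct} (a : Oct) (h : ⟪x, y⟫_ℝ = 0) :
    octMul (octMul a y) (octConj x) = -octMul (octMul a x) (octConj y) := by
  rw [eq_neg_iff_add_eq_zero, octMul_octConj_add_swap, h]; simp

theorem inner_octMul_left (x y z : Oct) : ⟪octMul x y, z⟫_ℝ = ⟪x, octMul z (octConj y)⟫_ℝ := by
  simp only [inner_eq_sum, octMul_coords, octConj_coords]; ring

theorem inner_octMul_right (x y z : Oct) : ⟪octMul x y, z⟫_ℝ = ⟪y, octMul (octConj x) z⟫_ℝ := by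
  simp only [inner_eq_sum, octMul_coords, octConj_coords]; ring

theorem inner_octMul_octMul_right (x y z : Oct) :
    ⟪octMul y x, octMul z x⟫_ℝ = ⟪x, x⟫_ℝ * ⟪y, z⟫_ℝ := by
  have h := octMul_octConj_add_swap z x x
  have h2 : octMul (octMul z x) (octConj x) = ⟪x, x⟫_ℝ • z := by
    refine smul_right_injective _ (two_ne_zero (α := ℝ)) ?_
    simp only [two_smul, h]; module
  rw [inner_octMul_left, h2, real_inner_smul_right]

theorem inner_octConj (x y : Oct) : ⟪octConj x, octConj y⟫_ℝ = ⟪x, y⟫_ℝ := by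
  simp only [inner_eq_sum, octConj_coords]; ring

theorem inner_octMul_of_imag {u : Oct} (hu : u 7 = 0) (x y : Oct) :
    ⟪octMul u x, y⟫_ℝ = -⟪x, octMul u y⟫_ℝ := by
  rw [inner_octMul_right, octConj_of_imag hu, octMul_neg_left, inner_neg_right]

theorem octMul_moufang_middle (u x y : Oct) :
    octMul (octMul u x) (octMul y u) = octMul (octMul u (octMul x y)) u := by
  refine oct_ext ?_ ?_ ?_ ?_ ?_ ?_ ?_ ?_ <;>
  · simp only [octMul_coords]; ring

theorem octConj_octMul (x y : Oct) : octConj (octMul x y) = octMul (octConj y) (octConj x) := by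
  refine oct_ext ?_ ?_ ?_ ?_ ?_ ?_ ?_ ?_ <;>
  · simp only [octMul_coords, octConj_coords]; ring

theorem octConj_octConj (x : Oct) : octConj (octConj x) = x := by
  refine oct_ext ?_ ?_ ?_ ?_ ?_ ?_ ?_ ?_ <;> simp [octConj_coords]

theorem octMul_flexible (u x : Oct) : octMul (octMul u x) u = octMul u (octMul x u) := by
  refine oct_ext ?_ ?_ ?_ ?_ ?_ ?_ ?_ ?_ <;>
  · simp only [octMul_coords]; ring

/-- The adjoint of the middle Moufang identity for ū, w, ȳ: pairing that identity with x and moving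
all factors off w gives this one. -/
theorem octMul_moufang_left (u x y : Oct) :
    octMul (octMul (octMul u x) u) y = octMul u (octMul x (octMul u y)) := by
  refine ext_inner_left ℝ fun w => ?_
  have h := congrArg (fun t => ⟪t, x⟫_ℝ) (octMul_moufang_middle (octConj u) w (octConj y))
  beta_reduce at h
  rw [inner_octMul_left (octMul _ w), inner_octMul_right (octConj u) w, inner_octMul_left _ (octConj u),
    inner_octMul_right (octConj u), inner_octMul_left w, octConj_octMul, octConj_octConj,
    octConj_octConj] at h
  rw [octMul_flexible, h]

/-! ### Triple and quadruple cross products -/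

theorem cross3_swap_left (x y z : Oct) : cross3 x y z = -cross3 y x z := by
  refine oct_ext ?_ ?_ ?_ ?_ ?_ ?_ ?_ ?_ <;>
  · simp only [cross3, PiLp.smul_apply, PiLp.sub_apply, PiLp.neg_apply, smul_eq_mul, octMul_coords,
      octConj_coords]
    ring

theorem cross3_swap_outer (x y z : Oct) : cross3 x y z = -cross3 z y x := by
  simp only [cross3]; module

theorem cross3_cycle (x y z : Oct) : cross3 x y z = cross3 y z x := by
  rw [cross3_swap_left, cross3_swap_outer y x z, cross3_swap_left z x y,
    cross3_swap_outer x z y]; simp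

theorem cross3_swap_right (x y z : Oct) : cross3 x y z = -cross3 x z y := by
  rw [cross3_cycle, cross3_swap_left, cross3_cycle z y x, cross3_cycle y x z]

theorem eq_zero_of_eq_neg {v : Oct} (h : v = -v) : v = 0 := by
  have h2 : (2 : ℝ) • v = 0 := by rw [two_smul]; nth_rewrite 2 [h]; exact add_neg_cancel v
  simpa using h2

theorem cross3_self_left (x z : Oct) : cross3 x x z = 0 :=
  eq_zero_of_eq_neg (cross3_swap_left x x z)

theorem cross3_self_outer (x y : Oct) : cross3 x y x = 0 := by simp [cross3]

theorem cross3_self_right (x y : Oct) : cross3 x y y = 0 :=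
  eq_zero_of_eq_neg (cross3_swap_right x y y)

/-- The triple cross product as a trilinear map. -/
noncomputable def cross3L : Oct →ₗ[ℝ] Oct →ₗ[ℝ] Oct →ₗ[ℝ] Oct :=
  LinearMap.mk₂ ℝ
    (fun x y => (1 / 2 : ℝ) • (octMulL (octMulL x (octConjL y)) -
      (octMulL.flip x).comp (octMulL.flip (octConjL y))))
    (by intros; ext : 1; simp; module) (by intros; ext : 1; simp; module)
    (by intros; ext : 1; simp; module) (by intros; ext : 1; simp; module)

theorem cross3L_apply (x y z : Oct) : cross3L x y z = cross3 x y z := rfl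

/-- For orthogonal vectors the two products in the definition are opposite, so half their difference
is a single product; its norm is then multiplicative. -/
theorem cross3_eq_of_orthogonal {x y z : Oct} (hxy : ⟪x, y⟫_ℝ = 0) (hyz : ⟪y, z⟫_ℝ = 0)
    (hxz : ⟪x, z⟫_ℝ = 0) : cross3 x y z = octMul (octMul x (octConj y)) z := by
  have h1 : octMul x (octConj y) = -octMul y (octConj x) := by
    have := octMul_octConj_swap (ε 7) ((real_inner_comm _ _).trans hxy)
    simpa [one_octMul] using this
  have h2 : octMul z (octConj y) = -octMul y (octConj z) := by
    have := octMul_octConj_swap (ε 7) hyz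
    simpa [one_octMul] using this
  have key : octMul (octMul y (octConj x)) z = -octMul (octMul y (octConj z)) x := by
    have := octMul_octConj_swap (x := octConj z) (y := octConj x) y
      (by rw [inner_octConj, real_inner_comm, hxz])
    rwa [octConj_octConj, octConj_octConj] at this
  rw [cross3, h1, h2, octMul_neg_left, octMul_neg_left, key]; module

theorem inner_cross3_self {x y z : Oct} (hxy : ⟪x, y⟫_ℝ = 0) (hyz : ⟪y, z⟫_ℝ = 0)
    (hxz : ⟪x, z⟫_ℝ = 0) :
    ⟪cross3 x y z, cross3 x y z⟫_ℝ = ⟪x, x⟫_ℝ * ⟪y, y⟫_ℝ * ⟪z, z⟫_ℝ := by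
  rw [cross3_eq_of_orthogonal hxy hyz hxz, inner_octMul_octMul_right, inner_octMul_octMul_right,
    inner_octConj]; ring

theorem cross3_coords (x y z : Oct) (i : Fin 8) : cross3 x y z i =
    (1 / 2 : ℝ) * (octMul (octMul x (octConj y)) z i - octMul (octMul z (octConj y)) x i) := rfl

theorem inner_cross3_left_eq_zero (x y z : Oct) : ⟪cross3 x y z, x⟫_ℝ = 0 := by
  have h1 : ⟪octMul (octMul x (octConj y)) z, x⟫_ℝ =
      ⟪octMul (octMul z (octConj y)) x, x⟫_ℝ := by
    rw [inner_octMul_left, real_inner_comm, inner_octMul_left (octMul z (octConj y)),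
      real_inner_comm]
    simp only [inner_eq_sum, octMul_coords, octConj_coords]; ring
  rw [cross3, real_inner_smul_left, inner_sub_left, h1]; simp

/-- Polarization of the orthogonality of x × y × z to x. Together with the skewness of the product
it makes ⟪x × y × z, w⟫ an alternating form. -/
theorem inner_cross3_swap (x y z w : Oct) : ⟪cross3 x y z, w⟫_ℝ = -⟪cross3 w y z, x⟫_ℝ := by
  have h := inner_cross3_left_eq_zero (x + w) y z
  have e : cross3 (x + w) y z = cross3 x y z + cross3 w y z := by
    simp only [← cross3L_apply, map_add, LinearMap.add_apply]
  rw [e, inner_add_left, inner_add_right, inner_add_right, inner_cross3_left_eq_zero,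
    inner_cross3_left_eq_zero] at h
  linarith

theorem one_inner_octMul_octConj (x y : Oct) : ⟪ε 7, octMul x (octConj y)⟫_ℝ = ⟪x, y⟫_ℝ := by
  rw [inner_ε_left]; simp only [inner_eq_sum, octMul_coords, octConj_coords]; ring

/-- All four summands of the quadruple product have the same real part, because ⟪x × y × z, w⟫ is
alternating. -/
theorem cayleyForm_eq (x y z w : Oct) : cayleyForm x y z w = -⟪cross3 x y z, w⟫_ℝ := by
  simp only [cayleyForm, cross4, real_inner_smul_right, inner_add_right, one_inner_octMul_octConj]
  have h1 : ⟪cross3 y z w, x⟫_ℝ = -⟪cross3 x y z, w⟫_ℝ := by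
    rw [cross3_cycle, cross3_cycle, inner_cross3_swap]
  have h2 : ⟪cross3 z x w, y⟫_ℝ = -⟪cross3 x y z, w⟫_ℝ := by
    rw [cross3_cycle, cross3_cycle, inner_cross3_swap, cross3_swap_left, cross3_cycle,
      cross3_swap_right, neg_neg, cross3_cycle, cross3_cycle]
  have h3 : ⟪cross3 x y w, z⟫_ℝ = -⟪cross3 x y z, w⟫_ℝ := by
    rw [cross3_cycle, cross3_cycle, inner_cross3_swap, cross3_cycle z x y]
  rw [h1, h2, h3, cross3_swap_left y x z, inner_neg_left]; ring

/-- Exchanging orthogonal factors by `octMul_octConj_swap` shows that the four summands coincide. -/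
theorem cross4_eq_of_orthogonal {x y z w : Oct} (hxy : ⟪x, y⟫_ℝ = 0) (hxz : ⟪x, z⟫_ℝ = 0)
    (hxw : ⟪x, w⟫_ℝ = 0) (hyz : ⟪y, z⟫_ℝ = 0) (hyw : ⟪y, w⟫_ℝ = 0) (hzw : ⟪z, w⟫_ℝ = 0) :
    cross4 x y z w = octMul (cross3 y z w) (octConj x) := by
  have hwy := (real_inner_comm w y).symm.trans hyw
  have hwz := (real_inner_comm w z).symm.trans hzw
  have hwx := (real_inner_comm w x).symm.trans hxw
  have hzy := (real_inner_comm z y).symm.trans hyz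
  have hzx := (real_inner_comm z x).symm.trans hxz
  have hyx := (real_inner_comm y x).symm.trans hxy
  have h2 : octMul (cross3 z x w) (octConj y) = octMul (cross3 y z w) (octConj x) := by
    rw [cross3_swap_right, cross3_cycle y z w, cross3_eq_of_orthogonal hzw hwx hzx,
      cross3_eq_of_orthogonal hzw hwy hzy, octMul_neg_left, octMul_octConj_swap _ hxy]
  have h3 : octMul (cross3 x y w) (octConj z) = octMul (cross3 y z w) (octConj x) := by
    rw [cross3_cycle x y w, cross3_swap_right y z w, cross3_eq_of_orthogonal hyw hwx hyx,
      cross3_eq_of_orthogonal hyw hwz hyz, octMul_neg_left, octMul_octConj_swap _ hxz, neg_neg]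
  have h4 : octMul (cross3 y x z) (octConj w) = octMul (cross3 y z w) (octConj x) := by
    rw [cross3_swap_right y x z, cross3_eq_of_orthogonal hyz hzx hyx,
      cross3_eq_of_orthogonal hyz hzw hyw, octMul_neg_left, octMul_octConj_swap _ hxw]
  rw [cross4, h2, h3, h4]; module

theorem inner_cross4_self {x y z w : Oct} (hxy : ⟪x, y⟫_ℝ = 0) (hxz : ⟪x, z⟫_ℝ = 0)
    (hxw : ⟪x, w⟫_ℝ = 0) (hyz : ⟪y, z⟫_ℝ = 0) (hyw : ⟪y, w⟫_ℝ = 0) (hzw : ⟪z, w⟫_ℝ = 0) :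
    ⟪cross4 x y z w, cross4 x y z w⟫_ℝ = ⟪x, x⟫_ℝ * ⟪y, y⟫_ℝ * ⟪z, z⟫_ℝ * ⟪w, w⟫_ℝ := by
  rw [cross4_eq_of_orthogonal hxy hxz hxw hyz hyw hzw, inner_octMul_octMul_right, inner_octConj,
    inner_cross3_self hyz hzw hyw]; ring

/-- The quadruple cross product as an alternating map. -/
noncomputable def cross4Alt : Oct [⋀^Fin 4]→ₗ[ℝ] Oct where
  toFun v := cross4 (v 0) (v 1) (v 2) (v 3)
  map_update_add' := @fun inst v i x y => by
    simp only [cross4, ← cross3L_apply, ← octMulL_apply, ← octConjL_apply]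
    obtain rfl := Subsingleton.elim inst (instDecidableEqFin 4)
    fin_cases i <;> simp <;> module
  map_update_smul' := @fun inst v i c x => by
    simp only [cross4, ← cross3L_apply, ← octMulL_apply, ← octConjL_apply]
    obtain rfl := Subsingleton.elim inst (instDecidableEqFin 4)
    fin_cases i <;> simp <;> module
  map_eq_zero_of_eq' v i j h hij := by
    have n0 : ∀ x, octMul 0 x = 0 := fun x => by simp [← octMulL_apply]
    have h01 : ∀ x z w, cross4 x x z w = 0 := fun x z w => by
      rw [cross4, cross3_swap_left z x w, cross3_self_left, cross3_self_left, octMul_neg_left]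
      simp [n0]
    have h02 : ∀ x y w, cross4 x y x w = 0 := fun x y w => by
      rw [cross4, cross3_self_left, cross3_self_right, cross3_swap_left y x w, octMul_neg_left]
      simp [n0]
    have h03 : ∀ x y z, cross4 x y z x = 0 := fun x y z => by
      rw [cross4, cross3_self_outer, cross3_self_right, cross3_swap_right y z x, octMul_neg_left]
      simp [n0]
    have h12 : ∀ x y w, cross4 x y y w = 0 := fun x y w => by
      rw [cross4, cross3_self_outer, cross3_self_left, cross3_swap_left y x w, octMul_neg_left]
      simp [n0]
    have h13 : ∀ x y z, cross4 x y z y = 0 := fun x y z => by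
      rw [cross4, cross3_self_outer, cross3_self_right, ← cross3_cycle y z x,
        cross3_swap_right y z x, octMul_neg_left]
      simp [n0]
    have h23 : ∀ x y z, cross4 x y z z = 0 := fun x y z => by
      rw [cross4, cross3_self_outer, cross3_self_right, cross3_swap_left y x z, octMul_neg_left]
      simp [n0]
    fin_cases i <;> fin_cases j <;> simp at h hij <;> simp [h, h01, h02, h03, h12, h13, h23]

theorem cross4Alt_apply (v : Fin 4 → Oct) : cross4Alt v = cross4 (v 0) (v 1) (v 2) (v 3) := by
  simp only [cross4Alt, AlternatingMap.coe_mk, MultilinearMap.coe_mk]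

section Smooth
variable {V : Type*} [NormedAddCommGroup V] [NormedSpace ℝ V] {U : Set V} {f g h : V → Oct}

theorem contDiffOn_cross3 (hf : ContDiffOn ℝ ∞ f U) (hg : ContDiffOn ℝ ∞ g U)
    (hh : ContDiffOn ℝ ∞ h U) : ContDiffOn ℝ ∞ (fun v => cross3 (f v) (g v) (h v)) U := by
  have key : ∀ (B : Oct →ₗ[ℝ] Oct →ₗ[ℝ] Oct) {f g : V → Oct}, ContDiffOn ℝ ∞ f U →
      ContDiffOn ℝ ∞ g U → ContDiffOn ℝ ∞ (fun v => B (f v) (g v)) U := fun B f g hf hg => by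
    simp only [← LinearMap.toContinuousBilinearMap_apply]
    exact (B.toContinuousBilinearMap.contDiff.comp_contDiffOn hf).clm_apply hg
  have hc : ContDiffOn ℝ ∞ (fun v => octConjL (g v)) U :=
    octConjL.toContinuousLinearMap.contDiff.comp_contDiffOn hg
  exact (contDiffOn_const (c := (1 / 2 : ℝ))).smul ((key octMulL (key octMulL hf hc) hh).sub
    (key octMulL (key octMulL hh hc) hf))

end Smooth

/-! ### Elements of `Spin(7)` -/

theorem exists_spin7 (A : Endo) (hA : ∀ x y, ⟪A x, A y⟫_ℝ = ⟪x, y⟫_ℝ)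
    (hc : ∀ x y z, cross3 (A x) (A y) (A z) = A (cross3 x y z)) : ∃ g : Spin7, toEndo g = A := by
  have h1 : star A * A = 1 := by
    ext1 x
    refine ext_inner_right ℝ fun y => ?_
    rw [ContinuousLinearMap.star_eq_adjoint]
    exact (ContinuousLinearMap.adjoint_inner_left A y (A x)).trans (hA x y)
  have hinj : Function.Injective A := fun x y h => by
    have := congrArg (star A : Endo) h
    have e : ∀ v, (star A : Endo) (A v) = v := fun v => congrArg (fun T : Endo => T v) h1
    rwa [e, e] at this
  have hsurj : Function.Surjective A :=
    LinearMap.surjective_of_injective (f := (A : Oct →ₗ[ℝ] Oct)) hinj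
  -- An injective endomorphism of a finite-dimensional space is onto, so the left inverse is
  -- two-sided.
  have h2 : A * star A = 1 := by
    ext1 x
    obtain ⟨y, rfl⟩ := hsurj x
    exact congrArg A (congrArg (fun T : Endo => T y) h1)
  refine ⟨⟨⟨A, h1, h2⟩, fun x y z w => ?_⟩, rfl⟩
  change cayleyForm (A x) (A y) (A z) (A w) = cayleyForm x y z w
  rw [cayleyForm_eq, cayleyForm_eq, hc, hA]

theorem toEndo_mul_apply (g h : Spin7) (x : Oct) : toEndo (g * h) x = toEndo g (toEndo h x) := rfl

theorem toEndo_one_apply (x : Oct) : toEndo 1 x = x := rfl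

@[simp] theorem toEndo_inv_apply (g : Spin7) (x : Oct) : toEndo g⁻¹ (toEndo g x) = x := by
  rw [← toEndo_mul_apply, inv_mul_cancel]; rfl

@[simp] theorem toEndo_apply_inv (g : Spin7) (x : Oct) : toEndo g (toEndo g⁻¹ x) = x := by
  rw [← toEndo_mul_apply, mul_inv_cancel]; rfl

theorem inner_toEndo_left (g : Spin7) (x y : Oct) : ⟪toEndo g x, y⟫_ℝ = ⟪x, toEndo g⁻¹ y⟫_ℝ := by
  rw [← inner_toEndo g x, toEndo_apply_inv]

theorem cross3_toEndo (g : Spin7) (x y z : Oct) :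
    cross3 (toEndo g x) (toEndo g y) (toEndo g z) = toEndo g (cross3 x y z) := by
  refine ext_inner_right ℝ fun w => ?_
  have h := (g : unitary Endo).2
  have h2 : cayleyForm (toEndo g x) (toEndo g y) (toEndo g z) (toEndo g (toEndo g⁻¹ w)) =
    cayleyForm x y z (toEndo g⁻¹ w) := g.2 x y z _
  rw [cayleyForm_eq, cayleyForm_eq, toEndo_apply_inv, neg_inj] at h2
  rw [h2, inner_toEndo_left]

theorem toEndo_injective : Function.Injective toEndo := fun _ _ h =>
  Subtype.ext (Subtype.ext h)

theorem octMul_self_of_imag {u : Oct} (hu : u 7 = 0) : octMul u u = -(⟪u, u⟫_ℝ • ε 7) := by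
  rw [← octMul_octMul_self hu, octMul_one]

/-- Left multiplication by an imaginary unit octonion belongs to `Spin(7)`. -/
theorem exists_spin7_octMul {u : Oct} (hu : u 7 = 0) (hu1 : ⟪u, u⟫_ℝ = 1) :
    ∃ g : Spin7, ∀ x, toEndo g x = octMul u x := by
  obtain ⟨g, hg⟩ := exists_spin7 (octMulL u).toContinuousLinearMap
    (fun x y => by
      change ⟪octMul u x, octMul u y⟫_ℝ = ⟪x, y⟫_ℝ
      rw [inner_octMul_of_imag hu, octMul_octMul_self hu, hu1]; simp)
    (fun x y z => by
      -- Since the conjugate of u b is -(b̄ u), the middle Moufang identity turns the first product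
      -- into -(u(a b̄))u; the left one and u(u c) = -c finish.
      have hm : ∀ a b c, octMul (octMul (octMul u a) (octConj (octMul u b))) (octMul u c) =
          octMul u (octMul (octMul a (octConj b)) c) := fun a b c => by
        rw [octConj_octMul, octConj_of_imag hu, octMul_neg_right, octMul_neg_right,
          octMul_moufang_middle,
          octMul_neg_left, octMul_moufang_left, octMul_octMul_self hu, hu1, one_smul,
          octMul_neg_right, octMul_neg_right, neg_neg]
      change cross3 (octMul u x) (octMul u y) (octMul u z) = octMul u (cross3 x y z)
      rw [cross3, hm, hm, cross3, octMul_smul_right, sub_eq_add_neg, sub_eq_add_neg,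
        octMul_add_right, octMul_neg_right])
  exact ⟨g, fun x => by rw [hg]; rfl⟩

theorem exists_unit_orthogonal {k : ℕ} (hk : k < 8) (f : Fin k → Oct) :
    ∃ c : Oct, ⟪c, c⟫_ℝ = 1 ∧ ∀ i, ⟪c, f i⟫_ℝ = 0 := by
  set W := Submodule.span ℝ (Set.range f)
  have hW : Module.finrank ℝ W ≤ k := by
    have := finrank_range_le_card (R := ℝ) f
    simpa [Set.finrank] using this
  have h8 : Module.finrank ℝ Oct = 8 := by simp
  have hsum := W.finrank_add_finrank_orthogonal
  have hne : Wᗮ ≠ ⊥ := fun h => by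
    rw [h, finrank_bot, h8] at hsum; omega
  obtain ⟨v, hv, hv0⟩ := Submodule.exists_mem_ne_zero_of_ne_bot hne
  have hn : ‖v‖ ≠ 0 := norm_ne_zero_iff.mpr hv0
  refine ⟨‖v‖⁻¹ • v, ?_, fun i => ?_⟩
  · rw [real_inner_smul_left, real_inner_smul_right, real_inner_self_eq_norm_sq]
    field_simp
  · rw [real_inner_smul_left, real_inner_comm,
      Submodule.inner_right_of_mem_orthogonal (Submodule.subset_span (Set.mem_range_self i)) hv, mul_zero]

/-- For orthonormal imaginary `i`, `m` the map that is `1` on the quaternion subalgebra spanned by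
`1, i, m, im` and `-1` on its orthogonal complement belongs to `Spin(7)`. -/
theorem exists_spin7_reflection {i m : Oct} (hi : i 7 = 0) (hm : m 7 = 0) (hii : ⟪i, i⟫_ℝ = 1)
    (hmm : ⟪m, m⟫_ℝ = 1) (him : ⟪i, m⟫_ℝ = 0) :
    ∃ g : Spin7, toEndo g (ε 7) = ε 7 ∧ toEndo g i = i ∧ toEndo g m = m ∧
      ∀ x, x 7 = 0 → ⟪i, x⟫_ℝ = 0 → ⟪m, x⟫_ℝ = 0 → ⟪octMul i m, x⟫_ℝ = 0 →
        toEndo g x = -x := by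
  set k := octMul i m with hk
  have hanti : ∀ {a b : Oct}, a 7 = 0 → b 7 = 0 → ⟪a, b⟫_ℝ = 0 → octMul a b = -octMul b a :=
    fun ha hb hab => by
      rw [eq_neg_iff_add_eq_zero, octMul_add_swap_of_imag ha hb, hab]; simp
  have hanti' : ∀ {a b : Oct} (x : Oct), a 7 = 0 → b 7 = 0 → ⟪a, b⟫_ℝ = 0 →
      octMul a (octMul b x) = -octMul b (octMul a x) := fun x ha hb hab => by
    rw [eq_neg_iff_add_eq_zero, octMul_octMul_add_swap_of_imag ha hb, hab]; simp
  have hk7 : k 7 = 0 := by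
    have h := octMul_coords i m
    have h2 := inner_eq_sum i m
    rw [him, hi, hm] at h2
    rw [hk, h.2.2.2.2.2.2.2, hi, hm]; linarith
  have hkk : ⟪k, k⟫_ℝ = 1 := by
    rw [hk, inner_octMul_octMul_right, hmm, hii, one_mul]
  obtain ⟨gi, hgi⟩ := exists_spin7_octMul hi hii
  obtain ⟨gm, hgm⟩ := exists_spin7_octMul hm hmm
  obtain ⟨gk, hgk⟩ := exists_spin7_octMul hk7 hkk
  have himk : octMul i k = -m := by rw [hk, octMul_octMul_self hi, hii, one_smul]
  have hki : octMul k i = m := by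
    have : ⟪k, i⟫_ℝ = 0 := by
      rw [hk, inner_octMul_of_imag hi, octMul_self_of_imag hi]
      simp [real_inner_smul_right, hm]
    rw [hanti hk7 hi this, himk, neg_neg]
  have hkm : octMul k m = -i := by
    rw [hk, hanti hi hm him, octMul_neg_left]
    have h : ⟪octMul m i, m⟫_ℝ = 0 := by
      rw [inner_octMul_of_imag hm, octMul_self_of_imag hm]
      simp [real_inner_smul_right, hi]
    rw [hanti (by rw [← neg_neg (octMul m i), ← hanti hi hm him]; simpa using hk7) hm h,
      octMul_octMul_self hm, hmm]; simp
  -- the reflection is `x ↦ -k (i (m x))`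
  refine ⟨gk⁻¹ * (gi * gm), ?_, ?_, ?_, fun x hx hix hmx hkx => ?_⟩
  · have : toEndo (gi * gm) (ε 7) = toEndo gk (ε 7) := by
      rw [toEndo_mul_apply, hgi, hgm, hgk, octMul_one, octMul_one]
    rw [toEndo_mul_apply, this, toEndo_inv_apply]
  · have : toEndo (gi * gm) i = toEndo gk i := by
      rw [toEndo_mul_apply, hgi, hgm, hgk, hki, hanti hm hi ((real_inner_comm _ _).trans him),
        octMul_neg_right, octMul_octMul_self hi, hii]; simp
    rw [toEndo_mul_apply, this, toEndo_inv_apply]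
  · have : toEndo (gi * gm) m = toEndo gk m := by
      rw [toEndo_mul_apply, hgi, hgm, hgk, hkm, octMul_self_of_imag hm, hmm, one_smul,
        octMul_neg_right, octMul_one]
    rw [toEndo_mul_apply, this, toEndo_inv_apply]
  -- Each exchange of orthogonal imaginary factors changes the sign: i(mx) = -i(xm) = x(im) = xk =
  -- -kx.
  · have : toEndo (gi * gm) x = toEndo gk (-x) := by
      rw [toEndo_mul_apply, hgi, hgm, hgk, hanti hm hx hmx, octMul_neg_right,
        hanti' m hi hx hix, neg_neg, ← hk, octMul_neg_right,
        hanti hx hk7 ((real_inner_comm _ _).trans hkx)]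
    rw [toEndo_mul_apply, this, toEndo_inv_apply]

/-! ### Transitivity of `Spin(7)` on frames -/

/-- A unit vector w is a product of two imaginary units: if v is an imaginary unit orthogonal to w,
then w v is imaginary and w = -(w v) v. -/
theorem exists_spin7_map_to_one {w : Oct} (hw : ⟪w, w⟫_ℝ = 1) :
    ∃ g : Spin7, toEndo g w = ε 7 := by
  obtain ⟨v, hv1, hv⟩ := exists_unit_orthogonal (by norm_num) ![ε 7, w]
  have hv7 : v 7 = 0 := by simpa using hv 0
  have hvw : ⟪v, w⟫_ℝ = 0 := hv 1
  have hvv : octMul (octMul w v) v = -w := by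
    have h := octMul_octConj_add_swap w v v
    rw [octConj_of_imag hv7, octMul_neg_right, hv1, ← two_smul ℝ] at h
    have h2 := smul_right_injective Oct (two_ne_zero (α := ℝ))
      (h.trans (show ((2 * 1 : ℝ) • w) = (2 : ℝ) • w by module))
    exact neg_eq_iff_eq_neg.mp h2
  have hu7 : (octMul w v) 7 = 0 := by
    rw [← inner_ε_right, inner_octMul_left, one_octMul, octConj_of_imag hv7, inner_neg_right,
      real_inner_comm, hvw, neg_zero]
  obtain ⟨g, hg⟩ := exists_spin7_octMul (u := -octMul w v) (by simp [hu7]) (by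
    rw [inner_neg_neg, inner_octMul_octMul_right, hv1, hw, one_mul])
  obtain ⟨h, hh⟩ := exists_spin7_octMul hv7 hv1
  refine ⟨(g * h)⁻¹, ?_⟩
  have : toEndo (g * h) (ε 7) = w := by
    rw [toEndo_mul_apply, hg, hh, octMul_one, octMul_neg_left, hvv, neg_neg]
  conv_lhs => rw [← this, toEndo_inv_apply]

theorem inner_octMul_self_eq_zero {i : Oct} (hi : i 7 = 0) (a : Oct) : ⟪octMul i a, a⟫_ℝ = 0 := by
  have h := inner_octMul_of_imag hi a a
  rw [real_inner_comm (octMul i a) a] at h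
  linarith

/-- The reflection attached to the quaternion algebra of i and a + b fixes a + b. The condition ⟪i
a, b⟫ = 0 makes a - b orthogonal to that algebra, so it changes sign and a goes to b. -/
theorem exists_spin7_swap {i a b : Oct} (hi : i 7 = 0) (ha : a 7 = 0) (hb : b 7 = 0)
    (hii : ⟪i, i⟫_ℝ = 1) (haa : ⟪a, a⟫_ℝ = 1) (hbb : ⟪b, b⟫_ℝ = 1) (hia : ⟪i, a⟫_ℝ = 0)
    (hib : ⟪i, b⟫_ℝ = 0) (hab : a + b ≠ 0) (h : ⟪octMul i a, b⟫_ℝ = 0) :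
    ∃ g : Spin7, toEndo g (ε 7) = ε 7 ∧ toEndo g i = i ∧ toEndo g a = b ∧
      ∀ x, x 7 = 0 → ⟪i, x⟫_ℝ = 0 → ⟪a, x⟫_ℝ = 0 → ⟪b, x⟫_ℝ = 0 → ⟪octMul i a, x⟫_ℝ = 0 →
        ⟪octMul i b, x⟫_ℝ = 0 → toEndo g x = -x := by
  have hn : ‖a + b‖ ≠ 0 := norm_ne_zero_iff.mpr hab
  obtain ⟨g, g1, gi, gm, gx⟩ := exists_spin7_reflection (i := i) (m := ‖a + b‖⁻¹ • (a + b)) hi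
    (by simp [ha, hb]) hii
    (by rw [real_inner_smul_left, real_inner_smul_right, real_inner_self_eq_norm_sq]; field_simp)
    (by rw [real_inner_smul_right, inner_add_right, hia, hib]; simp)
  have gm' : toEndo g (a + b) = a + b := by
    rw [map_smul] at gm
    exact smul_right_injective _ (inv_ne_zero hn) gm
  have hba : ⟪octMul i b, a⟫_ℝ = 0 := by
    rw [inner_octMul_of_imag hi, real_inner_comm, h, neg_zero]
  have gd : toEndo g (a - b) = -(a - b) := by
    refine gx _ (by simp [ha, hb]) (by rw [inner_sub_right, hia, hib, sub_zero]) ?_ ?_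
    · rw [real_inner_smul_left, inner_sub_right, inner_add_left, inner_add_left, haa, hbb,
        real_inner_comm a b]; ring
    · rw [octMul_smul_right, octMul_add_right, real_inner_smul_left, inner_add_left,
        inner_sub_right, inner_sub_right, inner_octMul_self_eq_zero hi,
        inner_octMul_self_eq_zero hi, h, hba]; ring
  refine ⟨g, g1, gi, ?_, fun x hx hix hax hbx h1 h2 => gx x hx hix ?_ ?_⟩
  · have e : (2 : ℝ) • toEndo g a = (2 : ℝ) • b := by
      rw [← map_smul, show (2 : ℝ) • a = (a + b) + (a - b) by module, map_add, gm', gd]; module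
    exact smul_right_injective _ two_ne_zero e
  · rw [real_inner_smul_left, inner_add_left, hax, hbx]; ring
  · rw [octMul_smul_right, octMul_add_right, real_inner_smul_left, inner_add_left, h1, h2]; ring

theorem add_ne_zero_of_inner {a b : Oct} (haa : ⟪a, a⟫_ℝ = 1) (hab : ⟪a, b⟫_ℝ = 0) :
    a + b ≠ 0 := fun h => by
  have := congrArg (fun t => ⟪a, t⟫_ℝ) h
  simp only [inner_add_right, haa, hab, inner_zero_right] at this
  norm_num at this

/-- If a ⟂ b, a swap with an auxiliary i works. The general case passes through a unit vector c
orthogonal to both, which avoids the exceptional case a + b = 0. -/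
theorem exists_spin7_fix_one {a b : Oct} (ha : a 7 = 0) (hb : b 7 = 0) (haa : ⟪a, a⟫_ℝ = 1)
    (hbb : ⟪b, b⟫_ℝ = 1) : ∃ g : Spin7, toEndo g (ε 7) = ε 7 ∧ toEndo g a = b := by
  have key : ∀ {a b : Oct}, a 7 = 0 → b 7 = 0 → ⟪a, a⟫_ℝ = 1 → ⟪b, b⟫_ℝ = 1 → ⟪a, b⟫_ℝ = 0 →
      ∃ g : Spin7, toEndo g (ε 7) = ε 7 ∧ toEndo g a = b := fun {a b} ha hb haa hbb hab => by
    obtain ⟨i, hii, hi⟩ := exists_unit_orthogonal (by norm_num) ![ε 7, a, b, octMul b a]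
    have hi7 : i 7 = 0 := by simpa using hi 0
    obtain ⟨g, g1, -, g2, -⟩ := exists_spin7_swap hi7 ha hb hii haa hbb (hi 1) (hi 2)
      (add_ne_zero_of_inner haa hab) (by
        rw [inner_octMul_left, octConj_of_imag ha, octMul_neg_right, inner_neg_right]
        exact neg_eq_zero.mpr (hi 3))
    exact ⟨g, g1, g2⟩
  obtain ⟨c, hcc, hc⟩ := exists_unit_orthogonal (by norm_num) ![ε 7, a, b]
  have hc7 : c 7 = 0 := by simpa using hc 0
  obtain ⟨g, g1, g2⟩ := key ha hc7 haa hcc ((real_inner_comm _ _).trans (hc 1))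
  obtain ⟨g', g1', g2'⟩ := key hc7 hb hcc hbb (hc 2)
  exact ⟨g' * g, by rw [toEndo_mul_apply, g1, g1'], by rw [toEndo_mul_apply, g2, g2']⟩

/-- Two swaps through a c orthogonal to 1, i, a, ia, b, ib; these are six conditions in dimension
eight. -/
theorem exists_spin7_fix_two {i a b : Oct} (hi : i 7 = 0) (ha : a 7 = 0) (hb : b 7 = 0)
    (hii : ⟪i, i⟫_ℝ = 1) (haa : ⟪a, a⟫_ℝ = 1) (hbb : ⟪b, b⟫_ℝ = 1) (hia : ⟪i, a⟫_ℝ = 0)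
    (hib : ⟪i, b⟫_ℝ = 0) :
    ∃ g : Spin7, toEndo g (ε 7) = ε 7 ∧ toEndo g i = i ∧ toEndo g a = b := by
  obtain ⟨c, hcc, hc⟩ := exists_unit_orthogonal (by norm_num)
    ![ε 7, i, a, octMul i a, b, octMul i b]
  have hc7 : c 7 = 0 := by simpa using hc 0
  have hic : ⟪i, c⟫_ℝ = 0 := (real_inner_comm _ _).trans (hc 1)
  obtain ⟨g, g1, g2, g3, -⟩ := exists_spin7_swap hi ha hc7 hii haa hcc hia hic
    (add_ne_zero_of_inner haa ((real_inner_comm _ _).trans (hc 2)))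
    ((real_inner_comm _ _).trans (hc 3))
  obtain ⟨g', g1', g2', g3', -⟩ := exists_spin7_swap hi hc7 hb hii hcc hbb hic hib
    (add_ne_zero_of_inner hcc (hc 4)) (by
      rw [inner_octMul_of_imag hi]; exact neg_eq_zero.mpr (hc 5))
  exact ⟨g' * g, by rw [toEndo_mul_apply, g1, g1'], by rw [toEndo_mul_apply, g2, g2'],
    by rw [toEndo_mul_apply, g3, g3']⟩

/-- A swap of a and b fixes i but negates j. The swap of b with itself negates j once more, so their
composition fixes j and still maps a to b. -/
theorem exists_spin7_fix_three {i j a b : Oct} (hi : i 7 = 0) (hj : j 7 = 0) (ha : a 7 = 0)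
    (hb : b 7 = 0) (hii : ⟪i, i⟫_ℝ = 1) (haa : ⟪a, a⟫_ℝ = 1)
    (hbb : ⟪b, b⟫_ℝ = 1) (hij : ⟪i, j⟫_ℝ = 0) (hia : ⟪i, a⟫_ℝ = 0) (hib : ⟪i, b⟫_ℝ = 0)
    (hja : ⟪j, a⟫_ℝ = 0) (hjb : ⟪j, b⟫_ℝ = 0) (hka : ⟪octMul i j, a⟫_ℝ = 0)
    (hkb : ⟪octMul i j, b⟫_ℝ = 0) :
    ∃ g : Spin7, toEndo g (ε 7) = ε 7 ∧ toEndo g i = i ∧ toEndo g j = j ∧ toEndo g a = b := by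
  have key : ∀ {a b : Oct}, a 7 = 0 → b 7 = 0 → ⟪a, a⟫_ℝ = 1 → ⟪b, b⟫_ℝ = 1 → ⟪i, a⟫_ℝ = 0 →
      ⟪i, b⟫_ℝ = 0 → ⟪j, a⟫_ℝ = 0 → ⟪j, b⟫_ℝ = 0 → ⟪octMul i j, a⟫_ℝ = 0 →
      ⟪octMul i j, b⟫_ℝ = 0 → a + b ≠ 0 → ⟪octMul i a, b⟫_ℝ = 0 →
      ∃ g : Spin7, toEndo g (ε 7) = ε 7 ∧ toEndo g i = i ∧ toEndo g a = b ∧ toEndo g j = -j := by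
    intro a b ha hb haa hbb hia hib hja hjb hka hkb hab h
    obtain ⟨g, g1, g2, g3, g4⟩ := exists_spin7_swap hi ha hb hii haa hbb hia hib hab h
    refine ⟨g, g1, g2, g3, g4 j hj hij ((real_inner_comm _ _).trans hja)
      ((real_inner_comm _ _).trans hjb) ?_ ?_⟩
    · rw [inner_octMul_of_imag hi, real_inner_comm, hka, neg_zero]
    · rw [inner_octMul_of_imag hi, real_inner_comm, hkb, neg_zero]
  have key2 : ∀ {a b : Oct}, a 7 = 0 → b 7 = 0 → ⟪a, a⟫_ℝ = 1 → ⟪b, b⟫_ℝ = 1 → ⟪i, a⟫_ℝ = 0 →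
      ⟪i, b⟫_ℝ = 0 → ⟪j, a⟫_ℝ = 0 → ⟪j, b⟫_ℝ = 0 → ⟪octMul i j, a⟫_ℝ = 0 →
      ⟪octMul i j, b⟫_ℝ = 0 → a + b ≠ 0 → ⟪octMul i a, b⟫_ℝ = 0 →
      ∃ g : Spin7, toEndo g (ε 7) = ε 7 ∧ toEndo g i = i ∧ toEndo g j = j ∧ toEndo g a = b := by
    intro a b ha hb haa hbb hia hib hja hjb hka hkb hab h
    obtain ⟨g, g1, g2, g3, g4⟩ := key ha hb haa hbb hia hib hja hjb hka hkb hab h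
    have hbb0 : b + b ≠ 0 := fun h0 => by
      have h2 : (2 : ℝ) • b = 0 := by rwa [two_smul]
      have : b = 0 := by simpa using h2
      simp [this] at hbb
    obtain ⟨g', g1', g2', g3', g4'⟩ := key hb hb hbb hbb hib hib hjb hjb hkb hkb hbb0
      (inner_octMul_self_eq_zero hi b)
    exact ⟨g' * g, by rw [toEndo_mul_apply, g1, g1'], by rw [toEndo_mul_apply, g2, g2'],
      by rw [toEndo_mul_apply, g4, map_neg, g4', neg_neg], by rw [toEndo_mul_apply, g3, g3']⟩
  have hc : ∃ c : Oct, ⟪c, c⟫_ℝ = 1 ∧ c 7 = 0 ∧ ⟪i, c⟫_ℝ = 0 ∧ ⟪j, c⟫_ℝ = 0 ∧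
      ⟪octMul i j, c⟫_ℝ = 0 ∧ ⟪octMul i a, c⟫_ℝ = 0 ∧ ⟪octMul i b, c⟫_ℝ = 0 ∧ ⟪a, c⟫_ℝ = 0 ∧
      c + b ≠ 0 := by
    -- Seven conditions in dimension eight leave no room to require c ⟂ b as well. The weaker c + b
    -- ≠ 0 suffices for the second swap and is achieved by the choice of the sign of c.
    obtain ⟨c, hcc, hc⟩ := exists_unit_orthogonal (by norm_num)
      ![ε 7, i, j, octMul i j, octMul i a, octMul i b, a]
    have hc' := fun l => (real_inner_comm _ _).trans (hc l)
    have hc7 : c 7 = 0 := by simpa using hc 0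
    by_cases hcb : c + b = 0
    · refine ⟨-c, by simpa using hcc, by simpa using hc7, ?_, ?_, ?_, ?_, ?_, ?_, ?_⟩
      · rw [inner_neg_right]; exact neg_eq_zero.mpr (hc' 1)
      · rw [inner_neg_right]; exact neg_eq_zero.mpr (hc' 2)
      · rw [inner_neg_right]; exact neg_eq_zero.mpr (hc' 3)
      · rw [inner_neg_right]; exact neg_eq_zero.mpr (hc' 4)
      · rw [inner_neg_right]; exact neg_eq_zero.mpr (hc' 5)
      · rw [inner_neg_right]; exact neg_eq_zero.mpr (hc' 6)
      · intro h
        have hb0 : b = c := by rw [eq_comm, ← sub_eq_zero, ← neg_eq_zero, ← h]; abel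
        rw [hb0, ← two_smul ℝ] at hcb
        have : c = 0 := by simpa using hcb
        simp [this] at hcc
    · exact ⟨c, hcc, hc7, hc' 1, hc' 2, hc' 3, hc' 4, hc' 5, hc' 6, hcb⟩
  obtain ⟨c, hcc, hc7, hic, hjc, hkc, h1, h2, hac, hcb⟩ := hc
  obtain ⟨g, g1, g2, g3, g4⟩ := key2 ha hc7 haa hcc hia hic hja hjc hka hkc
    (add_ne_zero_of_inner haa hac) h1
  obtain ⟨g', g1', g2', g3', g4'⟩ := key2 hc7 hb hcc hbb hic hib hjc hjb hkc hkb hcb (by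
    rw [inner_octMul_of_imag hi, real_inner_comm, h2, neg_zero])
  exact ⟨g' * g, by rw [toEndo_mul_apply, g1, g1'], by rw [toEndo_mul_apply, g2, g2'],
    by rw [toEndo_mul_apply, g3, g3'], by rw [toEndo_mul_apply, g4, g4']⟩

/-- Four orthonormal vectors the last of which is orthogonal to the triple cross product of the
others. `Spin(7)` acts simply transitively on these. -/
structure IsSpinFrame (a b c d : Oct) : Prop where
  aa : ⟪a, a⟫_ℝ = 1
  bb : ⟪b, b⟫_ℝ = 1
  cc : ⟪c, c⟫_ℝ = 1
  dd : ⟪d, d⟫_ℝ = 1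
  ab : ⟪a, b⟫_ℝ = 0
  ac : ⟪a, c⟫_ℝ = 0
  ad : ⟪a, d⟫_ℝ = 0
  bc : ⟪b, c⟫_ℝ = 0
  bd : ⟪b, d⟫_ℝ = 0
  cd : ⟪c, d⟫_ℝ = 0
  cross : ⟪cross3 a b c, d⟫_ℝ = 0

theorem IsSpinFrame.map {a b c d : Oct} (h : IsSpinFrame a b c d) (g : Spin7) :
    IsSpinFrame (toEndo g a) (toEndo g b) (toEndo g c) (toEndo g d) := by
  constructor <;> simp only [cross3_toEndo, inner_toEndo]
  exacts [h.aa, h.bb, h.cc, h.dd, h.ab, h.ac, h.ad, h.bc, h.bd, h.cd, h.cross]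

theorem IsSpinFrame.exists_map_standard {a b c d : Oct} (h : IsSpinFrame a b c d) :
    ∃ g : Spin7, toEndo g a = ε 7 ∧ toEndo g b = ε 4 ∧ toEndo g c = ε 5 ∧ toEndo g d = ε 0 := by
  obtain ⟨g, rfl'⟩ := exists_spin7_map_to_one h.aa
  have h' := h.map g
  rw [rfl'] at h'
  have hb := h'.ab
  rw [inner_ε_left] at hb
  obtain ⟨g₂, g21, g22⟩ := exists_spin7_fix_one hb (b := ε 4) (by simp) h'.bb (by simp)
  have h'' := h'.map g₂
  rw [g21, g22] at h''
  have hc := h''.ac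
  rw [inner_ε_left] at hc
  obtain ⟨g₃, g31, g32, g33⟩ := exists_spin7_fix_two (i := ε 4) (b := ε 5) (by simp) hc (by simp)
    (by simp) h''.cc (by simp) h''.bc (by simp)
  have h3 := h''.map g₃
  rw [g31, g32, g33] at h3
  have hd := h3.ad
  rw [inner_ε_left] at hd
  have hk : octMul (ε 4) (ε 5) = -ε 6 := by
    refine oct_ext ?_ ?_ ?_ ?_ ?_ ?_ ?_ ?_ <;> simp [octMul_coords]
  -- The frame condition on d becomes orthogonality to ε 6, hence to (ε 4)(ε 5) = -ε 6, as
  -- `exists_spin7_fix_three` requires.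
  have hcr : cross3 (ε 7) (ε 4) (ε 5) = ε 6 := by
    rw [cross3_eq_of_orthogonal (by simp) (by simp) (by simp), one_octMul,
      octConj_of_imag (by simp), octMul_neg_left, hk, neg_neg]
  have h6 := h3.cross
  rw [hcr] at h6
  obtain ⟨g₄, g41, g42, g43, g44⟩ := exists_spin7_fix_three (i := ε 4) (j := ε 5) (b := ε 0)
    (by simp) (by simp) hd (by simp) (by simp) h3.dd (by simp) (by simp) h3.bd (by simp)
    h3.cd (by simp) (by rw [hk, inner_neg_left, h6, neg_zero]) (by simp [hk])
  refine ⟨g₄ * (g₃ * (g₂ * g)), ?_, ?_, ?_, ?_⟩ <;> simp only [toEndo_mul_apply]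
  · rw [rfl', g21, g31, g41]
  · rw [g22, g32, g42]
  · rw [g33, g43]
  · rw [g44]

theorem IsSpinFrame.exists_map {a b c d a' b' c' d' : Oct} (h : IsSpinFrame a b c d)
    (h' : IsSpinFrame a' b' c' d') :
    ∃ g : Spin7, toEndo g a = a' ∧ toEndo g b = b' ∧ toEndo g c = c' ∧ toEndo g d = d' := by
  obtain ⟨g, g1, g2, g3, g4⟩ := h.exists_map_standard
  obtain ⟨k, k1, k2, k3, k4⟩ := h'.exists_map_standard
  refine ⟨k⁻¹ * g, ?_, ?_, ?_, ?_⟩ <;> rw [toEndo_mul_apply]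
  · rw [g1, ← k1, toEndo_inv_apply]
  · rw [g2, ← k2, toEndo_inv_apply]
  · rw [g3, ← k3, toEndo_inv_apply]
  · rw [g4, ← k4, toEndo_inv_apply]

/-! ### The explicit element of Spin(7) with a given frame -/

theorem endo_ext {A B : Endo} (h : ∀ i, A (ε i) = B (ε i)) : A = B := by
  ext1 x
  rw [← sum_smul_ε x, map_sum, map_sum]
  simp only [map_smul, h]

/-- The images of the standard basis under the element of `Spin(7)` that maps
`ε 0, ε 1, ε 2, ε 4` to `a, b, c, d`. -/
noncomputable def frameVec (a b c d : Oct) : Fin 8 → Oct :=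
  ![a, b, c, -cross3 a b c, d, cross3 b c d, -cross3 a c d, cross3 a b d]

/-- The element of `Spin(7)` that maps `ε 0, ε 1, ε 2, ε 4` to `a, b, c, d`. -/
noncomputable def frameMap (a b c d : Oct) : Endo :=
  ∑ i, InnerProductSpace.rankOne ℝ (frameVec a b c d i) (ε i)

theorem frameMap_apply_ε (a b c d : Oct) (i : Fin 8) :
    frameMap a b c d (ε i) = frameVec a b c d i := by
  simp [frameMap]

theorem cross3_ε₀₁₂ : cross3 (ε 0) (ε 1) (ε 2) = -ε 3 := by
  refine oct_ext ?_ ?_ ?_ ?_ ?_ ?_ ?_ ?_ <;> simp [cross3_coords, octMul_coords, octConj_coords]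
  norm_num
theorem cross3_ε₁₂₄ : cross3 (ε 1) (ε 2) (ε 4) = ε 5 := by
  refine oct_ext ?_ ?_ ?_ ?_ ?_ ?_ ?_ ?_ <;> simp [cross3_coords, octMul_coords, octConj_coords]
  norm_num
theorem cross3_ε₀₂₄ : cross3 (ε 0) (ε 2) (ε 4) = -ε 6 := by
  refine oct_ext ?_ ?_ ?_ ?_ ?_ ?_ ?_ ?_ <;> simp [cross3_coords, octMul_coords, octConj_coords]
  norm_num
theorem cross3_ε₀₁₄ : cross3 (ε 0) (ε 1) (ε 4) = ε 7 := by
  refine oct_ext ?_ ?_ ?_ ?_ ?_ ?_ ?_ ?_ <;> simp [cross3_coords, octMul_coords, octConj_coords]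
  norm_num

/-- ε 3, ε 5, ε 6, ε 7 are, up to sign, triple products of ε 0, ε 1, ε 2, ε 4, and g commutes with
these. So g is determined by four of its values, through a polynomial formula. -/
theorem frameMap_toEndo (g : Spin7) :
    frameMap (toEndo g (ε 0)) (toEndo g (ε 1)) (toEndo g (ε 2)) (toEndo g (ε 4)) = toEndo g := by
  refine endo_ext fun i => ?_
  rw [frameMap_apply_ε]
  simp only [frameVec, cross3_toEndo, cross3_ε₀₁₂, cross3_ε₁₂₄, cross3_ε₀₂₄, cross3_ε₀₁₄]
  fin_cases i <;> simp

theorem isSpinFrame_ε : IsSpinFrame (ε 0) (ε 1) (ε 2) (ε 4) := by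
  constructor <;> simp [cross3_ε₀₁₂]

/-- No direct check that the formula preserves Φ is needed: transitivity supplies an element with
the given values, and it agrees with the formula. -/
theorem IsSpinFrame.exists_spin7 {a b c d : Oct} (h : IsSpinFrame a b c d) :
    ∃ g : Spin7, toEndo g = frameMap a b c d := by
  obtain ⟨g, rfl, rfl, rfl, rfl⟩ := isSpinFrame_ε.exists_map h
  exact ⟨g, (frameMap_toEndo g).symm⟩

theorem contDiffOn_frameMap {V : Type*} [NormedAddCommGroup V] [NormedSpace ℝ V] {U : Set V}
    {a b c d : V → Oct} (ha : ContDiffOn ℝ ∞ a U) (hb : ContDiffOn ℝ ∞ b U)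
    (hc : ContDiffOn ℝ ∞ c U) (hd : ContDiffOn ℝ ∞ d U) :
    ContDiffOn ℝ ∞ (fun v => frameMap (a v) (b v) (c v) (d v)) U := by
  refine ContDiffOn.sum fun i _ => ?_
  have h : ContDiffOn ℝ ∞ (fun v => frameVec (a v) (b v) (c v) (d v) i) U := by
    simp only [frameVec]
    fin_cases i
    · simpa using ha
    · simpa using hb
    · simpa using hc
    · simpa using (contDiffOn_cross3 ha hb hc).neg
    · simpa using hd
    · simpa using contDiffOn_cross3 hb hc hd
    · simpa using (contDiffOn_cross3 ha hc hd).neg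
    · simpa using contDiffOn_cross3 ha hb hd
  exact (ContinuousLinearMap.smulRightL ℝ Oct Oct (innerSL ℝ (ε i))).contDiff.comp_contDiffOn h

/-! ### Bivectors -/

theorem wedge_apply (x y v : Oct) : wedge x y v = ⟪x, v⟫_ℝ • y - ⟪y, v⟫_ℝ • x := by
  simp [wedge]

/-- The exterior product as a continuous bilinear map. -/
noncomputable def wedgeC : Oct →L[ℝ] Oct →L[ℝ] Endo :=
  LinearMap.toContinuousBilinearMap <| LinearMap.mk₂ ℝ wedge
    (by intros; ext1 v; simp only [wedge_apply, add_apply, inner_add_left]; module)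
    (by intros; ext1 v; simp only [wedge_apply, smul_apply, real_inner_smul_left]; module)
    (by intros; ext1 v; simp only [wedge_apply, add_apply, inner_add_left]; module)
    (by intros; ext1 v; simp only [wedge_apply, smul_apply, real_inner_smul_left]; module)

theorem wedgeC_apply (x y : Oct) : wedgeC x y = wedge x y := rfl

theorem wedge_add_smul_left (x y : Oct) (c : ℝ) : wedge (x + c • y) y = wedge x y := by
  ext1 v
  simp only [wedge_apply, inner_add_left, real_inner_smul_left]
  module

theorem wedge_add_smul_right (x y : Oct) (c : ℝ) : wedge x (y + c • x) = wedge x y := by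
  ext1 v
  simp only [wedge_apply, inner_add_left, real_inner_smul_left]
  module

theorem wedge_smul_smul (x y : Oct) (a b : ℝ) : wedge (a • x) (b • y) = (a * b) • wedge x y := by
  simp only [← wedgeC_apply, map_smul, smul_apply, smul_smul]
  rw [mul_comm]

theorem inner_wedge_apply (x y v w : Oct) :
    ⟪wedge x y v, w⟫_ℝ = ⟪x, v⟫_ℝ * ⟪y, w⟫_ℝ - ⟪y, v⟫_ℝ * ⟪x, w⟫_ℝ := by
  rw [wedge_apply, inner_sub_left, real_inner_smul_left, real_inner_smul_left]

/-- An orthonormal pair of vectors. -/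
structure IsPair (x y : Oct) : Prop where
  xx : ⟪x, x⟫_ℝ = 1
  yy : ⟪y, y⟫_ℝ = 1
  xy : ⟪x, y⟫_ℝ = 0

theorem IsPair.yx {x y : Oct} (h : IsPair x y) : ⟪y, x⟫_ℝ = 0 :=
  (real_inner_comm _ _).trans h.xy

theorem mem_grass {p : Endo} : p ∈ grass ↔ ∃ x y, IsPair x y ∧ p = wedge x y := by
  have h : ∀ x : Oct, ‖x‖ = 1 ↔ ⟪x, x⟫_ℝ = 1 := fun x => by
    rw [real_inner_self_eq_norm_sq, pow_eq_one_iff_of_nonneg (norm_nonneg x) two_ne_zero]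
  constructor
  · rintro ⟨x, y, hx, hy, hxy, rfl⟩
    exact ⟨x, y, ⟨(h x).mp hx, (h y).mp hy, hxy⟩, rfl⟩
  · rintro ⟨x, y, ⟨hx, hy, hxy⟩, rfl⟩
    exact ⟨x, y, (h x).mpr hx, (h y).mpr hy, hxy, rfl⟩

theorem isPair_ε : IsPair (ε 0) (ε 1) := by constructor <;> simp

theorem IsPair.map {x y : Oct} (h : IsPair x y) (g : Spin7) : IsPair (toEndo g x) (toEndo g y) := by
  constructor <;> rw [inner_toEndo]
  exacts [h.xx, h.yy, h.xy]

/-- Any orthonormal pair extends to a frame on which Spin(7) acts transitively. -/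
theorem IsPair.exists_spin7 {x y : Oct} (h : IsPair x y) :
    ∃ g : Spin7, toEndo g (ε 0) = x ∧ toEndo g (ε 1) = y := by
  obtain ⟨c, hcc, hc⟩ := exists_unit_orthogonal (by norm_num) ![x, y]
  obtain ⟨d, hdd, hd⟩ := exists_unit_orthogonal (by norm_num) ![x, y, c, cross3 x y c]
  have hc' := fun l => (real_inner_comm _ _).trans (hc l)
  have hd' := fun l => (real_inner_comm _ _).trans (hd l)
  obtain ⟨g, g1, g2, -, -⟩ := isSpinFrame_ε.exists_map
    (⟨h.xx, h.yy, hcc, hdd, h.xy, hc' 0, hd' 0, hc' 1, hd' 1, hd' 2, hd' 3⟩ : IsSpinFrame x y c d)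
  exact ⟨g, g1, g2⟩

theorem coe_smul_grass (g : Spin7) (p : grass) : ((g • p : grass) : Endo) = conjAct g p := rfl

theorem smul_basePoint (g : Spin7) :
    ((g • basePoint : grass) : Endo) = wedge (toEndo g (ε 0)) (toEndo g (ε 1)) :=
  conjAct_wedge g _ _

theorem exists_smul_basePoint (p : grass) : ∃ g : Spin7, g • basePoint = p := by
  obtain ⟨p, hp⟩ := p
  obtain ⟨x, y, hxy, rfl⟩ := mem_grass.mp hp
  obtain ⟨g, rfl, rfl⟩ := hxy.exists_spin7
  exact ⟨g, Subtype.ext (smul_basePoint g)⟩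

/-- Gram-Schmidt: subtracting from b its component along a changes neither a ∧ b nor the Gram
determinant, which then factors as the product of squared lengths. -/
theorem smul_wedge_mem_grass {a b : Oct} (h : 0 < ⟪a, a⟫_ℝ * ⟪b, b⟫_ℝ - ⟪a, b⟫_ℝ ^ 2) :
    (Real.sqrt (⟪a, a⟫_ℝ * ⟪b, b⟫_ℝ - ⟪a, b⟫_ℝ ^ 2))⁻¹ • wedge a b ∈ grass := by
  have ha : 0 < ⟪a, a⟫_ℝ := by
    rcases (real_inner_self_nonneg (x := a)).lt_or_eq with h1 | h1
    · exact h1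
    · rw [← h1] at h; nlinarith [sq_nonneg ⟪a, b⟫_ℝ]
  set c := b + (-(⟪a, b⟫_ℝ / ⟪a, a⟫_ℝ)) • a with hc
  have hac : ⟪a, c⟫_ℝ = 0 := by
    rw [hc, inner_add_right, real_inner_smul_right]; field_simp; ring
  have hcc : ⟪c, c⟫_ℝ = (⟪a, a⟫_ℝ * ⟪b, b⟫_ℝ - ⟪a, b⟫_ℝ ^ 2) / ⟪a, a⟫_ℝ := by
    conv_lhs => rw [hc]
    rw [inner_add_left, real_inner_smul_left, ← hc, hac, hc, inner_add_right,
      real_inner_smul_right, real_inner_comm a b]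
    field_simp; ring
  have hcpos : 0 < ⟪c, c⟫_ℝ := by rw [hcc]; positivity
  have hsq : Real.sqrt (⟪a, a⟫_ℝ * ⟪b, b⟫_ℝ - ⟪a, b⟫_ℝ ^ 2) = ‖a‖ * ‖c‖ := by
    rw [show ⟪a, a⟫_ℝ * ⟪b, b⟫_ℝ - ⟪a, b⟫_ℝ ^ 2 = ⟪a, a⟫_ℝ * ⟪c, c⟫_ℝ by rw [hcc]; field_simp,
      Real.sqrt_mul ha.le, ← norm_eq_sqrt_real_inner, ← norm_eq_sqrt_real_inner]
  have hna : ‖a‖ ≠ 0 := fun h0 => by rw [real_inner_self_eq_norm_sq, h0] at ha; simp at ha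
  have hnc : ‖c‖ ≠ 0 := fun h0 => by rw [real_inner_self_eq_norm_sq, h0] at hcpos; simp at hcpos
  refine ⟨‖a‖⁻¹ • a, ‖c‖⁻¹ • c, ?_, ?_, ?_, ?_⟩
  · rw [norm_smul, norm_inv, norm_norm, inv_mul_cancel₀ hna]
  · rw [norm_smul, norm_inv, norm_norm, inv_mul_cancel₀ hnc]
  · rw [real_inner_smul_left, real_inner_smul_right, hac]; simp
  · rw [wedge_smul_smul, hsq, mul_inv, hc, wedge_add_smul_right]

section Pair
variable {x y : Oct} (h : IsPair x y)
include h

theorem IsPair.wedge_fst : wedge x y x = y := by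
  rw [wedge_apply, h.xx, h.yx]; simp

theorem IsPair.wedge_snd : wedge x y y = -x := by
  rw [wedge_apply, h.yy, h.xy]; simp

end Pair

theorem wedge_apply_of_orthogonal {x y v : Oct} (hx : ⟪x, v⟫_ℝ = 0) (hy : ⟪y, v⟫_ℝ = 0) :
    wedge x y v = 0 := by
  rw [wedge_apply, hx, hy]; simp

theorem inner_wedge_swap (x y v w : Oct) : ⟪wedge x y v, w⟫_ℝ = -⟪v, wedge x y w⟫_ℝ := by
  rw [inner_wedge_apply, real_inner_comm (wedge x y w), inner_wedge_apply]; ring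

/-! ### The contraction with the Cayley form -/

theorem contract_apply (p : Endo) (v : Oct) : contract p v =
    -((1 / 2 : ℝ) • ∑ i, ∑ j, ⟪p (ε i), ε j⟫_ℝ • cross3 (ε i) (ε j) v) := by
  have h1 : ∀ a b c : Oct, ∑ l, cayleyForm a b c (ε l) • ε l = -cross3 a b c := fun a b c => by
    conv_rhs => rw [← sum_smul_ε (cross3 a b c), ← Finset.sum_neg_distrib]
    refine Finset.sum_congr rfl fun l _ => ?_
    rw [cayleyForm_eq, inner_ε_right, neg_smul]
  have h2 : ∀ a b : Oct, ∑ k, v k • cross3 a b (ε k) = cross3 a b v := fun a b => by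
    conv_rhs => rw [← sum_smul_ε v]
    simp only [← cross3L_apply, map_sum, map_smul]
  simp only [contract, smul_apply, sum_apply,
    InnerProductSpace.rankOne_apply, inner_ε_left]
  rw [← smul_neg, ← Finset.sum_neg_distrib]
  refine congrArg _ (Finset.sum_congr rfl fun i _ => ?_)
  rw [← Finset.sum_neg_distrib]
  refine Finset.sum_congr rfl fun j _ => ?_
  rw [← h2, ← smul_neg, ← Finset.sum_neg_distrib, Finset.smul_sum]
  refine Finset.sum_congr rfl fun k _ => ?_
  rw [← smul_neg, ← h1, Finset.smul_sum, Finset.smul_sum]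
  refine Finset.sum_congr rfl fun l _ => ?_
  module

theorem contract_wedge (x y v : Oct) : contract (wedge x y) v = -cross3 x y v := by
  have h : ∀ x y : Oct, ∑ i, ∑ j, (x i * y j) • cross3 (ε i) (ε j) v = cross3 x y v := by
    intro x y
    conv_rhs => rw [← sum_smul_ε x, ← sum_smul_ε y]
    simp only [← cross3L_apply, map_sum, map_smul, LinearMap.sum_apply, LinearMap.smul_apply,
      Finset.smul_sum, smul_smul]
    rw [Finset.sum_comm]
    simp only [mul_comm]
  rw [contract_apply]
  simp only [inner_wedge_apply]
  simp only [inner_ε_right, sub_smul, Finset.sum_sub_distrib]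
  rw [h, h, cross3_swap_left y x]
  module

/-- The contraction as a linear map. -/
noncomputable def contractL : Endo →ₗ[ℝ] Endo where
  toFun := contract
  map_add' p q := by
    ext1 v
    simp only [add_apply, contract_apply, inner_add_left, add_smul,
      Finset.sum_add_distrib]
    module
  map_smul' c p := by
    ext1 v
    simp only [smul_apply, contract_apply, real_inner_smul_left, mul_smul,
      ← Finset.smul_sum, RingHom.id_apply]
    module

/-- The contraction as a continuous linear map. -/
noncomputable def contractC : Endo →L[ℝ] Endo := contractL.toContinuousLinearMap

theorem contractC_apply (p : Endo) : contractC p = contract p := rfl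

/-- The almost complex structure as a linear map of the base point. -/
noncomputable def acsC : Endo →L[ℝ] Endo →L[ℝ] Endo :=
  (ContinuousLinearMap.compL ℝ Oct Oct Oct - (ContinuousLinearMap.compL ℝ Oct Oct Oct).flip).comp
    contractC

theorem acsC_apply (p : Endo) : acsC p = acs p := rfl

theorem endo_mul_apply (A B : Endo) (v : Oct) : (A * B) v = A (B v) := rfl

theorem acs_apply (p B : Endo) : acs p B = contract p * B - B * contract p := by
  simp only [acs, sub_apply, ContinuousLinearMap.compL_apply, ContinuousLinearMap.flip_apply,
    ContinuousLinearMap.mul_def]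

theorem conjAct_apply (g : Spin7) (B : Endo) (v : Oct) :
    conjAct g B v = toEndo g (B (toEndo g⁻¹ v)) := rfl

theorem contract_conjAct (g : Spin7) {p : Endo} (hp : p ∈ grass) :
    contract (conjAct g p) = conjAct g (contract p) := by
  obtain ⟨x, y, -, rfl⟩ := mem_grass.mp hp
  ext1 v
  rw [conjAct_wedge, conjAct_apply, contract_wedge, contract_wedge, map_neg, ← cross3_toEndo,
    toEndo_apply_inv]

theorem acs_conjAct (g : Spin7) {p : Endo} (hp : p ∈ grass) (B : Endo) :
    acs (conjAct g p) (conjAct g B) = conjAct g (acs p B) := by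
  rw [acs_apply, acs_apply, contract_conjAct g hp]
  ext1 v
  simp only [sub_apply, endo_mul_apply, conjAct_apply,
    toEndo_inv_apply, map_sub]

theorem inner_contract_wedge_swap (x y v w : Oct) :
    ⟪contract (wedge x y) v, w⟫_ℝ = -⟪v, contract (wedge x y) w⟫_ℝ := by
  rw [contract_wedge, contract_wedge, inner_neg_left, inner_neg_right, cross3_cycle,
    cross3_cycle y v x, inner_cross3_swap, cross3_cycle w x y, real_inner_comm]

theorem contract_fst (x y : Oct) : contract (wedge x y) x = 0 := by
  rw [contract_wedge, cross3_self_outer, neg_zero]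

theorem contract_snd (x y : Oct) : contract (wedge x y) y = 0 := by
  rw [contract_wedge, cross3_self_right, neg_zero]

/-- The commutator with a skew endomorphism acts on bivectors as a derivation. -/
theorem acs_wedge_wedge (x y a b : Oct) : acs (wedge x y) (wedge a b) =
    wedge (contract (wedge x y) a) b + wedge a (contract (wedge x y) b) := by
  ext1 v
  rw [acs_apply]
  simp only [sub_apply, endo_mul_apply,
    add_apply, wedge_apply a b, wedge_apply _ b, wedge_apply a,
    inner_contract_wedge_swap, map_sub, map_smul]
  module

theorem contract_basePoint (u : Oct) : contract (wedge (ε 0) (ε 1)) u =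
    !₂[0, 0, -u 3, u 2, u 7, u 6, -u 5, -u 4] := by
  rw [contract_wedge]
  refine oct_ext ?_ ?_ ?_ ?_ ?_ ?_ ?_ ?_ <;>
    simp [cross3_coords, octMul_coords, octConj_coords] <;> ring

/-- By transitivity and equivariance this needs checking only at the base point, where I is
explicit. -/
theorem contract_contract {x y u : Oct} (h : IsPair x y) (hx : ⟪x, u⟫_ℝ = 0) (hy : ⟪y, u⟫_ℝ = 0) :
    contract (wedge x y) (contract (wedge x y) u) = -u := by
  obtain ⟨g, rfl, rfl⟩ := h.exists_spin7
  rw [← conjAct_wedge, contract_conjAct g basePoint_mem, conjAct_apply, conjAct_apply,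
    toEndo_inv_apply]
  rw [inner_toEndo_left, inner_ε_left] at hx hy
  conv_rhs => rw [← toEndo_apply_inv g u, ← map_neg]
  congr 1
  simp only [contract_basePoint]
  refine oct_ext ?_ ?_ ?_ ?_ ?_ ?_ ?_ ?_ <;> simp [hx, hy]

attribute [local irreducible] contract cross3 cross4 octMul wedge

theorem hasDerivAt_clm_comp {V W : Type*} [NormedAddCommGroup V] [NormedSpace ℝ V]
    [NormedAddCommGroup W] [NormedSpace ℝ W] (A : V →L[ℝ] W) {f : ℝ → V} {f' : V} {t : ℝ}
    (h : HasDerivAt f f' t) : HasDerivAt (fun t => A (f t)) (A f') t :=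
  A.hasFDerivAt.comp_hasDerivAt t h

/-! ### Tangent spaces of the Grassmannian -/

section
variable {x y : Oct} (h : IsPair x y)
include h

/-- The curve is the normalized bivector of x + t u and y + t v. Its Gram determinant is 1 + O(t²),
so the normalization does not contribute to the velocity. -/
theorem IsPair.mem_tangent {u v : Oct} (hxu : ⟪x, u⟫_ℝ = 0) (hyu : ⟪y, u⟫_ℝ = 0)
    (hxv : ⟪x, v⟫_ℝ = 0) (hyv : ⟪y, v⟫_ℝ = 0) :
    wedge u y + wedge x v ∈ tangent grass (wedge x y) := by
  set a : ℝ → Oct := fun t => x + t • u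
  set b : ℝ → Oct := fun t => y + t • v
  set f : ℝ → ℝ := fun t => (1 + t ^ 2 * ⟪u, u⟫_ℝ) * (1 + t ^ 2 * ⟪v, v⟫_ℝ) -
    (t ^ 2 * ⟪u, v⟫_ℝ) ^ 2 with hf
  have haa : ∀ t, ⟪a t, a t⟫_ℝ * ⟪b t, b t⟫_ℝ - ⟪a t, b t⟫_ℝ ^ 2 = f t := fun t => by
    simp only [a, b, f, inner_add_left, inner_add_right, real_inner_smul_left,
      real_inner_smul_right, h.xx, h.yy, h.xy, hxu, hyv, hxv, real_inner_comm x u,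
      real_inner_comm y v, real_inner_comm y u, hyu]
    ring
  have hpos : ∀ t, 0 < f t := fun t => by
    have hcs : ⟪u, v⟫_ℝ ^ 2 ≤ ⟪u, u⟫_ℝ * ⟪v, v⟫_ℝ := by
      rw [sq]; exact real_inner_mul_inner_self_le u v
    have h1 : 0 ≤ ⟪u, u⟫_ℝ := real_inner_self_nonneg
    have h2 : 0 ≤ ⟪v, v⟫_ℝ := real_inner_self_nonneg
    have : f t = 1 + t ^ 2 * ⟪u, u⟫_ℝ + t ^ 2 * ⟪v, v⟫_ℝ +
      t ^ 4 * (⟪u, u⟫_ℝ * ⟪v, v⟫_ℝ - ⟪u, v⟫_ℝ ^ 2) := by simp only [f]; ring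
    rw [this]
    have h3 : 0 ≤ t ^ 4 * (⟪u, u⟫_ℝ * ⟪v, v⟫_ℝ - ⟪u, v⟫_ℝ ^ 2) :=
      mul_nonneg (by positivity) (by linarith)
    positivity
  have hfs : ContDiff ℝ ∞ f := by simp only [hf]; fun_prop
  have hg : ContDiff ℝ ∞ fun t => (Real.sqrt (f t))⁻¹ :=
    (hfs.sqrt fun t => (hpos t).ne').inv fun t => (Real.sqrt_pos.mpr (hpos t)).ne'
  have hfa : HasDerivAt f 0 0 := by
    have : HasDerivAt f _ 0 := ((((hasDerivAt_pow 2 (0 : ℝ)).mul_const ⟪u, u⟫_ℝ).const_add 1).mul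
      (((hasDerivAt_pow 2 (0 : ℝ)).mul_const ⟪v, v⟫_ℝ).const_add 1)).sub
      (((hasDerivAt_pow 2 (0 : ℝ)).mul_const ⟪u, v⟫_ℝ).pow 2)
    convert this using 1; simp
  have f0 : f 0 = 1 := by simp [hf]
  have hga : HasDerivAt (fun t => (Real.sqrt (f t))⁻¹) 0 0 := by
    have := (hfa.sqrt (hpos 0).ne').inv (Real.sqrt_pos.mpr (hpos 0)).ne'
    refine this.congr_deriv ?_
    rw [zero_div, neg_zero, zero_div]
  have hab : HasDerivAt (fun t => wedgeC (a t) (b t)) (wedge u y + wedge x v) 0 := by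
    have h1 : HasDerivAt a u 0 :=
      (((hasDerivAt_id (0 : ℝ)).smul_const u).const_add x).congr_deriv (one_smul ℝ u)
    have h2 : HasDerivAt b v 0 :=
      (((hasDerivAt_id (0 : ℝ)).smul_const v).const_add y).congr_deriv (one_smul ℝ v)
    have h3 : HasDerivAt (fun t => wedgeC (a t)) (wedgeC u) 0 :=
      hasDerivAt_clm_comp (W := Oct →L[ℝ] Endo) wedgeC h1
    have a0 : a 0 = x := by simp [a]
    have b0 : b 0 = y := by simp [b]
    have h4 := h3.clm_apply h2
    rw [a0, b0] at h4
    simpa only [wedgeC_apply] using h4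
  refine ⟨fun t => (Real.sqrt (f t))⁻¹ • wedgeC (a t) (b t), ?_, fun t => ?_, ?_, ?_⟩
  · refine hg.smul ((wedgeC.contDiff.comp ?_).clm_apply ?_)
    · exact contDiff_const.add (contDiff_id.smul contDiff_const)
    · exact contDiff_const.add (contDiff_id.smul contDiff_const)
  · beta_reduce
    rw [wedgeC_apply, ← haa]
    exact smul_wedge_mem_grass (by rw [haa]; exact hpos t)
  · simp [f0, a, b, wedgeC_apply]
  · have := hga.smul hab
    refine HasDerivAt.deriv (f := fun t => (Real.sqrt (f t))⁻¹ • wedgeC (a t) (b t)) ?_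
    refine this.congr_deriv ?_
    rw [f0]
    simp

/-- The linearization at `q` of the equations of the Grassmannian. -/
structure IsTangent (q B : Endo) : Prop where
  skew : ∀ v w, ⟪B v, w⟫_ℝ = -⟪v, B w⟫_ℝ
  cube : ∀ v, B (q (q v)) + q (B (q v)) + q (q (B v)) = -B v

omit h in
-- Points of the Grassmannian are skew and satisfy q³ = -q; the two conditions are the derivatives
-- of these equations.
theorem isTangent_of_hasDerivAt {c : ℝ → Endo} {B : Endo} (hcd : HasDerivAt c B 0)
    (hcm : ∀ᶠ t in 𝓝 0, c t ∈ grass) : IsTangent (c 0) B where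
  skew v w := by
    have e : (fun t => ⟪c t v, w⟫_ℝ) =ᶠ[𝓝 0] fun t => -⟪v, c t w⟫_ℝ := hcm.mono fun t ht => by
      obtain ⟨a, b, -, hab⟩ := mem_grass.mp ht
      beta_reduce
      rw [hab, inner_wedge_swap]
    have h1 : HasDerivAt (fun t => ⟪c t v, w⟫_ℝ) ⟪B v, w⟫_ℝ 0 := by
      simpa using (hcd.clm_apply (hasDerivAt_const (0 : ℝ) v)).inner ℝ (hasDerivAt_const (0 : ℝ) w)
    have h2 : HasDerivAt (fun t => ⟪v, c t w⟫_ℝ) ⟪v, B w⟫_ℝ 0 := by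
      simpa using (hasDerivAt_const (0 : ℝ) v).inner ℝ
        (hcd.clm_apply (hasDerivAt_const (0 : ℝ) w))
    exact h1.unique (h2.neg.congr_of_eventuallyEq e)
  cube v := by
    have e : (fun t => c t (c t (c t v))) =ᶠ[𝓝 0] fun t => -c t v := hcm.mono fun t ht => by
      obtain ⟨a, b, hab, hct⟩ := mem_grass.mp ht
      beta_reduce
      rw [hct, wedge_apply a b v]
      simp only [map_sub, map_smul, hab.wedge_fst, hab.wedge_snd, map_neg]
      module
    have h0 := hcd.clm_apply (hasDerivAt_const (0 : ℝ) v)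
    have h1 := hcd.clm_apply (hcd.clm_apply h0)
    have h3 : HasDerivAt (fun t => c t (c t (c t v))) _ 0 := h1
    have := h3.unique (h0.neg.congr_of_eventuallyEq e)
    simp only [map_zero, add_zero, map_add] at this
    rw [← this]; abel

/-- The linearized equations already cut out the tangent space: they force B to exchange the plane
and its complement, and a skew B of this kind is determined by u = -B y and v = B x. -/
theorem IsPair.exists_of_isTangent {B : Endo} (hB : IsTangent (wedge x y) B) :
    ∃ u v : Oct, ⟪x, u⟫_ℝ = 0 ∧ ⟪y, u⟫_ℝ = 0 ∧ ⟪x, v⟫_ℝ = 0 ∧ ⟪y, v⟫_ℝ = 0 ∧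
      B = wedge u y + wedge x v := by
  set p := wedge x y with hp
  obtain ⟨hskew, hcube⟩ := hB
  have px : p x = y := h.wedge_fst
  have py : p y = -x := h.wedge_snd
  have pskew : ∀ v w, ⟪p v, w⟫_ℝ = -⟪v, p w⟫_ℝ := inner_wedge_swap x y
  -- Pairing the cubic equation at x with y gives -3⟪B x, y⟫ = -⟪B x, y⟫.
  have hBxy : ⟪B x, y⟫_ℝ = 0 := by
    have := congrArg (fun t => ⟪t, y⟫_ℝ) (hcube x)
    simp only [inner_add_left, px, py, map_neg, inner_neg_left, pskew, inner_neg_right, hskew,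
      inner_neg_right, neg_neg] at this
    rw [hskew]
    have h2 : ⟪y, B x⟫_ℝ = -⟪x, B y⟫_ℝ := by rw [real_inner_comm, hskew]
    linarith
  have hByx : ⟪B y, x⟫_ℝ = 0 := by rw [hskew, real_inner_comm, hBxy, neg_zero]
  have hd : ∀ v, ⟪B v, v⟫_ℝ = 0 := fun v => by
    have := hskew v v
    rw [real_inner_comm (B v) v] at this; linarith
  refine ⟨-B y, B x, ?_, ?_, ?_, ?_, ?_⟩
  · rw [inner_neg_right, real_inner_comm, hByx, neg_zero]
  · rw [inner_neg_right, real_inner_comm, hd, neg_zero]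
  · rw [real_inner_comm, hd]
  · rw [real_inner_comm, hBxy]
  · ext1 w
    -- For w orthogonal to the plane the cubic equation reduces to p(p(B w)) = -B w, so B w lies in
    -- the plane.
    have key : ∀ w, ⟪x, w⟫_ℝ = 0 → ⟪y, w⟫_ℝ = 0 → B w = ⟪B w, x⟫_ℝ • x + ⟪B w, y⟫_ℝ • y := by
      intro w hx hy
      have h1 := hcube w
      rw [hp, wedge_apply_of_orthogonal hx hy, ← hp] at h1
      simp only [map_zero, zero_add] at h1
      rw [hp, wedge_apply x y (B w), ← hp] at h1
      simp only [map_sub, map_smul, px, py] at h1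
      rw [← neg_neg (B w), ← h1, real_inner_comm x, real_inner_comm y]
      simp only [inner_neg_right, inner_sub_right, real_inner_smul_right, h.xx, h.yy, h.xy, h.yx,
        inner_neg_right]
      module
    set w' := w + (-⟪x, w⟫_ℝ) • x + (-⟪y, w⟫_ℝ) • y with hw'
    have hx : ⟪x, w'⟫_ℝ = 0 := by
      rw [hw', inner_add_right, inner_add_right, real_inner_smul_right, real_inner_smul_right,
        h.xx, h.xy]; ring
    have hy : ⟪y, w'⟫_ℝ = 0 := by
      rw [hw', inner_add_right, inner_add_right, real_inner_smul_right, real_inner_smul_right,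
        h.yy, h.yx]; ring
    have hBw : B w = B w' + ⟪x, w⟫_ℝ • B x + ⟪y, w⟫_ℝ • B y := by
      rw [hw']; simp only [map_add, map_smul]; module
    have h1 : ⟪B w', x⟫_ℝ = -⟪B x, w⟫_ℝ := by
      rw [hskew, hw', inner_add_left, inner_add_left, real_inner_smul_left, real_inner_smul_left,
        real_inner_comm (B x) x, hd, real_inner_comm (B x) y, hBxy, real_inner_comm]; ring
    have h2 : ⟪B w', y⟫_ℝ = -⟪B y, w⟫_ℝ := by
      rw [hskew, hw', inner_add_left, inner_add_left, real_inner_smul_left, real_inner_smul_left,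
        real_inner_comm (B y) x, hByx, real_inner_comm (B y) y, hd, real_inner_comm]; ring
    rw [hBw, key w' hx hy, h1, h2, add_apply, wedge_apply, wedge_apply, inner_neg_left]
    module

theorem IsPair.exists_of_mem_tangent {B : Endo} (hB : B ∈ tangent grass (wedge x y)) :
    ∃ u v : Oct, ⟪x, u⟫_ℝ = 0 ∧ ⟪y, u⟫_ℝ = 0 ∧ ⟪x, v⟫_ℝ = 0 ∧ ⟪y, v⟫_ℝ = 0 ∧
      B = wedge u y + wedge x v := by
  obtain ⟨c, hc, hcm, hc0, rfl⟩ := hB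
  apply h.exists_of_isTangent
  rw [← hc0]
  exact isTangent_of_hasDerivAt (hc.differentiable (by simp) 0).hasDerivAt
    (Filter.Eventually.of_forall hcm)

theorem IsPair.wedge_add_wedge_apply_fst {u v : Oct} (hxu : ⟪x, u⟫_ℝ = 0) (hxv : ⟪x, v⟫_ℝ = 0) :
    (wedge u y + wedge x v) x = v := by
  rw [add_apply, wedge_apply, wedge_apply, real_inner_comm, hxu, h.yx, h.xx,
    real_inner_comm, hxv]; simp

theorem IsPair.wedge_add_wedge_apply_snd {u v : Oct} (hyu : ⟪y, u⟫_ℝ = 0) (hyv : ⟪y, v⟫_ℝ = 0) :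
    (wedge u y + wedge x v) y = -u := by
  rw [add_apply, wedge_apply, wedge_apply, real_inner_comm, hyu, h.yy, h.xy,
    real_inner_comm, hyv]; simp

omit h in
theorem inner_contract_eq_zero (x y u : Oct) :
    ⟪x, contract (wedge x y) u⟫_ℝ = 0 ∧ ⟪y, contract (wedge x y) u⟫_ℝ = 0 := by
  constructor
  · rw [← neg_eq_zero, ← inner_contract_wedge_swap, contract_fst, inner_zero_left]
  · rw [← neg_eq_zero, ← inner_contract_wedge_swap, contract_snd, inner_zero_left]

omit h in
theorem acs_tangent (x y u v : Oct) : acs (wedge x y) (wedge u y + wedge x v) =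
    wedge (contract (wedge x y) u) y + wedge x (contract (wedge x y) v) := by
  have h0 : ∀ a, wedge a 0 = 0 ∧ wedge 0 a = 0 := fun a => by simp [← wedgeC_apply]
  rw [map_add, acs_wedge_wedge, acs_wedge_wedge, contract_fst, contract_snd, (h0 u).1, (h0 v).2,
    add_zero, zero_add]

end

theorem contDiff_clm {V W : Type*} [NormedAddCommGroup V] [NormedSpace ℝ V]
    [NormedAddCommGroup W] [NormedSpace ℝ W] (A : V →L[ℝ] W) : ContDiff ℝ ∞ fun x => A x :=
  A.contDiff

theorem contDiff_acs : ContDiff ℝ ∞ acs := by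
  have h : acs = fun p => acsC p := rfl
  rw [h]
  exact contDiff_clm (V := Endo) (W := Endo →L[ℝ] Endo) acsC

theorem acs_mem_tangent {p B : Endo} (hp : p ∈ grass) (hB : B ∈ tangent grass p) :
    acs p B ∈ tangent grass p := by
  obtain ⟨x, y, h, rfl⟩ := mem_grass.mp hp
  obtain ⟨u, v, -, -, -, -, rfl⟩ := h.exists_of_mem_tangent hB
  rw [acs_tangent]
  exact h.mem_tangent (inner_contract_eq_zero x y u).1 (inner_contract_eq_zero x y u).2
    (inner_contract_eq_zero x y v).1 (inner_contract_eq_zero x y v).2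

theorem wedge_neg_left (x y : Oct) : wedge (-x) y = -wedge x y := by
  ext1 v; simp [wedge_apply]; abel

theorem wedge_neg_right (x y : Oct) : wedge x (-y) = -wedge x y := by
  ext1 v; simp [wedge_apply]; abel

theorem acs_acs {p B : Endo} (hp : p ∈ grass) (hB : B ∈ tangent grass p) :
    acs p (acs p B) = -B := by
  obtain ⟨x, y, h, rfl⟩ := mem_grass.mp hp
  obtain ⟨u, v, h1, h2, h3, h4, rfl⟩ := h.exists_of_mem_tangent hB
  rw [acs_tangent, acs_tangent, contract_contract h h1 h2, contract_contract h h3 h4,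
    wedge_neg_left, wedge_neg_right, neg_add]

theorem isAlmostComplex_acs : IsAlmostComplex grass acs :=
  ⟨⟨Set.univ, isOpen_univ, Set.subset_univ _, contDiff_acs.contDiffOn⟩,
    fun _ hp _ hB => acs_mem_tangent hp hB, fun _ hp _ hB => acs_acs hp hB⟩

/-! ### Complex coordinates -/

/-- The complex coordinates as a linear map. -/
noncomputable def complexCoordL : Oct →ₗ[ℝ] (Fin 3 → ℂ) where
  toFun := complexCoord
  map_add' x y := by
    funext i; fin_cases i <;> simp [complexCoord] <;> ring
  map_smul' c x := by
    funext i; fin_cases i <;> simp [complexCoord] <;> ring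

theorem complexCoordL_apply (x : Oct) : complexCoordL x = complexCoord x := rfl

/-- This fixes the signs in the coordinates: they are those for which I at the base point becomes
multiplication by i. -/
theorem complexCoord_contract (u : Oct) :
    complexCoord (contract (wedge (ε 0) (ε 1)) u) = Complex.I • complexCoord u := by
  rw [contract_basePoint]
  funext i; fin_cases i <;> simp [complexCoord] <;> ring_nf <;> simp

theorem eq_of_complexCoord_eq {u v : Oct} (h : complexCoord u = complexCoord v) (h0 : u 0 = v 0)
    (h1 : u 1 = v 1) : u = v := by
  have a0 := congrFun h 0
  have a1 := congrFun h 1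
  have a2 := congrFun h 2
  simp [complexCoord, Complex.ext_iff] at a0 a1 a2
  exact oct_ext h0 h1 a0.1 a0.2 a2.1 a1.1 a1.2 a2.2

theorem zeta_zero (g : Spin7) (X : Endo) :
    zeta g 0 X = complexCoord (toEndo g⁻¹ (X (ε 0))) := by
  simp only [zeta, omega, inner_toEndo_left, inner_ε_left, complexCoord, Fin.castLE_zero]

theorem zeta_one (g : Spin7) (X : Endo) :
    zeta g 1 X = complexCoord (toEndo g⁻¹ (X (ε 1))) := by
  simp only [zeta, omega, inner_toEndo_left, inner_ε_left, complexCoord,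
    show Fin.castLE (by decide) (1 : Fin 2) = (1 : Fin 8) from rfl]

theorem inner_of_mem_tangent_spin7Set {g : Spin7} {X : Endo} (hX : X ∈ tangent spin7Set (toEndo g))
    (v : Oct) : ⟪toEndo g v, X v⟫_ℝ = 0 := by
  obtain ⟨c, hc, hcm, hc0, rfl⟩ := hX
  have hcd := ((hc.differentiable (by simp) 0).hasDerivAt).clm_apply (hasDerivAt_const (0 : ℝ) v)
  have h1 := hcd.inner ℝ hcd
  have h2 : (fun t => ⟪c t v, c t v⟫_ℝ) = fun _ => ⟪v, v⟫_ℝ := by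
    funext t
    obtain ⟨k, hk⟩ := hcm t
    rw [← hk, inner_toEndo]
  rw [h2] at h1
  have h3 := h1.unique (hasDerivAt_const (0 : ℝ) _)
  simp only [map_zero, add_zero, hc0] at h3
  rw [real_inner_comm (deriv c 0 v)] at h3
  rw [real_inner_comm]
  linarith

/-- In the frame g, `zeta g a X` is the complex coordinate vector of g⁻¹ X(ε a), and J acts on the
normal components of X(ε 0) and X(ε 1) by multiplication with i. -/
theorem zeta_type (g : Spin7) {X Y : Endo} (hX : X ∈ tangent spin7Set (toEndo g))
    (hY : Y ∈ tangent spin7Set (toEndo g)) :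
    acs (g • basePoint : grass) (dOrbit g X) = dOrbit g Y ↔
      ∀ a, zeta g a Y = Complex.I • zeta g a X := by
  have hp := isPair_ε.map g
  set x := toEndo g (ε 0) with hx
  set y := toEndo g (ε 1) with hy
  have hu : ∀ {Z : Endo}, Z ∈ tangent spin7Set (toEndo g) → ∃ u v : Oct, ⟪x, u⟫_ℝ = 0 ∧
      ⟪y, u⟫_ℝ = 0 ∧ ⟪x, v⟫_ℝ = 0 ∧ ⟪y, v⟫_ℝ = 0 ∧ dOrbit g Z = wedge u y + wedge x v ∧
      zeta g 0 Z = complexCoord (toEndo g⁻¹ u) ∧ zeta g 1 Z = complexCoord (toEndo g⁻¹ v) := by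
    intro Z hZ
    have hc1 : complexCoordL (ε 1) = 0 := by
      funext i; fin_cases i <;> simp [complexCoordL_apply, complexCoord]
    have hc0 : complexCoordL (ε 0) = 0 := by
      funext i; fin_cases i <;> simp [complexCoordL_apply, complexCoord]
    -- The components inside the plane are removed. They contribute neither to the bivector nor to
    -- the coordinates, which ignore ε 0 and ε 1.
    refine ⟨Z (ε 0) + (-⟪y, Z (ε 0)⟫_ℝ) • y, Z (ε 1) + (-⟪x, Z (ε 1)⟫_ℝ) • x, ?_, ?_, ?_, ?_, ?_,
      ?_, ?_⟩
    · rw [inner_add_right, real_inner_smul_right, hp.xy, inner_of_mem_tangent_spin7Set hZ]; ring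
    · rw [inner_add_right, real_inner_smul_right, hp.yy]; ring
    · rw [inner_add_right, real_inner_smul_right, hp.xx]; ring
    · rw [inner_add_right, real_inner_smul_right, hp.yx, inner_of_mem_tangent_spin7Set hZ]; ring
    · rw [wedge_add_smul_left, wedge_add_smul_right, dOrbit]
    · rw [zeta_zero, map_add, map_smul, hy, toEndo_inv_apply, ← complexCoordL_apply,
        ← complexCoordL_apply, map_add, map_smul, hc1, smul_zero, add_zero]
    · rw [zeta_one, map_add, map_smul, hx, toEndo_inv_apply, ← complexCoordL_apply,
        ← complexCoordL_apply, map_add, map_smul, hc0, smul_zero, add_zero]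
  have hI : ∀ {u w : Oct}, ⟪x, w⟫_ℝ = 0 → ⟪y, w⟫_ℝ = 0 →
      (contract (wedge x y) u = w ↔
        complexCoord (toEndo g⁻¹ w) = Complex.I • complexCoord (toEndo g⁻¹ u)) := by
    intro u w hxw hyw
    rw [hx, inner_toEndo_left, inner_ε_left] at hxw
    rw [hy, inner_toEndo_left, inner_ε_left] at hyw
    rw [hx, hy, ← conjAct_wedge, contract_conjAct g basePoint_mem, conjAct_apply]
    constructor
    · rintro rfl
      rw [toEndo_inv_apply, complexCoord_contract]
    · intro h
      rw [← complexCoord_contract] at h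
      rw [← eq_of_complexCoord_eq h, toEndo_apply_inv]
      · rw [hxw, contract_basePoint]; rfl
      · rw [hyw, contract_basePoint]; rfl
  obtain ⟨u, v, hu1, hu2, hv1, hv2, hX', hX0, hX1⟩ := hu hX
  obtain ⟨u', v', hu1', hu2', hv1', hv2', hY', hY0, hY1⟩ := hu hY
  rw [smul_basePoint, hX', hY', acs_tangent, Fin.forall_fin_two, hX0, hX1, hY0, hY1,
    ← hI hu1' hu2', ← hI hv1' hv2']
  constructor
  · intro h
    have hf := congrArg (fun T : Endo => T x) h
    have hs := congrArg (fun T : Endo => T y) h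
    beta_reduce at hf hs
    rw [hp.wedge_add_wedge_apply_fst (inner_contract_eq_zero x y u).1
      (inner_contract_eq_zero x y v).1, hp.wedge_add_wedge_apply_fst hu1' hv1'] at hf
    rw [hp.wedge_add_wedge_apply_snd (inner_contract_eq_zero x y u).2
      (inner_contract_eq_zero x y v).2, hp.wedge_add_wedge_apply_snd hu2' hv2', neg_inj] at hs
    exact ⟨hs, hf⟩
  · rintro ⟨h1, h2⟩
    rw [h1, h2]

/-! ### Normalization of bivectors -/

theorem sum_inner_wedge (a b : Oct) : ∑ i, ⟪wedge a b (ε i), wedge a b (ε i)⟫_ℝ =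
    2 * (⟪a, a⟫_ℝ * ⟪b, b⟫_ℝ - ⟪a, b⟫_ℝ ^ 2) := by
  have h : ∀ i, ⟪wedge a b (ε i), wedge a b (ε i)⟫_ℝ =
      a i ^ 2 * ⟪b, b⟫_ℝ - 2 * (a i * b i) * ⟪a, b⟫_ℝ + b i ^ 2 * ⟪a, a⟫_ℝ := fun i => by
    rw [wedge_apply, inner_ε_right, inner_ε_right]
    simp only [inner_sub_left, inner_sub_right, real_inner_smul_left, real_inner_smul_right,
      real_inner_comm a b]
    ring
  simp only [h]
  simp only [Fin.sum_univ_eight, inner_eq_sum]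
  ring

/-- The Gram determinant is half the squared Hilbert-Schmidt norm of the bivector, so it depends
only on a ∧ b. -/
theorem gram_eq_of_wedge_eq {a b x y : Oct} {t : ℝ} (hxy : IsPair x y)
    (h : wedge a b = t • wedge x y) : ⟪a, a⟫_ℝ * ⟪b, b⟫_ℝ - ⟪a, b⟫_ℝ ^ 2 = t ^ 2 := by
  have h1 := sum_inner_wedge a b
  rw [h] at h1
  simp only [smul_apply, real_inner_smul_left, real_inner_smul_right, ← Finset.mul_sum,
    sum_inner_wedge, hxy.xx, hxy.yy, hxy.xy] at h1
  linarith

theorem normalize_wedge {a b : Oct} {q : Endo} {t : ℝ} (hq : q ∈ grass) (ht : 0 < t)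
    (h : wedge a b = t • q) : 0 < ⟪a, a⟫_ℝ * ⟪b, b⟫_ℝ - ⟪a, b⟫_ℝ ^ 2 ∧
      (Real.sqrt (⟪a, a⟫_ℝ * ⟪b, b⟫_ℝ - ⟪a, b⟫_ℝ ^ 2))⁻¹ • wedge a b = q := by
  obtain ⟨x, y, hxy, rfl⟩ := mem_grass.mp hq
  rw [gram_eq_of_wedge_eq hxy h, Real.sqrt_sq ht.le, h, smul_smul, inv_mul_cancel₀ ht.ne']
  exact ⟨by positivity, one_smul _ _⟩

/-- Decomposability of q in a form without a chosen basis: the vectors q v and q w, which depend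
smoothly on q, frame the plane wherever ⟪q v, w⟫ ≠ 0. Charts and local frames of cones come from
this. -/
theorem wedge_apply_apply {q : Endo} (hq : q ∈ grass) (v w : Oct) :
    wedge (-q w) (q v) = ⟪q v, w⟫_ℝ • q := by
  obtain ⟨x, y, -, rfl⟩ := mem_grass.mp hq
  ext1 z
  rw [smul_apply, wedge_apply, inner_neg_left, inner_wedge_apply, inner_wedge_apply,
    inner_wedge_apply, wedge_apply x y v, wedge_apply x y w, wedge_apply x y z]
  module

theorem inner_apply_swap {q : Endo} (hq : q ∈ grass) (v w : Oct) : ⟪q v, w⟫_ℝ = -⟪v, q w⟫_ℝ := by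
  obtain ⟨x, y, -, rfl⟩ := mem_grass.mp hq
  exact inner_wedge_swap x y v w

theorem inner_apply_self {q : Endo} (hq : q ∈ grass) (v : Oct) : ⟪q v, v⟫_ℝ = 0 := by
  have h := inner_apply_swap hq v v
  rw [real_inner_comm (q v) v] at h
  linarith

theorem apply_apply_apply {q : Endo} (hq : q ∈ grass) (v : Oct) : q (q (q v)) = -q v := by
  obtain ⟨x, y, h, rfl⟩ := mem_grass.mp hq
  rw [wedge_apply x y v]
  simp only [map_sub, map_smul, h.wedge_fst, h.wedge_snd, map_neg]
  module

theorem isPair_apply {q : Endo} (hq : q ∈ grass) {z : Oct} (hz : ⟪q z, q z⟫_ℝ = 1) :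
    IsPair (q z) (q (q z)) ∧ wedge (q z) (q (q z)) = q := by
  have h1 : ⟪q (q z), q (q z)⟫_ℝ = 1 := by
    rw [inner_apply_swap hq, apply_apply_apply hq, inner_neg_right, hz, neg_neg]
  refine ⟨⟨hz, h1, ?_⟩, ?_⟩
  · rw [real_inner_comm, inner_apply_self hq]
  · have h := wedge_apply_apply hq (q z) (q (q z))
    rw [apply_apply_apply hq, neg_neg, h1] at h
    rw [h]; module

/-! ### The Grassmannian as a submanifold -/

theorem continuous_conjAct (g : Spin7) : Continuous (conjAct g) :=
  (continuous_const.mul continuous_id).mul continuous_const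

theorem contDiff_conjAct (g : Spin7) : ContDiff ℝ ∞ (conjAct g) :=
  (contDiff_const.mul contDiff_id).mul contDiff_const

theorem conjAct_conjAct_inv (g : Spin7) (B : Endo) : conjAct g (conjAct g⁻¹ B) = B := by
  ext1 v; simp [conjAct_apply]

theorem conjAct_inv_conjAct (g : Spin7) (B : Endo) : conjAct g⁻¹ (conjAct g B) = B := by
  ext1 v; simp [conjAct_apply]

/-- The first vector of the standard chart. -/
noncomputable def chartFst (y : EuclideanSpace ℝ (Fin 12)) : Oct :=
  !₂[1, 0, y 0, y 1, y 2, y 3, y 4, y 5]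

/-- The second vector of the standard chart. -/
noncomputable def chartSnd (y : EuclideanSpace ℝ (Fin 12)) : Oct :=
  !₂[0, 1, y 6, y 7, y 8, y 9, y 10, y 11]

/-- The coordinates of the standard chart. -/
noncomputable def chartCoord (q : Endo) : EuclideanSpace ℝ (Fin 12) :=
  (q (ε 0) 1)⁻¹ • !₂[-(q (ε 1) 2), -(q (ε 1) 3), -(q (ε 1) 4), -(q (ε 1) 5), -(q (ε 1) 6),
    -(q (ε 1) 7), q (ε 0) 2, q (ε 0) 3, q (ε 0) 4, q (ε 0) 5, q (ε 0) 6, q (ε 0) 7]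

theorem contDiff_apply_coord (v : Oct) (i : Fin 8) : ContDiff ℝ ∞ fun q : Endo => q v i := by
  have h1 : ContDiff ℝ ∞ fun q : Endo => q v := contDiff_id.clm_apply contDiff_const
  exact (contDiff_euclidean.mp h1) i

theorem gram_chart_pos (y : EuclideanSpace ℝ (Fin 12)) :
    0 < ⟪chartFst y, chartFst y⟫_ℝ * ⟪chartSnd y, chartSnd y⟫_ℝ -
      ⟪chartFst y, chartSnd y⟫_ℝ ^ 2 := by
  set u : Oct := !₂[0, 0, y 0, y 1, y 2, y 3, y 4, y 5] with hu
  set v : Oct := !₂[0, 0, y 6, y 7, y 8, y 9, y 10, y 11] with hv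
  have h1 : ⟪chartFst y, chartFst y⟫_ℝ = 1 + ⟪u, u⟫_ℝ := by
    rw [inner_eq_sum, inner_eq_sum]; simp [chartFst, hu]; ring
  have h2 : ⟪chartSnd y, chartSnd y⟫_ℝ = 1 + ⟪v, v⟫_ℝ := by
    rw [inner_eq_sum, inner_eq_sum]; simp [chartSnd, hv]; ring
  have h3 : ⟪chartFst y, chartSnd y⟫_ℝ = ⟪u, v⟫_ℝ := by
    simp [inner_eq_sum, chartFst, chartSnd, hu, hv]
  have hcs : ⟪u, v⟫_ℝ ^ 2 ≤ ⟪u, u⟫_ℝ * ⟪v, v⟫_ℝ := by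
    rw [sq]; exact real_inner_mul_inner_self_le u v
  have h4 : 0 ≤ ⟪u, u⟫_ℝ := real_inner_self_nonneg
  have h5 : 0 ≤ ⟪v, v⟫_ℝ := real_inner_self_nonneg
  rw [h1, h2, h3]
  nlinarith

/-- The standard chart. -/
noncomputable def chartMap (y : EuclideanSpace ℝ (Fin 12)) : Endo :=
  (Real.sqrt (⟪chartFst y, chartFst y⟫_ℝ * ⟪chartSnd y, chartSnd y⟫_ℝ -
      ⟪chartFst y, chartSnd y⟫_ℝ ^ 2))⁻¹ • wedgeC (chartFst y) (chartSnd y)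

theorem contDiff_chartMap : ContDiff ℝ ∞ chartMap := by
  have hc : ∀ i : Fin 12, ContDiff ℝ ∞ fun y : EuclideanSpace ℝ (Fin 12) => y i := fun i =>
    contDiff_euclidean.mp contDiff_id i
  have h1 : ContDiff ℝ ∞ chartFst := by
    rw [contDiff_euclidean]
    intro i
    fin_cases i <;> simp [chartFst, contDiff_const, hc]
  have h2 : ContDiff ℝ ∞ chartSnd := by
    rw [contDiff_euclidean]
    intro i
    fin_cases i <;> simp [chartSnd, contDiff_const, hc]
  refine ContDiff.smul (ContDiff.inv (ContDiff.sqrt ?_ fun y => (gram_chart_pos y).ne')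
    fun y => (Real.sqrt_pos.mpr (gram_chart_pos y)).ne') ?_
  · exact ((h1.inner ℝ h1).mul (h2.inner ℝ h2)).sub ((h1.inner ℝ h2).pow 2)
  · exact ((contDiff_clm (W := Oct →L[ℝ] Endo) wedgeC).comp h1).clm_apply h2

theorem chartMap_apply_ε (y : EuclideanSpace ℝ (Fin 12)) : ∃ s : ℝ, 0 < s ∧
    chartMap y (ε 0) = s • chartSnd y ∧ chartMap y (ε 1) = -(s • chartFst y) := by
  refine ⟨_, inv_pos.mpr (Real.sqrt_pos.mpr (gram_chart_pos y)), ?_, ?_⟩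
  · rw [chartMap, smul_apply, wedgeC_apply, wedge_apply, inner_ε_right, inner_ε_right,
      show chartFst y 0 = 1 from rfl, show chartSnd y 0 = 0 from rfl]; module
  · rw [chartMap, smul_apply, wedgeC_apply, wedge_apply, inner_ε_right, inner_ε_right,
      show chartFst y 1 = 0 from rfl, show chartSnd y 1 = 1 from rfl]; module

theorem chartCoord_chartMap (y : EuclideanSpace ℝ (Fin 12)) : chartCoord (chartMap y) = y := by
  obtain ⟨s, hs, h0, h1⟩ := chartMap_apply_ε y
  rw [chartCoord, h0, h1]
  have hs1 : (s • chartSnd y) 1 = s := by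
    rw [PiLp.smul_apply, show chartSnd y 1 = 1 from rfl]; simp
  rw [hs1]
  ext i
  fin_cases i <;> simp [chartFst, chartSnd, hs.ne']

/-- Dividing -q(ε 1) and q(ε 0) by the entry c = ⟪q(ε 0), ε 1⟫ gives the basis of the plane that
projects to ε 0, ε 1; positivity of c selects the orientation. -/
theorem chartMap_chartCoord {q : Endo} (hq : q ∈ grass) (hpos : 0 < q (ε 0) 1) :
    chartMap (chartCoord q) = q := by
  set c := q (ε 0) 1 with hc
  have h10 : q (ε 1) 0 = -c := by
    rw [← inner_ε_right, inner_apply_swap hq, inner_ε_left]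
  have h00 : q (ε 0) 0 = 0 := by rw [← inner_ε_right, inner_apply_self hq]
  have h11 : q (ε 1) 1 = 0 := by rw [← inner_ε_right, inner_apply_self hq]
  have hf : chartFst (chartCoord q) = c⁻¹ • (-q (ε 1)) := by
    ext i
    fin_cases i <;> simp [chartFst, chartCoord, ← hc, h10, h11, hpos.ne']
  have hs : chartSnd (chartCoord q) = c⁻¹ • q (ε 0) := by
    ext i
    fin_cases i <;> simp [chartSnd, chartCoord, ← hc, h00, hpos.ne']
  have hw : wedge (chartFst (chartCoord q)) (chartSnd (chartCoord q)) = c⁻¹ • q := by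
    rw [hf, hs, wedge_smul_smul, wedge_apply_apply hq, inner_ε_right, ← hc, smul_smul]
    congr 1; field_simp
  exact (normalize_wedge hq (inv_pos.mpr hpos) hw).2

theorem isSubmanifold_grass : IsSubmanifold 12 grass := by
  intro p hp
  obtain ⟨g, hg⟩ := exists_smul_basePoint ⟨p, hp⟩
  have hgp : p = conjAct g (wedge (ε 0) (ε 1)) := (congrArg Subtype.val hg).symm
  -- The oriented planes that project isomorphically, with orientation preserved, to the plane of ε
  -- 0, ε 1. Translates by Spin(7) cover the Grassmannian.
  set U₀ : Set Endo := {q | 0 < q (ε 0) 1}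
  have hU₀ : IsOpen U₀ := isOpen_lt continuous_const (contDiff_apply_coord (ε 0) 1).continuous
  have hmem : ∀ y, chartMap y ∈ grass := fun y => by
    rw [chartMap, wedgeC_apply]; exact smul_wedge_mem_grass (gram_chart_pos y)
  have hpos : ∀ y, chartMap y ∈ U₀ := fun y => by
    obtain ⟨s, hs, h0, -⟩ := chartMap_apply_ε y
    change 0 < chartMap y (ε 0) 1
    rw [h0, PiLp.smul_apply, show chartSnd y 1 = 1 from rfl]
    simpa using hs
  refine ⟨conjAct g⁻¹ ⁻¹' U₀, Set.univ, fun y => conjAct g (chartMap y),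
    fun q => chartCoord (conjAct g⁻¹ q), hU₀.preimage (continuous_conjAct _), ?_, isOpen_univ,
    ?_, ?_, ?_, fun _ _ => Set.mem_univ _, ?_, ?_⟩
  · rw [Set.mem_preimage, hgp, conjAct_inv_conjAct]
    change 0 < wedge (ε 0) (ε 1) (ε 0) 1
    rw [isPair_ε.wedge_fst]; simp
  · exact ((contDiff_conjAct g).comp contDiff_chartMap).contDiffOn
  · have h : ContDiffOn ℝ ∞ chartCoord U₀ := by
      have hi : ContDiffOn ℝ ∞ (fun q : Endo => (q (ε 0) 1)⁻¹) U₀ :=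
        (contDiff_apply_coord (ε 0) 1).contDiffOn.inv fun q hq => ne_of_gt hq
      rw [contDiffOn_euclidean]
      intro i
      have hc := fun (v : Oct) (j : Fin 8) => hi.mul (contDiff_apply_coord v j).contDiffOn
      have hn := fun (v : Oct) (j : Fin 8) => hi.mul (contDiff_apply_coord v j).neg.contDiffOn
      fin_cases i
      exacts [hn _ _, hn _ _, hn _ _, hn _ _, hn _ _, hn _ _, hc _ _, hc _ _, hc _ _, hc _ _,
        hc _ _, hc _ _]
    exact h.comp (contDiff_conjAct g⁻¹).contDiffOn (Set.mapsTo_preimage _ _)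
  · intro y _
    refine ⟨conjAct_mem g (hmem y), ?_⟩
    rw [Set.mem_preimage, conjAct_inv_conjAct]
    exact hpos y
  · intro y _
    beta_reduce
    rw [conjAct_inv_conjAct, chartCoord_chartMap]
  · rintro q ⟨hq, hqU⟩
    beta_reduce
    rw [chartMap_chartCoord (conjAct_mem g⁻¹ hq) hqU, conjAct_conjAct_inv]

/-! ### Local sections of the orbit map -/

/-- The normalized vector. -/
noncomputable def unitVec (v : Oct) : Oct := (Real.sqrt ⟪v, v⟫_ℝ)⁻¹ • v

theorem inner_self_pos {v : Oct} (hv : v ≠ 0) : 0 < ⟪v, v⟫_ℝ :=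
  real_inner_self_pos.mpr hv

theorem inner_unitVec {v : Oct} (hv : v ≠ 0) : ⟪unitVec v, unitVec v⟫_ℝ = 1 := by
  have h := inner_self_pos hv
  rw [unitVec, real_inner_smul_left, real_inner_smul_right, ← mul_assoc, ← mul_inv,
    Real.mul_self_sqrt h.le, inv_mul_cancel₀ h.ne']

theorem contDiffOn_unitVec {U : Set Endo} {f : Endo → Oct}
    (hf : ContDiffOn ℝ ∞ f U) (h0 : ∀ q ∈ U, f q ≠ 0) : ContDiffOn ℝ ∞ (fun q => unitVec (f q)) U :=
  (((hf.inner ℝ hf).sqrt fun q hq => (inner_self_pos (h0 q hq)).ne').inv fun q hq =>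
    (Real.sqrt_pos.mpr (inner_self_pos (h0 q hq))).ne').smul hf

/-- On the Grassmannian -q² is the orthogonal projection to the plane, so v + q²v is the normal part
of v. -/
theorem inner_add_apply_apply {q : Endo} (hq : q ∈ grass) (v z : Oct) :
    ⟪q z, v + q (q v)⟫_ℝ = 0 := by
  rw [inner_apply_swap hq, map_add, apply_apply_apply hq, add_neg_cancel, inner_zero_right, neg_zero]

/-- The first vector, orthogonal to the plane `q`, of the frame adapted to `q`. -/
noncomputable def sectionThd (q : Endo) : Oct := ε 2 + q (q (ε 2))

/-- The projection of `ε 4` to the orthogonal complement of the plane `q` and of the complex line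
spanned by `sectionThd q`, up to a factor. -/
noncomputable def sectionFth (q : Endo) : Oct :=
  ⟪sectionThd q, sectionThd q⟫_ℝ • (ε 4 + q (q (ε 4))) -
    ⟪sectionThd q, ε 4 + q (q (ε 4))⟫_ℝ • sectionThd q -
    ⟪contract q (sectionThd q), ε 4 + q (q (ε 4))⟫_ℝ • contract q (sectionThd q)

/-- A section of the orbit map near the base point. -/
noncomputable def sectionMap (q : Endo) : Endo :=
  frameMap (unitVec (-q (ε 1))) (q (unitVec (-q (ε 1)))) (unitVec (sectionThd q))
    (unitVec (sectionFth q))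

/-- The domain of `sectionMap`. -/
def sectionDomain : Set Endo := {q | -q (ε 1) ≠ 0 ∧ sectionThd q ≠ 0 ∧ sectionFth q ≠ 0}

theorem contDiff_endo_apply (v : Oct) : ContDiff ℝ ∞ fun q : Endo => q v :=
  contDiff_id.clm_apply contDiff_const

theorem contDiff_add_apply_apply (v : Oct) : ContDiff ℝ ∞ fun q : Endo => v + q (q v) :=
  contDiff_const.add (contDiff_id.clm_apply (contDiff_endo_apply v))

theorem contDiff_contract_apply {f : Endo → Oct} (hf : ContDiff ℝ ∞ f) :
    ContDiff ℝ ∞ fun q : Endo => contract q (f q) :=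
  (contDiff_clm (V := Endo) (W := Endo) contractC).clm_apply hf

theorem contDiff_sectionThd : ContDiff ℝ ∞ sectionThd := contDiff_add_apply_apply _

theorem contDiff_sectionFth : ContDiff ℝ ∞ sectionFth := by
  have h4 := contDiff_add_apply_apply (ε 4)
  have h3 := contDiff_sectionThd
  have hc := contDiff_contract_apply h3
  exact (((h3.inner ℝ h3).smul h4).sub ((h3.inner ℝ h4).smul h3)).sub ((hc.inner ℝ h4).smul hc)

theorem isOpen_sectionDomain : IsOpen sectionDomain :=
  (isOpen_ne_fun (contDiff_endo_apply (ε 1)).neg.continuous continuous_const).inter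
    ((isOpen_ne_fun contDiff_sectionThd.continuous continuous_const).inter
      (isOpen_ne_fun contDiff_sectionFth.continuous continuous_const))

theorem contDiffOn_sectionMap : ContDiffOn ℝ ∞ sectionMap sectionDomain := by
  have h1 := contDiffOn_unitVec (U := sectionDomain)
    (contDiff_endo_apply (ε 1)).neg.contDiffOn fun q hq => hq.1
  exact contDiffOn_frameMap h1 (contDiffOn_id.clm_apply h1)
    (contDiffOn_unitVec contDiff_sectionThd.contDiffOn fun q hq => hq.2.1)
    (contDiffOn_unitVec contDiff_sectionFth.contDiffOn fun q hq => hq.2.2)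

theorem inner_contract_contract {x y u v : Oct} (h : IsPair x y) (hx : ⟪x, u⟫_ℝ = 0)
    (hy : ⟪y, u⟫_ℝ = 0) :
    ⟪contract (wedge x y) u, contract (wedge x y) v⟫_ℝ = ⟪u, v⟫_ℝ := by
  rw [← neg_neg ⟪_, _⟫_ℝ, ← inner_contract_wedge_swap, contract_contract h hx hy, inner_neg_left,
    neg_neg]

theorem inner_contract_self (x y u : Oct) : ⟪u, contract (wedge x y) u⟫_ℝ = 0 := by
  have h := inner_contract_wedge_swap x y u u
  rw [real_inner_comm] at h
  linarith

/-- Gram-Schmidt inside the complex structure of the plane: the fourth vector is orthogonal to both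
the third and its image under I. Since I w = -(x × y × w), this is exactly the frame condition. -/
theorem sectionMap_spec {q : Endo} (hq : q ∈ grass) (hU : q ∈ sectionDomain) :
    ∃ g : Spin7, toEndo g = sectionMap q ∧ conjAct g (wedge (ε 0) (ε 1)) = q := by
  obtain ⟨hU1, hU3, hU5⟩ := hU
  set c := (Real.sqrt ⟪-q (ε 1), -q (ε 1)⟫_ℝ)⁻¹ with hc
  -- The first frame vector is in the image of q, so `isPair_apply` makes it and its image under q
  -- an oriented basis. At the base point it is ε 0.
  have hz : unitVec (-q (ε 1)) = q (-(c • ε 1)) := by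
    rw [unitVec, map_neg, map_smul, smul_neg]
  have h1 := inner_unitVec hU1
  set z := -(c • ε 1)
  rw [hz] at h1
  obtain ⟨hp, hw⟩ := isPair_apply hq h1
  set x := q z with hx
  set y := q (q z) with hy
  set w := sectionThd q with hw3
  set r := ε 4 + q (q (ε 4)) with hr
  have hxw : ⟪x, w⟫_ℝ = 0 := inner_add_apply_apply hq _ _
  have hyw : ⟪y, w⟫_ℝ = 0 := inner_add_apply_apply hq _ _
  have hxr : ⟪x, r⟫_ℝ = 0 := inner_add_apply_apply hq _ _
  have hyr : ⟪y, r⟫_ℝ = 0 := inner_add_apply_apply hq _ _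
  have hcw := inner_contract_eq_zero x y w
  have hww := inner_contract_contract (v := w) hp hxw hyw
  have hwc := inner_contract_self x y w
  have hcw' := hwc
  rw [real_inner_comm] at hcw'
  rw [hw] at hcw hww hwc hcw'
  have hd : sectionFth q = ⟪w, w⟫_ℝ • r - ⟪w, r⟫_ℝ • w - ⟪contract q w, r⟫_ℝ • contract q w := rfl
  set d := sectionFth q
  have hxd : ⟪x, d⟫_ℝ = 0 := by
    rw [hd]; simp only [inner_sub_right, real_inner_smul_right, hxw, hxr, hcw.1]; ring
  have hyd : ⟪y, d⟫_ℝ = 0 := by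
    rw [hd]; simp only [inner_sub_right, real_inner_smul_right, hyw, hyr, hcw.2]; ring
  have hwd : ⟪w, d⟫_ℝ = 0 := by
    rw [hd]; simp only [inner_sub_right, real_inner_smul_right, hwc]; ring
  have hcd : ⟪contract q w, d⟫_ℝ = 0 := by
    rw [hd]; simp only [inner_sub_right, real_inner_smul_right, hww, hcw']; ring
  have hf : IsSpinFrame x y (unitVec w) (unitVec d) := by
    refine ⟨hp.xx, hp.yy, inner_unitVec hU3, inner_unitVec hU5, hp.xy, ?_, ?_, ?_, ?_, ?_, ?_⟩
    · rw [unitVec, real_inner_smul_right, hxw, mul_zero]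
    · rw [unitVec, real_inner_smul_right, hxd, mul_zero]
    · rw [unitVec, real_inner_smul_right, hyw, mul_zero]
    · rw [unitVec, real_inner_smul_right, hyd, mul_zero]
    · rw [unitVec, unitVec, real_inner_smul_right, real_inner_smul_left, hwd, mul_zero, mul_zero]
    · rw [← neg_eq_zero, ← inner_neg_left, ← contract_wedge, hw, unitVec, unitVec, map_smul,
        real_inner_smul_right, real_inner_smul_left, hcd, mul_zero, mul_zero]
  obtain ⟨g, hg⟩ := hf.exists_spin7
  refine ⟨g, ?_, ?_⟩
  · rw [hg, sectionMap, hz]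
  · rw [conjAct_wedge, hg, frameMap_apply_ε, frameMap_apply_ε]
    exact hw

theorem basePoint_mem_sectionDomain : wedge (ε 0) (ε 1) ∈ sectionDomain := by
  have h0 : ∀ i : Fin 8, ε i ≠ 0 := fun i h => by
    have := congrArg (fun v : Oct => v i) h
    simp [ε_apply] at this
  have hp : ∀ i : Fin 8, i ≠ 0 → i ≠ 1 → wedge (ε 0) (ε 1) (ε i) = 0 := fun i hi hi' =>
    wedge_apply_of_orthogonal (by simp [ε_apply, hi]) (by simp [ε_apply, hi'])
  have h3 : sectionThd (wedge (ε 0) (ε 1)) = ε 2 := by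
    rw [sectionThd, hp 2 (by decide) (by decide), map_zero, add_zero]
  have h4 : contract (wedge (ε 0) (ε 1)) (ε 2) = ε 3 := by
    rw [contract_wedge, cross3_ε₀₁₂, neg_neg]
  refine ⟨?_, ?_, ?_⟩
  · rw [isPair_ε.wedge_snd, neg_neg]; exact h0 0
  · rw [h3]; exact h0 2
  · rw [sectionFth, h3, hp 4 (by decide) (by decide), map_zero, add_zero, h4]
    simpa [ε_apply] using h0 4

theorem exists_local_section (p : grass) : ∃ (U : Set Endo) (s : Endo → Endo), IsOpen U ∧
    (p : Endo) ∈ U ∧ ContDiffOn ℝ ∞ s U ∧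
      ∀ q : grass, (q : Endo) ∈ U → ∃ g : Spin7, toEndo g = s q ∧ g • basePoint = q := by
  obtain ⟨k, rfl⟩ := exists_smul_basePoint p
  refine ⟨conjAct k⁻¹ ⁻¹' sectionDomain, fun q => toEndo k * sectionMap (conjAct k⁻¹ q),
    isOpen_sectionDomain.preimage (continuous_conjAct _), ?_, ?_, ?_⟩
  · rw [Set.mem_preimage, coe_smul_grass, conjAct_inv_conjAct]
    exact basePoint_mem_sectionDomain
  · exact contDiffOn_const.mul (contDiffOn_sectionMap.comp (contDiff_conjAct k⁻¹).contDiffOn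
      (Set.mapsTo_preimage _ _))
  · intro q hq
    obtain ⟨g, hg, hgq⟩ := sectionMap_spec (conjAct_mem k⁻¹ q.2) hq
    refine ⟨k * g, ?_, ?_⟩
    · beta_reduce; rw [← hg]; rfl
    · rw [mul_smul]
      apply Subtype.ext
      rw [coe_smul_grass, coe_smul_grass]
      change conjAct k (conjAct g (wedge (ε 0) (ε 1))) = q
      rw [hgq, conjAct_conjAct_inv]

/-! ### The homogeneous space -/

theorem isInducing_toEndo : Topology.IsInducing toEndo :=
  Topology.IsInducing.subtypeVal.comp Topology.IsInducing.subtypeVal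

theorem continuous_orbit : Continuous fun g : Spin7 => g • basePoint := by
  rw [continuous_induced_rng]
  have he : (Subtype.val ∘ fun g : Spin7 => g • basePoint) =
      fun g => wedgeC (toEndo g (ε 0)) (toEndo g (ε 1)) := funext smul_basePoint
  rw [he]
  have h := fun v : Oct => isInducing_toEndo.continuous.clm_apply (continuous_const (y := v))
  exact ((ContinuousLinearMap.continuous (M₂ := Oct →L[ℝ] Endo) wedgeC).comp (h (ε 0))).clm_apply
    (h (ε 1))

theorem exists_homeomorph_quotient :
    ∃ h : (Spin7 ⧸ MulAction.stabilizer Spin7 basePoint) ≃ₜ grass,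
      ∀ g : Spin7, h (QuotientGroup.mk g) = g • basePoint := by
  set f := MulAction.ofQuotientStabilizer Spin7 basePoint
  have hf : Function.Bijective f := ⟨MulAction.injective_ofQuotientStabilizer Spin7 basePoint,
    fun p => by
      obtain ⟨g, hg⟩ := exists_smul_basePoint p
      exact ⟨QuotientGroup.mk g, hg⟩⟩
  let e := Equiv.ofBijective f hf
  have hcont : Continuous e := continuous_orbit.quotient_lift _
  have hinv : Continuous e.symm := by
    rw [continuous_iff_continuousAt]
    intro p
    obtain ⟨U, s, hU, hpU, hs, hsec⟩ := exists_local_section p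
    set V : Set grass := {q | (q : Endo) ∈ U}
    have hV : IsOpen V := hU.preimage continuous_subtype_val
    refine ContinuousOn.continuousAt ?_ (hV.mem_nhds hpU)
    rw [continuousOn_iff_continuous_domRestrict]
    -- Lifts to Spin(7) are chosen pointwise. They are continuous because the topology of Spin(7) is
    -- induced from endomorphisms and the section is continuous there.
    choose t ht using fun q : V => hsec q.1 q.2
    have htc : Continuous t := by
      rw [isInducing_toEndo.continuous_iff]
      have : toEndo ∘ t = fun q : V => s (q.1 : Endo) := funext fun q => (ht q).1
      rw [this]
      exact hs.continuousOn.comp_continuous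
        (continuous_subtype_val.comp continuous_subtype_val) fun q => q.2
    have he : V.domRestrict e.symm = fun q => QuotientGroup.mk (t q) := by
      funext q
      rw [Set.domRestrict_apply, Equiv.symm_apply_eq]
      exact (ht q).2.symm
    rw [he]
    exact QuotientGroup.continuous_mk.comp htc
  exact ⟨⟨e, hcont, hinv⟩, fun g => rfl⟩

/-! ### The stabilizer of the base point -/

section Stabilizer

variable {g : Spin7}

theorem wedge_toEndo_of_fix (hg : conjAct g (wedge (ε 0) (ε 1)) = wedge (ε 0) (ε 1)) (x : Oct) :
    wedge (ε 0) (ε 1) (toEndo g x) = toEndo g (wedge (ε 0) (ε 1) x) := by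
  conv_lhs => rw [← hg]
  rw [conjAct_apply, toEndo_inv_apply]

/-- An element fixing the oriented plane commutes with I; this is what makes its action on the
complement complex linear. -/
theorem contract_toEndo_of_fix (hg : conjAct g (wedge (ε 0) (ε 1)) = wedge (ε 0) (ε 1)) (x : Oct) :
    contract (wedge (ε 0) (ε 1)) (toEndo g x) = toEndo g (contract (wedge (ε 0) (ε 1)) x) := by
  conv_lhs => rw [← hg]
  rw [contract_conjAct g basePoint_mem, conjAct_apply, toEndo_inv_apply]

theorem complexCoord_wedge (x : Oct) : complexCoord (wedge (ε 0) (ε 1) x) = 0 := by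
  funext i
  fin_cases i <;> simp [complexCoord, wedge_apply, ε_apply]

theorem complexCoord_toEndo_eq_zero
    (hg : conjAct g (wedge (ε 0) (ε 1)) = wedge (ε 0) (ε 1)) :
    complexCoord (toEndo g (ε 0)) = 0 ∧ complexCoord (toEndo g (ε 1)) = 0 := by
  have h0 : ε 0 = wedge (ε 0) (ε 1) (-ε 1) := by rw [map_neg, isPair_ε.wedge_snd, neg_neg]
  have h1 : ε 1 = wedge (ε 0) (ε 1) (ε 0) := isPair_ε.wedge_fst.symm
  constructor
  · have h := wedge_toEndo_of_fix hg (-ε 1)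
    rw [← h0] at h
    rw [← h, complexCoord_wedge]
  · have h := wedge_toEndo_of_fix hg (ε 0)
    rw [← h1] at h
    rw [← h, complexCoord_wedge]

theorem toEndo_coord_of_fix (hg : conjAct g (wedge (ε 0) (ε 1)) = wedge (ε 0) (ε 1)) {x : Oct}
    (h0 : x 0 = 0) (h1 : x 1 = 0) : toEndo g x 0 = 0 ∧ toEndo g x 1 = 0 := by
  have h := wedge_toEndo_of_fix hg x
  rw [wedge_apply, wedge_apply, inner_ε_left, inner_ε_left, inner_ε_left, inner_ε_left, h0, h1,
    zero_smul, zero_smul, sub_zero, map_zero] at h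
  have e0 := congrArg (fun v : Oct => v 0) h
  have e1 := congrArg (fun v : Oct => v 1) h
  simp [ε_apply] at e0 e1
  exact ⟨e1, e0⟩

/-- The vectors with coordinates the standard basis of `ℂ³`. -/
noncomputable def complexBasis : Fin 3 → Oct := ![ε 2, ε 5, ε 4]

/-- The matrix of `g` in complex coordinates. -/
noncomputable def complexMatrix (g : Spin7) : Matrix (Fin 3) (Fin 3) ℂ :=
  Matrix.of fun i j => complexCoord (toEndo g (complexBasis j)) i

theorem eq_sum_complexBasis (x : Oct) : x = x 0 • ε 0 + x 1 • ε 1 +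
    (x 2 • ε 2 + x 3 • contract (wedge (ε 0) (ε 1)) (ε 2)) +
    (x 5 • ε 5 - x 6 • contract (wedge (ε 0) (ε 1)) (ε 5)) +
    (x 4 • ε 4 - x 7 • contract (wedge (ε 0) (ε 1)) (ε 4)) := by
  simp only [contract_basePoint]
  refine oct_ext ?_ ?_ ?_ ?_ ?_ ?_ ?_ ?_ <;> simp [ε_apply]

/-- The coordinates turn I into i, and g commutes with I and preserves the plane; so g is read off
from its values on ε 2, ε 5, ε 4. -/
theorem complexCoord_toEndo (hg : conjAct g (wedge (ε 0) (ε 1)) = wedge (ε 0) (ε 1)) (x : Oct) :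
    complexCoord (toEndo g x) = (complexMatrix g).mulVec (complexCoord x) := by
  obtain ⟨h0, h1⟩ := complexCoord_toEndo_eq_zero hg
  conv_lhs => rw [eq_sum_complexBasis x]
  simp only [map_add, map_sub, map_smul, ← contract_toEndo_of_fix hg]
  simp only [← complexCoordL_apply, map_add, map_sub, map_smul]
  simp only [complexCoordL_apply, complexCoord_contract, h0, h1]
  funext i
  simp [Matrix.mulVec, dotProduct, Fin.sum_univ_three, complexMatrix, complexBasis]
  rw [show complexCoord x 0 = x 2 + x 3 * Complex.I from rfl,
    show complexCoord x 1 = x 5 - x 6 * Complex.I from rfl,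
    show complexCoord x 2 = x 4 - x 7 * Complex.I from rfl]
  ring

theorem complexCoord_complexBasis (j : Fin 3) : complexCoord (complexBasis j) = Pi.single j 1 := by
  funext i
  fin_cases j <;> fin_cases i <;> simp [complexCoord, complexBasis, ε_apply]

theorem complexMatrix_mul (hg : conjAct g (wedge (ε 0) (ε 1)) = wedge (ε 0) (ε 1)) (k : Spin7) :
    complexMatrix (g * k) = complexMatrix g * complexMatrix k := by
  ext i j
  have h := congrFun (complexCoord_toEndo hg (toEndo k (complexBasis j))) i
  rw [← toEndo_mul_apply] at h
  exact h

/-- The standard Hermitian form in complex coordinates. -/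
theorem sum_conj_complexCoord {u v : Oct} (h0 : u 0 = 0) (h1 : u 1 = 0) :
    ∑ i, star (complexCoord u i) * complexCoord v i =
      ⟪u, v⟫_ℝ - ⟪u, contract (wedge (ε 0) (ε 1)) v⟫_ℝ * Complex.I := by
  rw [contract_basePoint, inner_eq_sum, inner_eq_sum, Fin.sum_univ_three]
  apply Complex.ext <;> simp [complexCoord, h0, h1] <;> ring

theorem complexBasis_coord (j : Fin 3) : complexBasis j 0 = 0 ∧ complexBasis j 1 = 0 := by
  fin_cases j <;> simp [complexBasis, ε_apply]

/-- The Hermitian form is ⟪u, v⟫ - i⟪u, I v⟫, and g preserves the inner product and commutes with I.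
-/
theorem star_complexMatrix_mul (hg : conjAct g (wedge (ε 0) (ε 1)) = wedge (ε 0) (ε 1)) :
    star (complexMatrix g) * complexMatrix g = 1 := by
  ext j k
  have hj := complexBasis_coord j
  have hgj := toEndo_coord_of_fix hg hj.1 hj.2
  have h1 := sum_conj_complexCoord (v := toEndo g (complexBasis k)) hgj.1 hgj.2
  rw [contract_toEndo_of_fix hg, inner_toEndo, inner_toEndo, ← sum_conj_complexCoord hj.1 hj.2,
    complexCoord_complexBasis, complexCoord_complexBasis] at h1
  rw [Matrix.mul_apply]
  refine h1.trans ?_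
  simp [Pi.single_apply, Matrix.one_apply, eq_comm]

/-! ### Recovering stabilizer elements from unitary matrices -/

theorem cross3_ε₂₄₅ : cross3 (ε 2) (ε 4) (ε 5) = -ε 1 := by
  refine oct_ext ?_ ?_ ?_ ?_ ?_ ?_ ?_ ?_ <;> simp [cross3_coords, octMul_coords, octConj_coords]
  norm_num

theorem cross3_ε₂₄₆ : cross3 (ε 2) (ε 4) (ε 6) = ε 0 := by
  refine oct_ext ?_ ?_ ?_ ?_ ?_ ?_ ?_ ?_ <;> simp [cross3_coords, octMul_coords, octConj_coords]
  norm_num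

/-- The vector orthogonal to `ε 0` and `ε 1` with given complex coordinates. -/
noncomputable def ofComplexCoord (c : Fin 3 → ℂ) : Oct :=
  !₂[0, 0, (c 0).re, (c 0).im, (c 2).re, (c 1).re, -(c 1).im, -(c 2).im]

theorem complexCoord_ofComplexCoord (c : Fin 3 → ℂ) : complexCoord (ofComplexCoord c) = c := by
  funext i
  fin_cases i <;> apply Complex.ext <;> simp [complexCoord, ofComplexCoord]

theorem continuous_ofComplexCoord : Continuous ofComplexCoord := by
  unfold ofComplexCoord
  fun_prop

/-- The element of the stabilizer of the base point with the given matrix. -/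
noncomputable def ofComplexMatrix (A : Matrix (Fin 3) (Fin 3) ℂ) : Endo :=
  frameMap
    (-cross3 (ofComplexCoord fun i => A i 0) (ofComplexCoord fun i => A i 2)
      (contract (wedge (ε 0) (ε 1)) (ofComplexCoord fun i => A i 1)))
    (-cross3 (ofComplexCoord fun i => A i 0) (ofComplexCoord fun i => A i 2)
      (ofComplexCoord fun i => A i 1))
    (ofComplexCoord fun i => A i 0) (ofComplexCoord fun i => A i 2)

/-- The columns give g on the complement, and the triple products that express ε 0 and ε 1 through ε
2, ε 4, ε 5, ε 6 recover g on the plane. So the matrix determines g, and continuously. -/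
theorem ofComplexMatrix_complexMatrix
    (hg : conjAct g (wedge (ε 0) (ε 1)) = wedge (ε 0) (ε 1)) :
    ofComplexMatrix (complexMatrix g) = toEndo g := by
  have hv : ∀ j, (ofComplexCoord fun i => complexMatrix g i j) = toEndo g (complexBasis j) := by
    intro j
    have hj := complexBasis_coord j
    have hgj := toEndo_coord_of_fix hg hj.1 hj.2
    refine eq_of_complexCoord_eq ?_ hgj.1.symm hgj.2.symm
    rw [complexCoord_ofComplexCoord]
    rfl
  have h6 : contract (wedge (ε 0) (ε 1)) (ε 5) = -ε 6 := by
    rw [contract_basePoint]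
    refine oct_ext ?_ ?_ ?_ ?_ ?_ ?_ ?_ ?_ <;> simp [ε_apply]
  rw [ofComplexMatrix]
  simp only [hv, contract_toEndo_of_fix hg, cross3_toEndo]
  have h0 : cross3 (ε 2) (ε 4) (-ε 6) = -ε 0 := by
    rw [← cross3L_apply, map_neg, cross3L_apply, cross3_ε₂₄₆]
  rw [show complexBasis 0 = ε 2 from rfl, show complexBasis 1 = ε 5 from rfl,
    show complexBasis 2 = ε 4 from rfl, h6, ← map_neg, ← map_neg, cross3_ε₂₄₅, h0, neg_neg,
    neg_neg, frameMap_toEndo]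

/-- Together with ε 0, ε 1, two Hermitian-orthonormal columns form a frame: Hermitian orthogonality
of v 0 and v 2 contains v 2 ⟂ I(v 0), up to sign the triple product of the first three vectors. The
resulting g fixes ε 0 and ε 1. -/
theorem exists_fix_two_columns {A : Matrix (Fin 3) (Fin 3) ℂ} (hA : star A * A = 1) :
    ∃ g : Spin7, conjAct g (wedge (ε 0) (ε 1)) = wedge (ε 0) (ε 1) ∧
      (∀ i, complexMatrix g i 0 = A i 0) ∧ ∀ i, complexMatrix g i 2 = A i 2 := by
  set v := fun j => ofComplexCoord fun i => A i j with hv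
  have hc : ∀ j, complexCoord (v j) = fun i => A i j := fun j => complexCoord_ofComplexCoord _
  have key : ∀ j k, (if j = k then 1 else 0 : ℂ) =
      ⟪v j, v k⟫_ℝ - ⟪v j, contract (wedge (ε 0) (ε 1)) (v k)⟫_ℝ * Complex.I := fun j k => by
    rw [← sum_conj_complexCoord rfl rfl, hc, hc]
    exact ((congrFun (congrFun hA j) k).symm.trans (Matrix.mul_apply ..)).trans
      (Finset.sum_congr rfl fun i _ => rfl) |>.symm ▸ (Matrix.one_apply ..).symm
  have hre : ∀ j k, ⟪v j, v k⟫_ℝ = if j = k then 1 else 0 := fun j k => by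
    have h := congrArg Complex.re (key j k)
    split_ifs at h ⊢ <;> simpa using h.symm
  have him : ∀ j k, ⟪v j, contract (wedge (ε 0) (ε 1)) (v k)⟫_ℝ = 0 := fun j k => by
    have h := congrArg Complex.im (key j k)
    split_ifs at h <;> simpa using h.symm
  have h0 : ∀ j, ⟪ε 0, v j⟫_ℝ = 0 := fun j => by rw [inner_ε_left]; rfl
  have h1 : ∀ j, ⟪ε 1, v j⟫_ℝ = 0 := fun j => by rw [inner_ε_left]; rfl
  have hf : IsSpinFrame (ε 0) (ε 1) (v 0) (v 2) := by
    refine ⟨by simp, by simp, (hre 0 0).trans (if_pos rfl), (hre 2 2).trans (if_pos rfl), by simp, h0 0, h0 2, h1 0,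
      h1 2, by simp [hre], ?_⟩
    rw [← neg_eq_zero, ← inner_neg_left, ← contract_wedge, real_inner_comm, him]
  obtain ⟨g, hg⟩ := hf.exists_spin7
  refine ⟨g, ?_, fun i => ?_, fun i => ?_⟩
  · rw [conjAct_wedge, hg, frameMap_apply_ε, frameMap_apply_ε]; rfl
  · change complexCoord (toEndo g (ε 2)) i = _
    rw [hg, frameMap_apply_ε]
    exact congrFun (hc 0) i
  · change complexCoord (toEndo g (ε 4)) i = _
    rw [hg, frameMap_apply_ε]
    exact congrFun (hc 2) i

/-- Rotating ε 0, ε 1 in their plane and fixing ε 2, ε 4 multiplies the remaining coordinate by a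
phase, since ε 5 = ε 1 × ε 2 × ε 4 is carried along. -/
theorem exists_complexMatrix_eq_diagonal {z : ℂ} (hz : star z * z = 1) :
    ∃ g : Spin7, conjAct g (wedge (ε 0) (ε 1)) = wedge (ε 0) (ε 1) ∧
      complexMatrix g = Matrix.diagonal ![1, z, 1] := by
  have hn : z.re * z.re + z.im * z.im = 1 := by simpa using congrArg Complex.re hz
  -- A rotation of the plane preserves its bivector, hence the products with ε 0, ε 1.
  have hc : ∀ v, cross3 (z.re • ε 0 + -z.im • ε 1) (z.im • ε 0 + z.re • ε 1) v =
      cross3 (ε 0) (ε 1) v := fun v => by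
    simp only [← cross3L_apply, map_add, map_smul, LinearMap.add_apply, LinearMap.smul_apply]
    simp only [cross3L_apply, cross3_self_left, cross3_swap_left (ε 1) (ε 0)]
    linear_combination (norm := module) hn • cross3 (ε 0) (ε 1) v
  have hf : IsSpinFrame (z.re • ε 0 + -z.im • ε 1) (z.im • ε 0 + z.re • ε 1) (ε 2) (ε 4) := by
    constructor <;> try rw [hc, cross3_ε₀₁₂]
    all_goals simp only [inner_add_left, inner_add_right, real_inner_smul_left,
      real_inner_smul_right, inner_ε_left, ε_apply, inner_neg_left]
    all_goals simp
    all_goals linarith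
  obtain ⟨g, hg⟩ := hf.exists_spin7
  have h2 : toEndo g (ε 2) = ε 2 := by rw [hg, frameMap_apply_ε]; rfl
  have h4 : toEndo g (ε 4) = ε 4 := by rw [hg, frameMap_apply_ε]; rfl
  have h5 : toEndo g (ε 5) = -z.im • ε 6 + z.re • ε 5 := by
    rw [hg, frameMap_apply_ε]
    change cross3 (z.im • ε 0 + z.re • ε 1) (ε 2) (ε 4) = _
    simp only [← cross3L_apply, map_add, map_smul, LinearMap.add_apply, LinearMap.smul_apply]
    simp only [cross3L_apply, cross3_ε₀₂₄, cross3_ε₁₂₄]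
    module
  refine ⟨g, ?_, ?_⟩
  · rw [conjAct_wedge, hg, frameMap_apply_ε, frameMap_apply_ε]
    ext1 v
    change wedge (z.re • ε 0 + -z.im • ε 1) (z.im • ε 0 + z.re • ε 1) v = _
    simp only [wedge_apply, inner_add_left, real_inner_smul_left]
    linear_combination (norm := module) hn • (⟪ε 0, v⟫_ℝ • ε 1 - ⟪ε 1, v⟫_ℝ • ε 0)
  · ext i j
    change complexCoord (toEndo g (complexBasis j)) i = _
    fin_cases j
    · change complexCoord (toEndo g (ε 2)) i = _
      rw [h2]
      fin_cases i <;> simp [complexCoord, ε_apply]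
    · change complexCoord (toEndo g (ε 5)) i = _
      rw [h5]
      fin_cases i <;> simp [complexCoord, ε_apply, Complex.re_add_im]
    · change complexCoord (toEndo g (ε 4)) i = _
      rw [h4]
      fin_cases i <;> simp [complexCoord, ε_apply]

theorem eq_diagonal_of_star_mul {B : Matrix (Fin 3) (Fin 3) ℂ} (hB : star B * B = 1)
    (h0 : ∀ i, B i 0 = (1 : Matrix (Fin 3) (Fin 3) ℂ) i 0)
    (h2 : ∀ i, B i 2 = (1 : Matrix (Fin 3) (Fin 3) ℂ) i 2) :
    star (B 1 1) * B 1 1 = 1 ∧ B = Matrix.diagonal ![1, B 1 1, 1] := by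
  have key : ∀ j k, ∑ i, star (B i j) * B i k = (1 : Matrix (Fin 3) (Fin 3) ℂ) j k := fun j k =>
    congrFun (congrFun hB j) k
  have e0 := key 0 1
  have e1 := key 1 1
  have e2 := key 2 1
  simp only [Fin.sum_univ_three, h0, h2] at e0 e1 e2
  simp at e0 e1 e2
  rw [e0, e2] at e1
  refine ⟨by simpa using e1, ?_⟩
  ext i j
  fin_cases j
  · refine (h0 i).trans ?_
    fin_cases i <;> simp [Matrix.one_apply]
  · fin_cases i
    · simpa using e0
    · simp
    · simpa using e2
  · refine (h2 i).trans ?_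
    fin_cases i <;> simp [Matrix.one_apply]

/-- After matching columns 0 and 2 by an element of the stabilizer, what remains of A is unitary
with two standard columns, hence diagonal with one free phase. -/
theorem exists_complexMatrix_eq {A : Matrix (Fin 3) (Fin 3) ℂ} (hA : star A * A = 1) :
    ∃ g : Spin7, conjAct g (wedge (ε 0) (ε 1)) = wedge (ε 0) (ε 1) ∧ complexMatrix g = A := by
  obtain ⟨g, hg, g0, g2⟩ := exists_fix_two_columns hA
  set M := complexMatrix g
  have hM : star M * M = 1 := star_complexMatrix_mul hg
  have hM' : M * star M = 1 := mul_eq_one_comm.mp hM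
  have hB : star (star M * A) * (star M * A) = 1 := by
    rw [star_mul, star_star, mul_assoc, ← mul_assoc M, hM', one_mul, hA]
  have hcol : ∀ j, (∀ i, M i j = A i j) → ∀ i, (star M * A) i j =
      (1 : Matrix (Fin 3) (Fin 3) ℂ) i j := fun j hj i => by
    rw [← hM, Matrix.mul_apply, Matrix.mul_apply]
    simp only [hj]
  obtain ⟨hz, hd⟩ := eq_diagonal_of_star_mul hB (hcol 0 g0) (hcol 2 g2)
  obtain ⟨k, hk, hkd⟩ := exists_complexMatrix_eq_diagonal hz
  refine ⟨g * k, ?_, ?_⟩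
  · have h : (g * k) • basePoint = basePoint := by
      rw [mul_smul, show k • basePoint = basePoint from Subtype.ext hk]
      exact Subtype.ext hg
    exact congrArg Subtype.val h
  · rw [complexMatrix_mul hg, hkd, ← hd]
    change M * (star M * A) = A
    rw [← mul_assoc, hM', one_mul]

end Stabilizer

theorem conjAct_stabilizer (g : MulAction.stabilizer Spin7 basePoint) :
    conjAct (g : Spin7) (wedge (ε 0) (ε 1)) = wedge (ε 0) (ε 1) :=
  congrArg Subtype.val (MulAction.mem_stabilizer_iff.mp g.2)

/-- The stabilizer of the base point acts on its orthogonal complement by unitary matrices. -/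
noncomputable def stabilizerHom :
    MulAction.stabilizer Spin7 basePoint →* Matrix.unitaryGroup (Fin 3) ℂ where
  toFun g := ⟨complexMatrix g, Matrix.mem_unitaryGroup_iff'.mpr
    (star_complexMatrix_mul (conjAct_stabilizer g))⟩
  map_one' := by
    apply Subtype.ext
    ext i j
    change complexCoord (toEndo 1 (complexBasis j)) i = (1 : Matrix (Fin 3) (Fin 3) ℂ) i j
    rw [toEndo_one_apply, complexCoord_complexBasis, Pi.single_apply, Matrix.one_apply]
  map_mul' g k := Subtype.ext (complexMatrix_mul (conjAct_stabilizer g) k)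

theorem bijective_stabilizerHom : Function.Bijective stabilizerHom := by
  refine ⟨fun g k h => ?_, fun A => ?_⟩
  · have h' : complexMatrix g = complexMatrix k := congrArg Subtype.val h
    apply Subtype.ext
    apply toEndo_injective
    rw [← ofComplexMatrix_complexMatrix (conjAct_stabilizer g), h',
      ofComplexMatrix_complexMatrix (conjAct_stabilizer k)]
  · obtain ⟨g, hg, hgA⟩ := exists_complexMatrix_eq (Matrix.mem_unitaryGroup_iff'.mp A.2)
    exact ⟨⟨g, MulAction.mem_stabilizer_iff.mpr (Subtype.ext hg)⟩, Subtype.ext hgA⟩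

theorem continuous_cross3 {X : Type*} [TopologicalSpace X] {f g h : X → Oct} (hf : Continuous f)
    (hg : Continuous g) (hh : Continuous h) : Continuous fun x => cross3 (f x) (g x) (h x) := by
  have h3 : ContDiff ℝ ∞ fun p : Oct × Oct × Oct => cross3 p.1 p.2.1 p.2.2 := by
    rw [← contDiffOn_univ]
    exact contDiffOn_cross3 contDiffOn_fst contDiffOn_snd.fst contDiffOn_snd.snd
  exact h3.continuous.comp (hf.prodMk (hg.prodMk hh))

theorem continuous_frameMap {X : Type*} [TopologicalSpace X] {a b c d : X → Oct}
    (ha : Continuous a) (hb : Continuous b) (hc : Continuous c) (hd : Continuous d) :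
    Continuous fun x => frameMap (a x) (b x) (c x) (d x) := by
  have h : ∀ i, Continuous fun x => frameVec (a x) (b x) (c x) (d x) i := fun i => by
    simp only [frameVec]
    fin_cases i
    · simpa using ha
    · simpa using hb
    · simpa using hc
    · exact (continuous_cross3 ha hb hc).neg
    · simpa using hd
    · simpa using continuous_cross3 hb hc hd
    · exact (continuous_cross3 ha hc hd).neg
    · simpa using continuous_cross3 ha hb hd
  refine continuous_finsetSum _ fun i _ => ?_
  exact (ContinuousLinearMap.smulRightL ℝ Oct Oct (innerSL ℝ (ε i))).continuous.comp (h i)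

theorem continuous_clm {X V W : Type*} [TopologicalSpace X] [NormedAddCommGroup V]
    [NormedSpace ℝ V] [NormedAddCommGroup W] [NormedSpace ℝ W] (A : V →L[ℝ] W) {f : X → V}
    (hf : Continuous f) : Continuous fun x => A (f x) :=
  A.continuous.comp hf

theorem continuous_ofComplexMatrix : Continuous ofComplexMatrix := by
  have hv : ∀ j, Continuous fun A : Matrix (Fin 3) (Fin 3) ℂ => ofComplexCoord fun i => A i j :=
    fun j => continuous_ofComplexCoord.comp
      (continuous_pi fun i => continuous_id.matrix_elem i j)
  have h0 : Continuous fun A : Matrix (Fin 3) (Fin 3) ℂ => ofComplexCoord fun i => A i 0 := hv 0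
  have h1 : Continuous fun A : Matrix (Fin 3) (Fin 3) ℂ => ofComplexCoord fun i => A i 1 := hv 1
  have h2 : Continuous fun A : Matrix (Fin 3) (Fin 3) ℂ => ofComplexCoord fun i => A i 2 := hv 2
  exact continuous_frameMap
    (continuous_cross3 h0 h2 (continuous_clm (contract (wedge (ε 0) (ε 1))) h1)).fun_neg
    (continuous_cross3 h0 h2 h1).fun_neg h0 h2

theorem exists_stabilizer_equiv :
    ∃ χ : MulAction.stabilizer Spin7 basePoint ≃ₜ* Matrix.unitaryGroup (Fin 3) ℂ,
      ∀ (g : MulAction.stabilizer Spin7 basePoint) (x : Oct), complexCoord (toEndo g x) =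
        (χ g : Matrix (Fin 3) (Fin 3) ℂ).mulVec (complexCoord x) := by
  let e := MulEquiv.ofBijective stabilizerHom bijective_stabilizerHom
  have hcont : Continuous e := by
    rw [continuous_induced_rng]
    refine continuous_matrix fun i j => ?_
    have h1 : Continuous fun g : MulAction.stabilizer Spin7 basePoint =>
        toEndo (g : Spin7) (complexBasis j) :=
      (isInducing_toEndo.continuous.comp continuous_subtype_val).clm_apply continuous_const
    exact (continuous_apply i).comp
      ((complexCoordL.continuous_of_finiteDimensional).comp h1)
  -- The inverse is the explicit map `ofComplexMatrix`, a polynomial in the entries and their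
  -- conjugates.
  have hinv : Continuous e.symm := by
    rw [continuous_induced_rng, isInducing_toEndo.continuous_iff]
    have h : toEndo ∘ Subtype.val ∘ e.symm =
        fun A : Matrix.unitaryGroup (Fin 3) ℂ => ofComplexMatrix A := by
      funext A
      have hA : complexMatrix (e.symm A : Spin7) = A := congrArg Subtype.val (e.apply_symm_apply A)
      rw [← hA, ofComplexMatrix_complexMatrix (conjAct_stabilizer _)]
      rfl
    rw [h]
    exact continuous_ofComplexMatrix.comp continuous_subtype_val
  exact ⟨{ e with continuous_toFun := hcont, continuous_invFun := hinv },
    fun g x => complexCoord_toEndo (conjAct_stabilizer g) x⟩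

/-! ### Non-integrability -/

/-- The derivative of the Cauchy–Riemann equations along a curve, for an almost complex structure
`J` and a vector field `X` that depend linearly on the point. -/
theorem deriv_cauchyRiemann {V : Type*} [NormedAddCommGroup V] [NormedSpace ℝ V] {n : ℕ}
    {φ : V → Fin n → ℂ} (J : V →L[ℝ] V →L[ℝ] V) (X : V →L[ℝ] V) {c : ℝ → V} {b p : V}
    (hφ : ContDiffAt ℝ ∞ φ p) (hc : HasDerivAt c b 0) (hp : c 0 = p)
    (h : ∀ᶠ t in 𝓝 0, fderiv ℝ φ (c t) (J (c t) (X (c t))) =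
      Complex.I • fderiv ℝ φ (c t) (X (c t))) :
    fderiv ℝ (fderiv ℝ φ) p b (J p (X p)) + fderiv ℝ φ p (J b (X p) + J p (X b)) =
      Complex.I • (fderiv ℝ (fderiv ℝ φ) p b (X p) + fderiv ℝ φ p (X b)) := by
  subst hp
  have hD : HasFDerivAt (fderiv ℝ φ) (fderiv ℝ (fderiv ℝ φ) (c 0)) (c 0) :=
    ((hφ.fderiv_right (m := 1) (by norm_cast)).differentiableAt (by norm_num)).hasFDerivAt
  have hD' : HasDerivAt (fun t => fderiv ℝ φ (c t)) (fderiv ℝ (fderiv ℝ φ) (c 0) b) 0 :=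
    hD.comp_hasDerivAt 0 hc
  have hX : HasDerivAt (fun t => X (c t)) (X b) 0 := X.hasFDerivAt.comp_hasDerivAt 0 hc
  have hJ : HasDerivAt (fun t => J (c t)) (J b) 0 := J.hasFDerivAt.comp_hasDerivAt 0 hc
  have h1 := hD'.clm_apply (hJ.clm_apply hX)
  have h2 := (hD'.clm_apply hX).const_smul Complex.I
  exact h1.unique (h2.congr_of_eventuallyEq h)

/-- The commutator with a fixed endomorphism. -/
noncomputable def commutator (A : Endo) : Endo →L[ℝ] Endo :=
  ContinuousLinearMap.compL ℝ Oct Oct Oct A - (ContinuousLinearMap.compL ℝ Oct Oct Oct).flip A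

theorem commutator_wedge (a b x y : Oct) : commutator (wedge a b) (wedge x y) =
    wedge (wedge a b x) y + wedge x (wedge a b y) := by
  ext1 v
  change wedge a b (wedge x y v) - wedge x y (wedge a b v) = _
  rw [add_apply, wedge_apply x y v, wedge_apply x y, wedge_apply _ y, wedge_apply x _ v,
    inner_wedge_swap, inner_wedge_swap, map_sub, map_smul, map_smul]
  module

theorem wedge_add_wedge_mem_tangent {x y u v : Oct} (h : IsPair x y) (hu : ⟪x, u⟫_ℝ = 0)
    (hv : ⟪y, v⟫_ℝ = 0) : wedge u y + wedge x v ∈ tangent grass (wedge x y) := by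
  rw [← wedge_add_smul_left u y (-⟪y, u⟫_ℝ), ← wedge_add_smul_right x v (-⟪x, v⟫_ℝ)]
  apply h.mem_tangent <;>
    simp only [inner_add_right, real_inner_smul_right, h.xx, h.yy, h.xy, h.yx, hu, hv] <;> ring

/-- The commutator with a ∧ b is an infinitesimal rotation. It provides tangent fields that are
linear in the point, so their derivatives are immediate. -/
theorem commutator_mem_tangent (a b : Oct) {p : Endo} (hp : p ∈ grass) :
    commutator (wedge a b) p ∈ tangent grass p := by
  obtain ⟨x, y, h, rfl⟩ := mem_grass.mp hp
  have hs : ∀ v, ⟪v, wedge a b v⟫_ℝ = 0 := fun v => by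
    rw [real_inner_comm, inner_wedge_apply]; ring
  rw [commutator_wedge]
  exact wedge_add_wedge_mem_tangent h (hs x) (hs y)

theorem acs_wedge_fst (x z w : Oct) :
    acs (wedge x z) (wedge x w) = wedge x (-cross3 x z w) := by
  rw [acs_wedge_wedge, contract_fst, contract_wedge, ← wedgeC_apply, map_zero]
  ext1 v; simp

theorem wedge_basePoint_mem_tangent {z : Oct} (h1 : z 1 = 0) :
    wedge (ε 0) z ∈ tangent grass (wedge (ε 0) (ε 1)) := by
  have h := wedge_add_wedge_mem_tangent (u := 0) (v := z) isPair_ε (by simp) (by simpa using h1)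
  have e : wedge 0 (ε 1) + wedge (ε 0) z = wedge (ε 0) z := by
    ext1 v; simp [wedge_apply]
  rwa [e] at h

section Integrable

variable {U : Set Endo} {n : ℕ} {φ : Endo → Fin n → ℂ}

/-- The Cauchy-Riemann equation for the field X generated by ε 1 ∧ w is differentiated in the
direction ε 0 ∧ z. The right side is the term from the derivative of J, which is again a value of J
because J depends linearly on the point. -/
theorem second_cauchyRiemann (hU : IsOpen U) (hpU : wedge (ε 0) (ε 1) ∈ U)
    (hφ : ContDiffOn ℝ ∞ φ U)
    (hol : ∀ q ∈ grass ∩ U, ∀ v ∈ tangent grass q,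
      fderiv ℝ φ q (acs q v) = Complex.I • fderiv ℝ φ q v)
    {z w : Oct} (hz1 : z 1 = 0) (hw0 : w 0 = 0) (hw1 : w 1 = 0)
    (hzw : ⟪z, w⟫_ℝ = 0) :
    fderiv ℝ (fderiv ℝ φ) (wedge (ε 0) (ε 1)) (wedge (ε 0) z)
        (wedge (ε 0) (contract (wedge (ε 0) (ε 1)) w)) -
      Complex.I • fderiv ℝ (fderiv ℝ φ) (wedge (ε 0) (ε 1)) (wedge (ε 0) z) (wedge (ε 0) w) =
      fderiv ℝ φ (wedge (ε 0) (ε 1)) (wedge (ε 0) (cross3 (ε 0) z w)) := by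
  obtain ⟨c, hc, hcm, hc0, hcd⟩ := wedge_basePoint_mem_tangent hz1
  have hc' : HasDerivAt c (wedge (ε 0) z) 0 := by
    rw [← hcd]; exact (hc.differentiable (by simp) 0).hasDerivAt
  have hev : ∀ᶠ t in 𝓝 (0 : ℝ), c t ∈ U :=
    hc.continuous.continuousAt.eventually_mem (by rw [hc0]; exact hU.mem_nhds hpU)
  have key := deriv_cauchyRiemann acsC (commutator (wedge (ε 1) w))
    (hφ.contDiffAt (hU.mem_nhds hpU)) hc' hc0 (hev.mono fun t ht =>
      hol _ ⟨hcm t, ht⟩ _ (commutator_mem_tangent _ _ (hcm t)))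
  have hXp : commutator (wedge (ε 1) w) (wedge (ε 0) (ε 1)) = wedge (ε 0) w := by
    rw [commutator_wedge, wedge_apply, wedge_apply]
    ext1 v; simp [hw0, hw1, wedge_apply, ε_apply]
  -- With z and w orthogonal, the derivative of X in this direction vanishes; only the variation of
  -- J remains.
  have hXb : commutator (wedge (ε 1) w) (wedge (ε 0) z) = 0 := by
    rw [commutator_wedge, wedge_apply, wedge_apply, real_inner_comm z w, hzw]
    ext1 v; simp [hw0, hz1, wedge_apply, ε_apply]
  have hJ : acs (wedge (ε 0) (ε 1)) (wedge (ε 0) w) =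
      wedge (ε 0) (contract (wedge (ε 0) (ε 1)) w) := by
    rw [acs_wedge_fst, contract_wedge]
  rw [hXp, hXb, map_zero, map_zero, add_zero, add_zero, acsC_apply, acsC_apply, hJ, acs_wedge_fst,
    wedge_neg_right, map_neg] at key
  rw [← key]
  abel

/-- The Nijenhuis tensor is nonzero on the directions ε 0 ∧ ε 2 and ε 0 ∧ ε 4; its value would have
to vanish under an injective dφ. -/
theorem not_isIntegrable : ¬ IsIntegrable 6 grass acs := by
  intro h
  obtain ⟨U, φ, hU, hpU, hφ, hbij, hol⟩ := h _ basePoint_mem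
  set p := wedge (ε 0) (ε 1) with hp
  have hI : ∀ i, contract p (ε i) = !₂[0, 0, -ε i 3, ε i 2, ε i 7, ε i 6, -ε i 5, -ε i 4] :=
    fun i => contract_basePoint _
  have hI2 : contract p (ε 2) = ε 3 := by
    rw [hI]; refine oct_ext ?_ ?_ ?_ ?_ ?_ ?_ ?_ ?_ <;> simp [ε_apply]
  have hI4 : contract p (ε 4) = -ε 7 := by
    rw [hI]; refine oct_ext ?_ ?_ ?_ ?_ ?_ ?_ ?_ ?_ <;> simp [ε_apply]
  have hI6 : contract p (ε 6) = ε 5 := by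
    rw [hI]; refine oct_ext ?_ ?_ ?_ ?_ ?_ ?_ ?_ ?_ <;> simp [ε_apply]
  have hc1 : cross3 (ε 0) (-ε 7) (ε 2) = -ε 5 := by
    refine oct_ext ?_ ?_ ?_ ?_ ?_ ?_ ?_ ?_ <;> simp [cross3_coords, octMul_coords, octConj_coords]
    norm_num
  have hc2 : cross3 (ε 0) (ε 3) (ε 4) = ε 5 := by
    refine oct_ext ?_ ?_ ?_ ?_ ?_ ?_ ?_ ?_ <;> simp [cross3_coords, octMul_coords, octConj_coords]
    norm_num
  have hc3 : cross3 (ε 0) (ε 4) (ε 2) = ε 6 := by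
    refine oct_ext ?_ ?_ ?_ ?_ ?_ ?_ ?_ ?_ <;> simp [cross3_coords, octMul_coords, octConj_coords]
    norm_num
  -- The pairs (z, w) are (Iε 4, ε 2), (Iε 2, ε 4), (ε 4, ε 2), (ε 2, ε 4), the four combinations in
  -- a Nijenhuis tensor.
  have e1 := second_cauchyRiemann hU hpU hφ hol (z := -ε 7) (w := ε 2) (by simp [ε_apply])
    (by simp [ε_apply]) (by simp [ε_apply]) (by simp [ε_apply])
  have e2 := second_cauchyRiemann hU hpU hφ hol (z := ε 3) (w := ε 4) (by simp [ε_apply])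
    (by simp [ε_apply]) (by simp [ε_apply]) (by simp [ε_apply])
  have e3 := second_cauchyRiemann hU hpU hφ hol (z := ε 4) (w := ε 2) (by simp [ε_apply])
    (by simp [ε_apply]) (by simp [ε_apply]) (by simp [ε_apply])
  have e4 := second_cauchyRiemann hU hpU hφ hol (z := ε 2) (w := ε 4) (by simp [ε_apply])
    (by simp [ε_apply]) (by simp [ε_apply]) (by simp [ε_apply])
  rw [← hp, hI2, hc1, wedge_neg_right _ (ε 5), map_neg (fderiv ℝ φ p)] at e1
  rw [← hp, hI4, hc2] at e2
  rw [← hp, hI2, hc3] at e3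
  rw [← hp, hI4, cross3_ε₀₂₄, wedge_neg_right _ (ε 6), map_neg (fderiv ℝ φ p)] at e4
  have hsymm : IsSymmSndFDerivAt ℝ φ p :=
    (hφ.contDiffAt (hU.mem_nhds hpU)).isSymmSndFDerivAt (by simp; exact WithTop.coe_le_coe.mpr le_top)
  have hJ : acs p (wedge (ε 0) (ε 6)) = wedge (ε 0) (ε 5) := by
    rw [hp, acs_wedge_fst, ← contract_wedge, ← hp, hI6]
  have h6 := hol p ⟨basePoint_mem, hpU⟩ _
    (wedge_basePoint_mem_tangent (z := ε 6) (by simp [ε_apply]))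
  rw [hJ] at h6
  rw [hsymm.eq (wedge (ε 0) (ε 3)) (wedge (ε 0) (-ε 7))] at e2
  rw [hsymm.eq (wedge (ε 0) (ε 2)) (wedge (ε 0) (-ε 7)),
    hsymm.eq (wedge (ε 0) (ε 2)) (wedge (ε 0) (ε 4))] at e4
  rw [hsymm.eq (wedge (ε 0) (ε 4)) (wedge (ε 0) (ε 3))] at e3
  -- Write F k for dφ(ε 0 ∧ ε k). In e1 - e2 - i(e3 - e4) all second derivatives cancel by symmetry,
  -- leaving 0 = -2 F 5 - 2i F 6, and `h6` says F 5 = i F 6. Hence F 5 = 0.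
  have hzero : fderiv ℝ φ p (wedge (ε 0) (ε 5)) = 0 := by
    funext i
    have e1 := congrFun e1 i
    have e2 := congrFun e2 i
    have e3 := congrFun e3 i
    have e4 := congrFun e4 i
    have h6 := congrFun h6 i
    simp only [Pi.sub_apply, Pi.smul_apply, Pi.neg_apply, smul_eq_mul] at e1 e2 e3 e4 h6
    rw [Pi.zero_apply]
    linear_combination (1 / 4 : ℂ) * (e1 - e2 - Complex.I * (e3 - e4) + 2 * h6)
  have h5 := wedge_basePoint_mem_tangent (z := ε 5) (by simp [ε_apply])
  have h00 : (0 : Endo) ∈ tangent grass p := by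
    have h := wedge_basePoint_mem_tangent (z := 0) (by simp)
    rwa [show wedge (ε 0) 0 = 0 by ext1 v; simp [wedge_apply]] at h
  have h := hbij.injOn h5 h00 (hzero.trans (map_zero _).symm)
  have h' := congrArg (fun A : Endo => A (ε 0) 5) h
  simp [wedge_apply, ε_apply] at h'

end Integrable

/-! ### Oriented planes and bivectors -/

theorem wedge_linear_combination (x y : Oct) (a b c d : ℝ) :
    wedge (a • x + b • y) (c • x + d • y) = (a * d - b * c) • wedge x y := by
  ext1 v
  simp only [wedge_apply, smul_apply, inner_add_left, real_inner_smul_left]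
  module

theorem IsPair.ne_zero {x y : Oct} (h : IsPair x y) : wedge x y ≠ 0 := fun h0 => by
  have h1 := congrArg (fun A : Endo => ⟪A x, y⟫_ℝ) h0
  simp only [h.wedge_fst, h.yy, zero_apply, inner_zero_left] at h1
  norm_num at h1

section Plane

variable {P : Submodule ℝ Oct} (hP : Module.finrank ℝ P = 2) (o : Orientation ℝ P (Fin 2))

/-- The unit bivector of an oriented plane. -/
noncomputable def planeBivector : Endo :=
  let b := o.finOrthonormalBasis (by norm_num) hP
  wedge (b 0 : P) (b 1 : P)

theorem isPair_finOrthonormalBasis :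
    IsPair (o.finOrthonormalBasis (by norm_num) hP 0 : P)
      (o.finOrthonormalBasis (by norm_num) hP 1 : P) := by
  have h := (o.finOrthonormalBasis (by norm_num) hP).inner_eq_ite
  exact ⟨(h 0 0).trans (if_pos rfl), (h 1 1).trans (if_pos rfl), (h 0 1).trans (if_neg (by decide))⟩

theorem planeBivector_mem : planeBivector hP o ∈ grass :=
  mem_grass.mpr ⟨_, _, isPair_finOrthonormalBasis hP o, rfl⟩

/-- The link between orientations and bivectors: a basis is positively oriented exactly when its
wedge is a positive multiple of the unit bivector. -/
theorem wedge_eq_det_smul_planeBivector (v : Fin 2 → P) :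
    wedge (v 0) (v 1) =
      ((o.finOrthonormalBasis (by norm_num) hP).toBasis.det v) • planeBivector hP o := by
  set b := o.finOrthonormalBasis (by norm_num) hP with hb
  have hv : ∀ j, (v j : Oct) = b.toBasis.toMatrix v 0 j • (b 0 : Oct) +
      b.toBasis.toMatrix v 1 j • (b 1 : Oct) := fun j => by
    have h := b.toBasis.sum_repr (v j)
    rw [Fin.sum_univ_two] at h
    have h' := congrArg Subtype.val h
    rw [OrthonormalBasis.coe_toBasis] at h'
    exact h'.symm
  rw [Module.Basis.det_apply, Matrix.det_fin_two, hv 0, hv 1, wedge_linear_combination]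
  rw [planeBivector, ← hb]
  congr 1
  ring

theorem IsOrientedBasis.wedge_eq {o} {e : Fin 2 → Oct} (h : IsOrientedBasis P o e) :
    ∃ t : ℝ, 0 < t ∧ wedge (e 0) (e 1) = t • planeBivector hP o := by
  obtain ⟨b, hb, hbe⟩ := h
  refine ⟨(o.finOrthonormalBasis (by norm_num) hP).toBasis.det b, ?_, ?_⟩
  swap
  · rw [← hbe 0, ← hbe 1]
    exact wedge_eq_det_smul_planeBivector hP o b
  · rw [← Module.Basis.orientation_eq_iff_det_pos, hb]
    exact o.finOrthonormalBasis_orientation _ _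

theorem isOrientedBasis_of_wedge_eq {e : Fin 2 → Oct} (he : ∀ i, e i ∈ P) {t : ℝ} (ht : 0 < t)
    (h : wedge (e 0) (e 1) = t • planeBivector hP o) : IsOrientedBasis P o e := by
  set b := (o.finOrthonormalBasis (by norm_num) hP).toBasis
  set v : Fin 2 → P := fun i => ⟨e i, he i⟩
  have hdet : b.det v = t := by
    have h1 := (wedge_eq_det_smul_planeBivector hP o v).symm.trans h
    exact smul_left_injective ℝ (isPair_finOrthonormalBasis hP o).ne_zero h1
  have hu : IsUnit (b.det v) := by rw [hdet]; exact ht.ne'.isUnit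
  obtain ⟨hli, hsp⟩ := (Module.Basis.is_basis_iff_det b).mpr hu
  refine ⟨Module.Basis.mk hli hsp.ge, ?_, fun i => by rw [Module.Basis.mk_apply]⟩
  rw [← o.finOrthonormalBasis_orientation (by norm_num) hP]
  refine ((Module.Basis.orientation_eq_iff_det_pos _ _).mpr ?_).symm
  rw [Module.Basis.coe_mk]
  exact hdet.symm ▸ ht

theorem IsPair.range_wedge {x y : Oct} (h : IsPair x y) :
    LinearMap.range (wedge x y : Oct →ₗ[ℝ] Oct) = Submodule.span ℝ (Set.range ![x, y]) := by
  rw [Matrix.range_cons, Matrix.range_cons, Matrix.range_empty, Set.union_empty,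
    Set.singleton_union]
  apply le_antisymm
  · rintro _ ⟨v, rfl⟩
    rw [ContinuousLinearMap.coe_coe, wedge_apply]
    exact Submodule.mem_span_pair.mpr ⟨-⟪y, v⟫_ℝ, ⟪x, v⟫_ℝ, by module⟩
  · rw [Submodule.span_le]
    rintro v (rfl | rfl)
    · exact ⟨-y, by rw [map_neg, ContinuousLinearMap.coe_coe, h.wedge_snd, neg_neg]⟩
    · exact ⟨x, h.wedge_fst⟩

theorem range_planeBivector : LinearMap.range (planeBivector hP o : Oct →ₗ[ℝ] Oct) = P := by
  set b := o.finOrthonormalBasis (by norm_num) hP with hb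
  have h := (isPair_finOrthonormalBasis hP o).range_wedge
  refine h.trans ?_
  apply le_antisymm
  · rw [Submodule.span_le]
    rintro _ ⟨i, rfl⟩
    fin_cases i
    exacts [(b 0).2, (b 1).2]
  · intro v hv
    have hs := congrArg Subtype.val (b.toBasis.sum_repr ⟨v, hv⟩)
    rw [Fin.sum_univ_two, OrthonormalBasis.coe_toBasis] at hs
    have hs' : b.toBasis.repr ⟨v, hv⟩ 0 • (b 0 : Oct) + b.toBasis.repr ⟨v, hv⟩ 1 • (b 1 : Oct) = v :=
      hs
    rw [← hs']
    exact Submodule.add_mem _ (Submodule.smul_mem _ _ (Submodule.subset_span ⟨0, rfl⟩))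
      (Submodule.smul_mem _ _ (Submodule.subset_span ⟨1, rfl⟩))

/-- Equal bivectors make the orthonormal basis of one orientation positive for the other. -/
theorem eq_of_planeBivector_eq {o' : Orientation ℝ P (Fin 2)}
    (h : planeBivector hP o = planeBivector hP o') : o = o' := by
  set b := o.finOrthonormalBasis (by norm_num) hP with hb
  obtain ⟨b', hb', hbb⟩ := isOrientedBasis_of_wedge_eq hP o' (e := fun i => (b i : P))
    (fun i => (b i).2) one_pos (by rw [one_smul, ← h]; rfl)
  have : b' = b.toBasis := by
    ext i : 1
    exact Subtype.ext ((hbb i).trans (by rw [OrthonormalBasis.coe_toBasis]))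
  rw [← hb', this, hb, o.finOrthonormalBasis_orientation]

end Plane

/-- The plane is the range of q, oriented by the pair that represents q. With `range_planeBivector`,
this identifies oriented planes with points of the Grassmannian. -/
theorem exists_orientation {q : Endo} (hq : q ∈ grass) :
    ∃ (hP : Module.finrank ℝ (LinearMap.range (q : Oct →ₗ[ℝ] Oct)) = 2)
      (o : Orientation ℝ (LinearMap.range (q : Oct →ₗ[ℝ] Oct)) (Fin 2)),
      planeBivector hP o = q := by
  obtain ⟨x, y, h, rfl⟩ := mem_grass.mp hq
  have hli : LinearIndependent ℝ ![x, y] := by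
    refine Orthonormal.linearIndependent (𝕜 := ℝ) ?_
    rw [orthonormal_iff_ite]
    intro i j
    fin_cases i <;> fin_cases j <;> simp only []
    exacts [h.xx, h.xy, h.yx, h.yy]
  have key : ∀ P : Submodule ℝ Oct, P = Submodule.span ℝ (Set.range ![x, y]) →
      ∃ (hP : Module.finrank ℝ P = 2) (o : Orientation ℝ P (Fin 2)),
        planeBivector hP o = wedge x y := by
    rintro _ rfl
    have hP : Module.finrank ℝ (Submodule.span ℝ (Set.range ![x, y])) = 2 := by
      rw [finrank_span_eq_card hli, Fintype.card_fin]
    refine ⟨hP, (Module.Basis.span hli).orientation, ?_⟩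
    have ho : IsOrientedBasis _ (Module.Basis.span hli).orientation ![x, y] :=
      ⟨_, rfl, fun i => congrArg Subtype.val (Module.Basis.span_apply hli i)⟩
    obtain ⟨t, ht, hw⟩ := ho.wedge_eq hP
    obtain ⟨-, hn⟩ := normalize_wedge (planeBivector_mem hP _) ht hw
    rw [← hn]
    change _ • wedge x y = _
    simp only [Matrix.cons_val_zero, Matrix.cons_val_one, h.xx, h.yy, h.xy]
    norm_num
  exact key _ h.range_wedge

/-! ### The associated map of a cone -/

section Cone

variable {S : Type*} [TopologicalSpace S] [ChartedSpace (EuclideanSpace ℝ (Fin 2)) S]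

namespace RuledCone

theorem gauss_mem (C : RuledCone S) (σ : S) : C.gauss σ ∈ grass := planeBivector_mem _ _

theorem gauss_eq_normalize (C : RuledCone S) {σ : S} {e : Fin 2 → Oct}
    (h : IsOrientedBasis (C.plane σ) (C.orientation σ) e) :
    0 < ⟪e 0, e 0⟫_ℝ * ⟪e 1, e 1⟫_ℝ - ⟪e 0, e 1⟫_ℝ ^ 2 ∧ C.gauss σ =
      (Real.sqrt (⟪e 0, e 0⟫_ℝ * ⟪e 1, e 1⟫_ℝ - ⟪e 0, e 1⟫_ℝ ^ 2))⁻¹ • wedge (e 0) (e 1) := by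
  obtain ⟨t, ht, hw⟩ := h.wedge_eq (C.finrank_plane σ)
  obtain ⟨h1, h2⟩ := normalize_wedge (planeBivector_mem _ _) ht hw
  exact ⟨h1, h2.symm⟩

theorem contMDiff_gauss (C : RuledCone S) : ContMDiff (𝓡 2) 𝓘(ℝ, Endo) ∞ C.gauss := by
  intro σ₀
  obtain ⟨U, e, hU, hσ, he, hb⟩ := C.exists_frame σ₀
  have hF : ContDiffOn ℝ ∞ (fun p : Oct × Oct =>
      (Real.sqrt (⟪p.1, p.1⟫_ℝ * ⟪p.2, p.2⟫_ℝ - ⟪p.1, p.2⟫_ℝ ^ 2))⁻¹ • wedge p.1 p.2)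
      {p | 0 < ⟪p.1, p.1⟫_ℝ * ⟪p.2, p.2⟫_ℝ - ⟪p.1, p.2⟫_ℝ ^ 2} := by
    have hf : ContDiff ℝ ∞ fun p : Oct × Oct =>
        ⟪p.1, p.1⟫_ℝ * ⟪p.2, p.2⟫_ℝ - ⟪p.1, p.2⟫_ℝ ^ 2 :=
      ((contDiff_fst.inner ℝ contDiff_fst).mul (contDiff_snd.inner ℝ contDiff_snd)).sub
        ((contDiff_fst.inner ℝ contDiff_snd).pow 2)
    have hw : ContDiff ℝ ∞ fun p : Oct × Oct => wedgeC p.1 p.2 :=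
      ((contDiff_clm (W := Oct →L[ℝ] Endo) wedgeC).comp contDiff_fst).clm_apply contDiff_snd
    exact ((hf.contDiffOn.sqrt fun p hp => ne_of_gt hp).inv fun p hp =>
      (Real.sqrt_pos.mpr hp).ne').smul hw.contDiffOn
  have h1 : ContMDiffAt (𝓡 2) 𝓘(ℝ, Oct × Oct) ∞ (fun σ => (e 0 σ, e 1 σ)) σ₀ :=
    ((he 0).contMDiffAt (hU.mem_nhds hσ)).prodMk_space ((he 1).contMDiffAt (hU.mem_nhds hσ))
  have hopen : IsOpen {p : Oct × Oct | 0 < ⟪p.1, p.1⟫_ℝ * ⟪p.2, p.2⟫_ℝ - ⟪p.1, p.2⟫_ℝ ^ 2} :=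
    isOpen_lt continuous_const (by fun_prop)
  have h2 := (hF.contDiffAt (hopen.mem_nhds (C.gauss_eq_normalize (hb σ₀ hσ)).1)).contMDiffAt.comp
    σ₀ h1
  exact h2.congr_of_eventuallyEq (Filter.eventually_of_mem (hU.mem_nhds hσ) fun σ hσ =>
    (C.gauss_eq_normalize (hb σ hσ)).2)

theorem isSmoothInto_gauss (C : RuledCone S) : IsSmoothInto grass C.gauss :=
  ⟨C.contMDiff_gauss, C.gauss_mem⟩

theorem range_gauss (C : RuledCone S) (σ : S) :
    LinearMap.range (C.gauss σ : Oct →ₗ[ℝ] Oct) = C.plane σ :=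
  range_planeBivector _ _

theorem gauss_injective : Function.Injective (gauss (S := S)) := by
  intro C C' h
  have hplane : C.plane = C'.plane := funext fun σ => by
    rw [← C.range_gauss, ← C'.range_gauss, h]
  obtain ⟨P, hP, o, ho⟩ := C
  obtain ⟨P', hP', o', ho'⟩ := C'
  obtain rfl : P = P' := hplane
  obtain rfl : o = o' := funext fun σ => eq_of_planeBivector_eq (hP σ) (o σ) (congrFun h σ)
  rfl

/-- The cone with a given associated map. -/
theorem exists_gauss_eq {γ : S → Endo} (hγ : IsSmoothInto grass γ) :
    ∃ C : RuledCone S, C.gauss = γ := by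
  choose hP o ho using fun σ => exists_orientation (hγ.2 σ)
  refine ⟨⟨fun σ => LinearMap.range (γ σ : Oct →ₗ[ℝ] Oct), hP, o, fun σ₀ => ?_⟩, funext ho⟩
  obtain ⟨x, y, h, hxy⟩ := mem_grass.mp (hγ.2 σ₀)
  have hs : ∀ v, ContMDiff (𝓡 2) 𝓘(ℝ, Oct) ∞ fun σ => γ σ v := fun v =>
    (contDiff_endo_apply v).contMDiff.comp hγ.1
  -- If γ(σ₀) = x ∧ y, then -γ y and γ x equal x and y at σ₀, and `wedge_apply_apply` keeps them an
  -- oriented frame where ⟪γ x, y⟫ > 0.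
  refine ⟨{σ | 0 < ⟪γ σ x, y⟫_ℝ}, ![fun σ => -γ σ y, fun σ => γ σ x], ?_, ?_, ?_, ?_⟩
  · exact isOpen_lt continuous_const ((hs x).continuous.inner continuous_const)
  · change 0 < ⟪γ σ₀ x, y⟫_ℝ
    rw [hxy, h.wedge_fst, h.yy]; exact one_pos
  · intro i
    fin_cases i
    · exact (hs y).neg.contMDiffOn
    · exact (hs x).contMDiffOn
  · intro σ hσ
    refine isOrientedBasis_of_wedge_eq (hP σ) (o σ) ?_ hσ ?_
    · intro i
      fin_cases i
      · exact ⟨-y, map_neg (γ σ) y⟩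
      · exact ⟨x, rfl⟩
    · rw [ho σ]
      exact wedge_apply_apply (hγ.2 σ) x y

theorem bijOn_gauss :
    Set.BijOn (gauss (S := S)) Set.univ {γ | IsSmoothInto grass γ} :=
  ⟨fun C _ => C.isSmoothInto_gauss, gauss_injective.injOn, fun _ hγ => by
    obtain ⟨C, hC⟩ := exists_gauss_eq hγ
    exact ⟨C, Set.mem_univ _, hC⟩⟩

end RuledCone

end Cone

/-! ### The quadruple cross product on planes -/

theorem cross4_add_right (x y z w w' : Oct) :
    cross4 x y z (w + w') = cross4 x y z w + cross4 x y z w' := by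
  have h := cross4Alt.map_update_add ![x, y, z, 0] 3 w w'
  simp only [cross4Alt_apply] at h
  exact h

theorem cross4_smul_right (x y z : Oct) (c : ℝ) (w : Oct) :
    cross4 x y z (c • w) = c • cross4 x y z w := by
  have h := cross4Alt.map_update_smul ![x, y, z, 0] 3 c w
  simp only [cross4Alt_apply] at h
  exact h

theorem cross4_swap_right (x y z w : Oct) : cross4 x y z w = -cross4 x y w z := by
  have h := cross4Alt.map_swap ![x, y, w, z] (i := 2) (j := 3) (by decide)
  simpa [cross4Alt_apply, Equiv.swap_apply_of_ne_of_ne] using h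

theorem cross4_self_right (x y z : Oct) : cross4 x y z z = 0 := by
  have h := cross4Alt.map_eq_zero_of_eq ![x, y, z, z] (i := 2) (j := 3) rfl (by decide)
  simpa [cross4Alt_apply] using h

theorem cross4_right_eq_fst (x y z : Oct) : cross4 x y z x = 0 := by
  have h := cross4Alt.map_eq_zero_of_eq ![x, y, z, x] (i := 0) (j := 3) rfl (by decide)
  simpa [cross4Alt_apply] using h

theorem cross4_right_eq_snd (x y z : Oct) : cross4 x y z y = 0 := by
  have h := cross4Alt.map_eq_zero_of_eq ![x, y, z, y] (i := 1) (j := 3) rfl (by decide)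
  simpa [cross4Alt_apply] using h

theorem cross4_add_span_right {x y v : Oct} (hv : v ∈ Submodule.span ℝ {x, y}) (z w : Oct) :
    cross4 x y z (w + v) = cross4 x y z w := by
  obtain ⟨a, b, rfl⟩ := Submodule.mem_span_pair.mp hv
  rw [cross4_add_right, cross4_add_right, cross4_smul_right, cross4_smul_right, cross4_right_eq_fst,
    cross4_right_eq_snd, smul_zero, smul_zero, add_zero, add_zero]

theorem cross4_add_span {x y v v' : Oct} (hv : v ∈ Submodule.span ℝ {x, y})
    (hv' : v' ∈ Submodule.span ℝ {x, y}) (z w : Oct) :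
    cross4 x y (z + v) (w + v') = cross4 x y z w := by
  rw [cross4_add_span_right hv', cross4_swap_right, cross4_add_span_right hv, ← cross4_swap_right]

theorem cross4_linear_combination (x y z w : Oct) (a b c d : ℝ) :
    cross4 (a • x + b • y) (c • x + d • y) z w = (a * d - b * c) • cross4 x y z w := by
  have e : ∀ u v, cross4 u v z w = cross4 z w u v := fun u v => by
    -- Rotating twice exchanges the two pairs of arguments and is an even permutation.
    have h := cross4Alt.map_perm ![z, w, u, v] (finRotate 4 * finRotate 4)
    have hs : Equiv.Perm.sign (finRotate 4 * finRotate 4) = 1 := by decide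
    rw [hs, one_smul] at h
    simpa [cross4Alt_apply, finRotate_apply] using h
  rw [e, e, cross4_add_right, cross4_smul_right, cross4_smul_right, cross4_swap_right z w _ x,
    cross4_swap_right z w _ y]
  simp only [cross4_add_right, cross4_smul_right, cross4_self_right, cross4_swap_right z w y x]
  module

theorem inner_cross4_self_of_isPair {x y z w : Oct} (h : IsPair x y) (hxz : ⟪x, z⟫_ℝ = 0)
    (hyz : ⟪y, z⟫_ℝ = 0) (hxw : ⟪x, w⟫_ℝ = 0) (hyw : ⟪y, w⟫_ℝ = 0) :
    ⟪cross4 x y z w, cross4 x y z w⟫_ℝ = ⟪z, z⟫_ℝ * ⟪w, w⟫_ℝ - ⟪z, w⟫_ℝ ^ 2 := by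
  rcases eq_or_ne z 0 with rfl | hz
  · have h0 : cross4 x y 0 w = 0 := by
      rw [cross4_swap_right, ← zero_smul ℝ (0 : Oct), cross4_smul_right, zero_smul, neg_zero,
        zero_smul]
    rw [h0]; simp
  · have hz' := inner_self_pos hz
    -- One Gram-Schmidt step makes w orthogonal to z without changing the product.
    set t := -(⟪z, w⟫_ℝ / ⟪z, z⟫_ℝ) with ht
    have hw : cross4 x y z (w + t • z) = cross4 x y z w := by
      rw [cross4_add_right, cross4_smul_right, cross4_self_right, smul_zero, add_zero]
    rw [← hw, inner_cross4_self h.xy hxz _ hyz _ _, h.xx, h.yy]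
    · simp only [inner_add_left, inner_add_right, real_inner_smul_left, real_inner_smul_right,
        real_inner_comm z w, ht]
      field_simp
      ring
    · rw [inner_add_right, real_inner_smul_right, hxw, hxz]; ring
    · rw [inner_add_right, real_inner_smul_right, hyw, hyz]; ring
    · rw [inner_add_right, real_inner_smul_right, ht]; field_simp; ring

/-! ### Complex coordinates on the orthogonal complement of a plane -/

/-- The complex coordinates on the orthogonal complement of the plane of `g (ε 0)`, `g (ε 1)`. -/
noncomputable def coordAt (g : Spin7) : Oct →ₗ[ℝ] (Fin 3 → ℂ) :=
  complexCoordL ∘ₗ (toEndo g⁻¹ : Oct →ₗ[ℝ] Oct)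

theorem coordAt_apply (g : Spin7) (v : Oct) : coordAt g v = complexCoord (toEndo g⁻¹ v) := rfl

section

variable (g : Spin7)

theorem toEndo_inv_coord {v : Oct} (h0 : ⟪toEndo g (ε 0), v⟫_ℝ = 0)
    (h1 : ⟪toEndo g (ε 1), v⟫_ℝ = 0) : toEndo g⁻¹ v 0 = 0 ∧ toEndo g⁻¹ v 1 = 0 := by
  rw [← inner_ε_left, ← inner_ε_left, ← inner_toEndo g, ← inner_toEndo g (ε 1), toEndo_apply_inv]
  exact ⟨h0, h1⟩

theorem toEndo_inv_contract (v : Oct) :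
    toEndo g⁻¹ (contract (wedge (toEndo g (ε 0)) (toEndo g (ε 1))) v) =
      contract (wedge (ε 0) (ε 1)) (toEndo g⁻¹ v) := by
  rw [← conjAct_wedge, contract_conjAct g basePoint_mem, conjAct_apply, toEndo_inv_apply]

theorem coordAt_contract (v : Oct) :
    coordAt g (contract (wedge (toEndo g (ε 0)) (toEndo g (ε 1))) v) =
      Complex.I • coordAt g v := by
  rw [coordAt_apply, toEndo_inv_contract, complexCoord_contract, coordAt_apply]

theorem eq_of_coordAt_eq {v w : Oct} (hv0 : ⟪toEndo g (ε 0), v⟫_ℝ = 0)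
    (hv1 : ⟪toEndo g (ε 1), v⟫_ℝ = 0) (hw0 : ⟪toEndo g (ε 0), w⟫_ℝ = 0)
    (hw1 : ⟪toEndo g (ε 1), w⟫_ℝ = 0) (h : coordAt g v = coordAt g w) : v = w := by
  obtain ⟨a0, a1⟩ := toEndo_inv_coord g hv0 hv1
  obtain ⟨b0, b1⟩ := toEndo_inv_coord g hw0 hw1
  have : toEndo g⁻¹ v = toEndo g⁻¹ w := eq_of_complexCoord_eq h (a0.trans b0.symm) (a1.trans b1.symm)
  rw [← toEndo_apply_inv g v, this, toEndo_apply_inv]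

/-- Lagrange's identity |z|²|w|² - |h(z,w)|² = Σ |minors|², where the real and imaginary parts of
the Hermitian product h are ⟪z, w⟫ and, up to sign, ⟪I z, w⟫. -/
theorem lagrange_complexCoord {z w : Oct} (hz0 : z 0 = 0) (hz1 : z 1 = 0) (hw0 : w 0 = 0)
    (hw1 : w 1 = 0) :
    ⟪z, z⟫_ℝ * ⟪w, w⟫_ℝ - ⟪z, w⟫_ℝ ^ 2 - ⟪contract (wedge (ε 0) (ε 1)) z, w⟫_ℝ ^ 2 =
      Complex.normSq (complexCoord z 0 * complexCoord w 1 - complexCoord z 1 * complexCoord w 0) +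
      Complex.normSq (complexCoord z 0 * complexCoord w 2 - complexCoord z 2 * complexCoord w 0) +
      Complex.normSq (complexCoord z 1 * complexCoord w 2 - complexCoord z 2 * complexCoord w 1) := by
  rw [contract_basePoint]
  simp only [inner_eq_sum]
  simp [Complex.normSq_apply, complexCoord, hz0, hz1, hw0, hw1]
  ring

theorem sum_psi_sq (x y z w : Oct) :
    ∑ m, psi m x y z w ^ 2 =
      ⟪cross4 x y z w, cross4 x y z w⟫_ℝ - cayleyForm x y z w ^ 2 := by
  simp only [psi, cayleyForm, inner_ε_left]
  rw [inner_eq_sum, Fin.sum_univ_seven]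
  simp only [Fin.castSucc, Fin.castAdd, Fin.castLE]
  ring_nf
  rfl

/-- The pointwise Cayley condition. Σ ψ_m² is the squared length of the quadruple product minus Φ² =
⟪I z, w⟫², which Lagrange's identity turns into the squared moduli of the 2×2 minors. -/
theorem psi_eq_zero_iff {z w : Oct} (hz0 : ⟪toEndo g (ε 0), z⟫_ℝ = 0)
    (hz1 : ⟪toEndo g (ε 1), z⟫_ℝ = 0) (hw0 : ⟪toEndo g (ε 0), w⟫_ℝ = 0)
    (hw1 : ⟪toEndo g (ε 1), w⟫_ℝ = 0) :
    (∀ m, psi m (toEndo g (ε 0)) (toEndo g (ε 1)) z w = 0) ↔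
      ∀ i j, coordAt g z i * coordAt g w j = coordAt g z j * coordAt g w i := by
  have h1 := sum_psi_sq (toEndo g (ε 0)) (toEndo g (ε 1)) z w
  rw [inner_cross4_self_of_isPair (isPair_ε.map g) hz0 hz1 hw0 hw1, cayleyForm_eq,
    ← inner_neg_left, ← contract_wedge] at h1
  obtain ⟨a0, a1⟩ := toEndo_inv_coord g hz0 hz1
  obtain ⟨b0, b1⟩ := toEndo_inv_coord g hw0 hw1
  have h2 := lagrange_complexCoord a0 a1 b0 b1
  rw [inner_toEndo, inner_toEndo, inner_toEndo, ← toEndo_inv_contract, inner_toEndo, ← h1] at h2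
  have h3 : (∀ m, psi m (toEndo g (ε 0)) (toEndo g (ε 1)) z w = 0) ↔
      ∑ m, psi m (toEndo g (ε 0)) (toEndo g (ε 1)) z w ^ 2 = 0 := by
    rw [Finset.sum_eq_zero_iff_of_nonneg fun _ _ => sq_nonneg _]
    simp
  rw [h3, h2]
  simp only [← coordAt_apply]
  constructor
  · intro h
    have n1 := Complex.normSq_nonneg
      (coordAt g z 0 * coordAt g w 1 - coordAt g z 1 * coordAt g w 0)
    have n2 := Complex.normSq_nonneg
      (coordAt g z 0 * coordAt g w 2 - coordAt g z 2 * coordAt g w 0)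
    have n3 := Complex.normSq_nonneg
      (coordAt g z 1 * coordAt g w 2 - coordAt g z 2 * coordAt g w 1)
    have m1 := sub_eq_zero.mp (Complex.normSq_eq_zero.mp (by linarith :
      Complex.normSq (coordAt g z 0 * coordAt g w 1 - coordAt g z 1 * coordAt g w 0) = 0))
    have m2 := sub_eq_zero.mp (Complex.normSq_eq_zero.mp (by linarith :
      Complex.normSq (coordAt g z 0 * coordAt g w 2 - coordAt g z 2 * coordAt g w 0) = 0))
    have m3 := sub_eq_zero.mp (Complex.normSq_eq_zero.mp (by linarith :
      Complex.normSq (coordAt g z 1 * coordAt g w 2 - coordAt g z 2 * coordAt g w 1) = 0))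
    intro i j
    fin_cases i <;> fin_cases j
    exacts [rfl, m1, m2, m1.symm, rfl, m3, m2.symm, m3.symm, rfl]
  · intro h
    rw [h 0 1, h 0 2, h 1 2]
    simp

end

/-! ### Pencils of vectors in `ℂ³` -/

theorem exists_smul_of_minors {b b' : Fin 3 → ℂ} (hb : b ≠ 0)
    (h : ∀ i j, b i * b' j = b j * b' i) : ∃ c : ℂ, b' = c • b := by
  obtain ⟨i, hi⟩ := Function.ne_iff.mp hb
  refine ⟨b' i / b i, funext fun j => ?_⟩
  have hi' : b i ≠ 0 := hi
  rw [Pi.smul_apply, smul_eq_mul]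
  field_simp
  linear_combination h i j

/-- If two linear families of vectors in `ℂ³` are pointwise linearly dependent but not proportional,
then their values lie in a common line. -/
theorem exists_smul_of_pencil {V : Type*} [AddCommGroup V] [Module ℝ V] (b₁ b₂ : V →ₗ[ℝ] Fin 3 → ℂ)
    (h : ∀ s i j, b₁ s i * b₂ s j = b₁ s j * b₂ s i) {s₀ : V} (h₀ : b₁ s₀ ≠ 0)
    (hne : ¬ ∃ c : ℂ, ∀ s, b₂ s = c • b₁ s) :
    (∀ s, ∃ c : ℂ, b₁ s = c • b₁ s₀) ∧ ∀ s, ∃ c : ℂ, b₂ s = c • b₁ s₀ := by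
  obtain ⟨c₀, hc₀⟩ := exists_smul_of_minors h₀ (h s₀)
  push Not at hne
  obtain ⟨s₁, hs₁⟩ := hne c₀
  -- The difference b₂ - c₀ b₁ vanishes at s₀. Polarizing the dependence between s₀ and s therefore
  -- leaves only its minors with b₁ s₀.
  have hd : ∀ s, ∃ c : ℂ, b₂ s - c₀ • b₁ s = c • b₁ s₀ := fun s => by
    apply exists_smul_of_minors h₀
    intro i j
    have e1 := h (s₀ + s) i j
    have e2 := h s i j
    have e0 := h s₀ i j
    have f : ∀ k, b₂ s₀ k = c₀ * b₁ s₀ k := fun k => congrFun hc₀ k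
    simp only [map_add, Pi.add_apply] at e1
    simp only [Pi.sub_apply, Pi.smul_apply, smul_eq_mul]
    linear_combination e1 - e2 - e0 - b₁ s i * f j + b₁ s j * f i
  have hbd : ∀ s i j, (b₂ s - c₀ • b₁ s) i * b₁ s j = (b₂ s - c₀ • b₁ s) j * b₁ s i :=
    fun s i j => by
      simp only [Pi.sub_apply, Pi.smul_apply, smul_eq_mul]
      linear_combination -(h s i j)
  have h1 : ∀ s, b₂ s ≠ c₀ • b₁ s → ∃ c : ℂ, b₁ s = c • b₁ s₀ := fun s hs => by
    obtain ⟨c, hc⟩ := exists_smul_of_minors (sub_ne_zero.mpr hs) (hbd s)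
    obtain ⟨c', hc'⟩ := hd s
    exact ⟨c * c', by rw [hc, hc', smul_smul]⟩
  -- Where the difference is nonzero, both families are on the line through it. Elsewhere s is
  -- shifted by s₁, at which the difference is nonzero.
  have h2 : ∀ s, ∃ c : ℂ, b₁ s = c • b₁ s₀ := fun s => by
    by_cases hs : b₂ s = c₀ • b₁ s
    · obtain ⟨c, hc⟩ := h1 s₁ hs₁
      obtain ⟨c', hc'⟩ := h1 (s + s₁) (by
        rw [map_add, map_add, hs, smul_add]
        exact fun hh => hs₁ (add_left_cancel hh))
      refine ⟨c' - c, ?_⟩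
      rw [sub_smul, ← hc, ← hc', map_add, add_sub_cancel_right]
    · exact h1 s hs
  refine ⟨h2, fun s => ?_⟩
  obtain ⟨c, hc⟩ := h2 s
  obtain ⟨c', hc'⟩ := hd s
  refine ⟨c' + c₀ * c, ?_⟩
  rw [add_smul, ← hc', mul_smul, ← hc, sub_add_cancel]

/-! ### Tangent vectors of the Grassmannian -/

section Tangent

variable {x y : Oct} (h : IsPair x y) {B : Endo} (hB : IsTangent (wedge x y) B)
include h hB

theorem IsTangent.mem_tangent : B ∈ tangent grass (wedge x y) := by
  obtain ⟨u, v, h1, h2, h3, h4, rfl⟩ := h.exists_of_isTangent hB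
  exact h.mem_tangent h1 h2 h3 h4

/-- A tangent vector sends the plane to its complement and, by `IsTangent.apply_of_orthogonal`, the
complement to the plane; its restriction to the plane determines it. -/
theorem IsTangent.inner_apply_wedge (z : Oct) :
    ⟪x, B (wedge x y z)⟫_ℝ = 0 ∧ ⟪y, B (wedge x y z)⟫_ℝ = 0 := by
  obtain ⟨u, v, h1, h2, h3, h4, rfl⟩ := h.exists_of_isTangent hB
  rw [wedge_apply x y z, map_sub, map_smul, map_smul, h.wedge_add_wedge_apply_fst h1 h3,
    h.wedge_add_wedge_apply_snd h2 h4]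
  simp [inner_sub_right, real_inner_smul_right, h1, h2, h3, h4]

omit h in
theorem IsTangent.apply_of_orthogonal {w : Oct} (hx : ⟪x, w⟫_ℝ = 0) (hy : ⟪y, w⟫_ℝ = 0) :
    B w = -wedge x y (wedge x y (B w)) := by
  have h1 := hB.cube w
  rw [wedge_apply_of_orthogonal hx hy] at h1
  simp only [map_zero, zero_add] at h1
  rw [h1, neg_neg]

omit h hB in
theorem contract_wedge_wedge (z : Oct) : contract (wedge x y) (wedge x y z) = 0 := by
  rw [wedge_apply x y z, map_sub, map_smul, map_smul, contract_fst, contract_snd, smul_zero,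
    smul_zero, sub_zero]

omit h hB in
theorem acs_apply_wedge (B : Endo) (z : Oct) :
    acs (wedge x y) B (wedge x y z) = contract (wedge x y) (B (wedge x y z)) := by
  rw [acs_apply, sub_apply, endo_mul_apply, endo_mul_apply, contract_wedge_wedge, map_zero, sub_zero]

theorem IsTangent.eq_of_apply_wedge {B' : Endo} (hB' : IsTangent (wedge x y) B')
    (he : ∀ z, B (wedge x y z) = B' (wedge x y z)) : B = B' := by
  obtain ⟨u, v, h1, h2, h3, h4, rfl⟩ := h.exists_of_isTangent hB
  obtain ⟨u', v', h1', h2', h3', h4', rfl⟩ := h.exists_of_isTangent hB'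
  have e1 := he y
  have e2 := he x
  rw [h.wedge_snd, map_neg, map_neg, neg_inj, h.wedge_add_wedge_apply_fst h1 h3,
    h.wedge_add_wedge_apply_fst h1' h3'] at e1
  rw [h.wedge_fst, h.wedge_add_wedge_apply_snd h2 h4, h.wedge_add_wedge_apply_snd h2' h4',
    neg_inj] at e2
  rw [e1, e2]

end Tangent

/-- An operator with square -1 has no real eigenvector. -/
theorem eq_zero_of_smul_smul {A : Endo} {a : ℝ} (h : a • a • A = -A) : A = 0 := by
  ext1 v
  have h1 : a • a • A v = -A v := congrArg (fun B : Endo => B v) h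
  have h2 : (a * a + 1) • A v = 0 := by
    rw [add_smul, mul_smul, h1, one_smul, neg_add_cancel]
  exact (smul_eq_zero.mp h2).resolve_left
    (by nlinarith [mul_self_nonneg a] : (0 : ℝ) < a * a + 1).ne'

section Surface

variable {S : Type*} [TopologicalSpace S] [ChartedSpace (EuclideanSpace ℝ (Fin 2)) S]

/-! ### Differentiation on surfaces -/

section Line

variable {E H M F : Type*} [NormedAddCommGroup E] [NormedSpace ℝ E] [TopologicalSpace H]
  {I : ModelWithCorners ℝ E H} [TopologicalSpace M] [ChartedSpace H M]
  [NormedAddCommGroup F] [NormedSpace ℝ F]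

variable (I) in
/-- A straight line in the preferred chart at `p`. -/
noncomputable def chartLine (p : M) (ξ : E) (t : ℝ) : M :=
  (extChartAt I p).symm (extChartAt I p p + t • ξ)

theorem chartLine_zero (p : M) (ξ : E) : chartLine I p ξ 0 = p := by
  rw [chartLine, zero_smul, add_zero, extChartAt_to_inv]

theorem tendsto_chartLine (p : M) (ξ : E) :
    Filter.Tendsto (chartLine I p ξ) (𝓝 0) (𝓝 p) := by
  have h1 : ContinuousAt (fun t : ℝ => extChartAt I p p + t • ξ) 0 := by fun_prop
  have h2 := continuousAt_extChartAt_symm (I := I) p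
  have h3 : ContinuousAt (chartLine I p ξ) 0 := ContinuousAt.comp (by simpa using h2) h1
  have h4 := h3.tendsto
  rwa [chartLine_zero] at h4

theorem hasFDerivAt_extChartAt [I.Boundaryless] {f : M → F} {p : M}
    (hf : MDifferentiableAt I 𝓘(ℝ, F) f p) :
    HasFDerivAt (f ∘ (extChartAt I p).symm) (mfderiv I 𝓘(ℝ, F) f p : E →L[ℝ] F)
      (extChartAt I p p) := by
  have key : ∀ L : E →L[ℝ] F, HasFDerivWithinAt (f ∘ (extChartAt I p).symm) L (Set.range I)
      (extChartAt I p p) → HasFDerivAt (f ∘ (extChartAt I p).symm) L (extChartAt I p p) :=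
    fun L h => by rwa [I.range_eq_univ, hasFDerivWithinAt_univ] at h
  exact key _ hf.hasMFDerivAt.2

/-- The differential at p is taken in the preferred chart at p, so ξ itself is the velocity of the
line. This reduces differentiation on the surface to one real variable. -/
theorem hasDerivAt_chartLine [I.Boundaryless] {f : M → F} {p : M}
    (hf : MDifferentiableAt I 𝓘(ℝ, F) f p) (ξ : E) :
    HasDerivAt (fun t => f (chartLine I p ξ t)) ((mfderiv I 𝓘(ℝ, F) f p : E →L[ℝ] F) ξ) 0 := by
  have h2 : HasDerivAt (fun t : ℝ => extChartAt I p p + t • ξ) ξ 0 := by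
    simpa using ((hasDerivAt_id (0 : ℝ)).smul_const ξ).const_add (extChartAt I p p)
  have h1 := hasFDerivAt_extChartAt hf
  have h0 : extChartAt I p p = extChartAt I p p + (0 : ℝ) • ξ := by rw [zero_smul, add_zero]
  rw [h0] at h1
  exact h1.comp_hasDerivAt (0 : ℝ) h2

end Line

theorem differential_zero {F : Type*} [NormedAddCommGroup F] [NormedSpace ℝ F] (f : S → F) (σ : S) :
    differential f σ (0 : EuclideanSpace ℝ (Fin 2)) = 0 :=
  map_zero (differential f σ)

theorem isTangent_differential {γ : S → Endo} (hγ : IsSmoothInto grass γ) (σ : S)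
    (ξ : EuclideanSpace ℝ (Fin 2)) : IsTangent (γ σ) (differential γ σ ξ) := by
  have h := isTangent_of_hasDerivAt
    (hasDerivAt_chartLine ((hγ.1 σ).mdifferentiableAt (by simp)) ξ)
    (Filter.Eventually.of_forall fun t => hγ.2 _)
  rwa [chartLine_zero] at h

/-- Differentiating γ(γ e) = -e gives de modulo the ruling, since every other term is in the image
of γ. -/
theorem differential_section {γ : S → Endo} (hγ : IsSmoothInto grass γ) {σ : S} {e : S → Oct}
    (he : MDifferentiableAt (𝓡 2) 𝓘(ℝ, Oct) e σ) (hr : ∀ᶠ τ in 𝓝 σ, γ τ (γ τ (e τ)) = -e τ)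
    (ξ : EuclideanSpace ℝ (Fin 2)) :
    ∃ a, differential e σ ξ = -differential γ σ ξ (γ σ (e σ)) + γ σ a := by
  have h1 : HasDerivAt (fun t => e (chartLine (𝓡 2) σ ξ t)) (differential e σ ξ) 0 :=
    hasDerivAt_chartLine he ξ
  have h2 : HasDerivAt (fun t => γ (chartLine (𝓡 2) σ ξ t)) (differential γ σ ξ) 0 :=
    hasDerivAt_chartLine ((hγ.1 σ).mdifferentiableAt (by simp)) ξ
  have h3 := h2.clm_apply (h2.clm_apply h1)
  have h4 := h3.unique (h1.neg.congr_of_eventuallyEq ((tendsto_chartLine σ ξ).eventually hr))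
  rw [chartLine_zero] at h4
  refine ⟨-(differential γ σ ξ (e σ) + γ σ (differential e σ ξ)), ?_⟩
  rw [map_neg, ← neg_add, h4, neg_neg]

theorem dparam_apply {e : Fin 2 → S → Oct} {σ : S}
    (he : ∀ i, MDifferentiableAt (𝓡 2) 𝓘(ℝ, Oct) (e i) σ) (r a : ℝ × ℝ)
    (ξ : EuclideanSpace ℝ (Fin 2)) :
    RuledCone.dparam e (r, σ) (a, ξ) = a.1 • e 0 σ + a.2 • e 1 σ +
      (r.1 • differential (e 0) σ ξ + r.2 • differential (e 1) σ ξ) := by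
  have hd : MDifferentiableAt (𝓘(ℝ, ℝ × ℝ).prod (𝓡 2)) 𝓘(ℝ, Oct) (RuledCone.param e) (r, σ) := by
    have h1 : MDifferentiableAt (𝓘(ℝ, ℝ × ℝ).prod (𝓡 2)) 𝓘(ℝ, ℝ × ℝ)
      (fun q : (ℝ × ℝ) × S => q.1) (r, σ) := mdifferentiableAt_fst
    have h2 : ∀ i, MDifferentiableAt (𝓘(ℝ, ℝ × ℝ).prod (𝓡 2)) 𝓘(ℝ, Oct)
        (fun q : (ℝ × ℝ) × S => e i q.2) (r, σ) := fun i =>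
      MDifferentiableAt.comp (r, σ) (he i) mdifferentiableAt_snd
    have h3 := h1.prodMk_space ((h2 0).prodMk_space (h2 1))
    have hF : Differentiable ℝ fun p : (ℝ × ℝ) × Oct × Oct => p.1.1 • p.2.1 + p.1.2 • p.2.2 := by
      fun_prop
    exact MDifferentiableAt.comp (g := fun p : (ℝ × ℝ) × Oct × Oct =>
      p.1.1 • p.2.1 + p.1.2 • p.2.2) (r, σ) (hF _).mdifferentiableAt h3
  have hl := hasDerivAt_chartLine hd (a, ξ)
  have h0 : HasDerivAt (fun t => e 0 (chartLine (𝓡 2) σ ξ t)) (differential (e 0) σ ξ) 0 :=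
    hasDerivAt_chartLine (he 0) ξ
  have h1 : HasDerivAt (fun t => e 1 (chartLine (𝓡 2) σ ξ t)) (differential (e 1) σ ξ) 0 :=
    hasDerivAt_chartLine (he 1) ξ
  have hlin : ∀ b c : ℝ, HasDerivAt (fun t : ℝ => b + t * c) c 0 := fun b c => by
    simpa using ((hasDerivAt_id (0 : ℝ)).mul_const c).const_add b
  have h2 := ((hlin r.1 a.1).smul h0).add ((hlin r.2 a.2).smul h1)
  have he : (fun t => RuledCone.param e (chartLine (𝓘(ℝ, ℝ × ℝ).prod (𝓡 2)) (r, σ) (a, ξ) t)) =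
      fun t : ℝ => (r.1 + t * a.1) • e 0 (chartLine (𝓡 2) σ ξ t) +
        (r.2 + t * a.2) • e 1 (chartLine (𝓡 2) σ ξ t) := by
    funext t
    have hline : chartLine (𝓘(ℝ, ℝ × ℝ).prod (𝓡 2)) (r, σ) (a, ξ) t =
        (r + t • a, chartLine (𝓡 2) σ ξ t) := rfl
    rw [hline]
    rfl
  rw [he] at hl
  have := hl.unique h2
  rw [chartLine_zero] at this
  refine this.trans ?_
  simp only [zero_mul, add_zero]
  abel

/-! ### Frames and the Cayley condition -/

theorem IsOrientedBasis.span_eq {P : Submodule ℝ Oct} {o : Orientation ℝ P (Fin 2)}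
    {e : Fin 2 → Oct} (h : IsOrientedBasis P o e) : Submodule.span ℝ {e 0, e 1} = P := by
  obtain ⟨b, -, hb⟩ := h
  apply le_antisymm
  · rw [Submodule.span_le]
    rintro v (rfl | rfl)
    · rw [← hb 0]; exact (b 0).2
    · rw [← hb 1]; exact (b 1).2
  · intro v hv
    have hs := congrArg Subtype.val (b.sum_repr ⟨v, hv⟩)
    rw [Fin.sum_univ_two] at hs
    refine Submodule.mem_span_pair.mpr ⟨b.repr ⟨v, hv⟩ 0, b.repr ⟨v, hv⟩ 1, ?_⟩
    rw [← hb 0, ← hb 1]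
    exact hs

namespace RuledCone

variable {C : RuledCone S}

theorem gauss_gauss_apply {σ : S} {v : Oct} (hv : v ∈ C.plane σ) :
    C.gauss σ (C.gauss σ v) = -v := by
  rw [← C.range_gauss σ] at hv
  obtain ⟨w, rfl⟩ := hv
  exact apply_apply_apply (C.gauss_mem σ) w

theorem gauss_apply_mem (σ : S) (v : Oct) : C.gauss σ v ∈ C.plane σ := by
  rw [← C.range_gauss σ]; exact ⟨v, rfl⟩

/-- The forms `ψ` on the cone in terms of the differential of its associated map. -/
theorem psi_dparam {U : Set S} {e : Fin 2 → S → Oct} (hU : IsOpen U)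
    (he : ∀ i, ContMDiffOn (𝓡 2) 𝓘(ℝ, Oct) ∞ (e i) U)
    (hb : ∀ σ ∈ U, IsOrientedBasis (C.plane σ) (C.orientation σ) fun i => e i σ)
    {σ : S} (hσ : σ ∈ U) {x y : Oct} (h : IsPair x y) (hxy : C.gauss σ = wedge x y) :
    ∃ t : ℝ, t ≠ 0 ∧ ∀ (r : ℝ × ℝ) (ξ η : EuclideanSpace ℝ (Fin 2)) (m : Fin 7),
      psi m (e 0 σ) (e 1 σ) (dparam e (r, σ) ((0, 0), ξ)) (dparam e (r, σ) ((0, 0), η)) =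
        t * psi m x y (differential C.gauss σ ξ (C.gauss σ (r.1 • e 0 σ + r.2 • e 1 σ)))
          (differential C.gauss σ η (C.gauss σ (r.1 • e 0 σ + r.2 • e 1 σ))) := by
  have hspan : Submodule.span ℝ {e 0 σ, e 1 σ} = C.plane σ := (hb σ hσ).span_eq
  have hspan' : C.plane σ = Submodule.span ℝ {x, y} := by
    rw [← C.range_gauss, hxy, h.range_wedge, Matrix.range_cons, Matrix.range_cons,
      Matrix.range_empty, Set.union_empty, Set.singleton_union]
  have hmem : ∀ i, e i σ ∈ Submodule.span ℝ {x, y} := fun i => by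
    rw [← hspan', ← hspan]
    fin_cases i
    · exact Submodule.subset_span (Set.mem_insert _ _)
    · exact Submodule.subset_span (Set.mem_insert_of_mem _ rfl)
  obtain ⟨a, b, hab⟩ := Submodule.mem_span_pair.mp (hmem 0)
  obtain ⟨c, d, hcd⟩ := Submodule.mem_span_pair.mp (hmem 1)
  have ht : a * d - b * c ≠ 0 := fun h0 => by
    have hg := (C.gauss_eq_normalize (hb σ hσ)).2
    rw [← hab, ← hcd, wedge_linear_combination x y, h0, hxy] at hg
    refine h.ne_zero (hg.trans ?_)
    ext1 v; simp
  have hd : ∀ i, MDifferentiableAt (𝓡 2) 𝓘(ℝ, Oct) (e i) σ := fun i =>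
    ((he i).contMDiffAt (hU.mem_nhds hσ)).mdifferentiableAt (by simp)
  have hsec : ∀ i, ∀ᶠ τ in 𝓝 σ, C.gauss τ (C.gauss τ (e i τ)) = -e i τ := fun i =>
    Filter.eventually_of_mem (hU.mem_nhds hσ) fun τ hτ => gauss_gauss_apply (by
      rw [← (hb τ hτ).span_eq]
      fin_cases i
      · exact Submodule.subset_span (Set.mem_insert _ _)
      · exact Submodule.subset_span (Set.mem_insert_of_mem _ rfl))
  refine ⟨a * d - b * c, ht, fun r ξ η m => ?_⟩
  -- Modulo the ruling the derivative of s = r₁e₀ + r₂e₁ is -dγ(γ s). Ruling components drop out of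
  -- the quadruple product, the two signs cancel, and t is the determinant of the frame in the basis
  -- x, y.
  have hds : ∀ ξ, ∃ v ∈ Submodule.span ℝ {e 0 σ, e 1 σ}, dparam e (r, σ) ((0, 0), ξ) =
      (-1 : ℝ) • differential C.gauss σ ξ (C.gauss σ (r.1 • e 0 σ + r.2 • e 1 σ)) + v := fun ξ => by
    obtain ⟨a₀, h₀⟩ := differential_section C.isSmoothInto_gauss (hd 0) (hsec 0) ξ
    obtain ⟨a₁, h₁⟩ := differential_section C.isSmoothInto_gauss (hd 1) (hsec 1) ξ
    refine ⟨C.gauss σ (r.1 • a₀ + r.2 • a₁), hspan ▸ gauss_apply_mem σ _, ?_⟩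
    rw [dparam_apply hd, h₀, h₁]
    simp only [map_add, map_smul]
    module
  obtain ⟨v, hv, hv'⟩ := hds ξ
  obtain ⟨w, hw, hw'⟩ := hds η
  rw [hv', hw', psi, cross4_add_span hv hw, cross4_smul_right, cross4_swap_right, cross4_smul_right,
    cross4_swap_right, ← hab, ← hcd, cross4_linear_combination, psi]
  simp [real_inner_smul_right]

theorem IsCayley.psi_eq_zero (hC : C.IsCayley) {σ : S} {x y : Oct} (h : IsPair x y)
    (hxy : C.gauss σ = wedge x y) (ξ η : EuclideanSpace ℝ (Fin 2)) (z : Oct) (m : Fin 7) :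
    psi m x y (differential C.gauss σ ξ (C.gauss σ z)) (differential C.gauss σ η (C.gauss σ z)) =
      0 := by
  obtain ⟨U, e, hU, hσ, he, hb⟩ := C.exists_frame σ
  obtain ⟨t, ht, hpsi⟩ := psi_dparam hU he hb hσ h hxy
  have hspan : Submodule.span ℝ {e 0 σ, e 1 σ} = C.plane σ := (hb σ hσ).span_eq
  -- The point γ(-γ z) of the ruling is mapped by γ to γ z, because γ³ = -γ; so the parametrization
  -- at this point gives the statement for z.
  have hz : C.gauss σ (-C.gauss σ z) ∈ Submodule.span ℝ {e 0 σ, e 1 σ} :=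
    hspan ▸ gauss_apply_mem σ _
  obtain ⟨a, b, hab⟩ := Submodule.mem_span_pair.mp hz
  have h1 := hpsi (a, b) ξ η m
  have hd : ∀ i, MDifferentiableAt (𝓡 2) 𝓘(ℝ, Oct) (e i) σ := fun i =>
    ((he i).contMDiffAt (hU.mem_nhds hσ)).mdifferentiableAt (by simp)
  have e0 : dparam e ((a, b), σ) ((1, 0), (0 : EuclideanSpace ℝ (Fin 2))) = e 0 σ := by
    rw [dparam_apply hd, differential_zero, differential_zero]; simp
  have e1 : dparam e ((a, b), σ) ((0, 1), (0 : EuclideanSpace ℝ (Fin 2))) = e 1 σ := by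
    rw [dparam_apply hd, differential_zero, differential_zero]; simp
  have h2 := hC U e hU he hb (a, b) σ hσ ((1, 0), (0 : EuclideanSpace ℝ (Fin 2)))
    ((0, 1), (0 : EuclideanSpace ℝ (Fin 2))) ((0, 0), ξ) ((0, 0), η) m
  rw [e0, e1, h1, hab, map_neg, map_neg, apply_apply_apply (C.gauss_mem σ), neg_neg] at h2
  exact (mul_eq_zero.mp h2).resolve_left ht

theorem isCayley_of_psi_eq_zero (hpsi : ∀ σ, ∃ x y, IsPair x y ∧ C.gauss σ = wedge x y ∧
    ∀ (ξ η : EuclideanSpace ℝ (Fin 2)) (z : Oct) (m : Fin 7),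
      psi m x y (differential C.gauss σ ξ (C.gauss σ z)) (differential C.gauss σ η (C.gauss σ z)) =
        0) : C.IsCayley := by
  intro U e hU he hb r σ hσ X Y Z W m
  obtain ⟨x, y, h, hxy, h0⟩ := hpsi σ
  obtain ⟨t, -, ht⟩ := psi_dparam hU he hb hσ h hxy
  have hd : ∀ i, MDifferentiableAt (𝓡 2) 𝓘(ℝ, Oct) (e i) σ := fun i =>
    ((he i).contMDiffAt (hU.mem_nhds hσ)).mdifferentiableAt (by simp)
  let L : (ℝ × ℝ) × EuclideanSpace ℝ (Fin 2) →ₗ[ℝ] Oct :=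
    { toFun := fun v => dparam e (r, σ) v
      map_add' := fun v w => (dparam e (r, σ)).map_add v w
      map_smul' := fun c v => (dparam e (r, σ)).map_smul c v }
  let f : ((ℝ × ℝ) × EuclideanSpace ℝ (Fin 2)) [⋀^Fin 4]→ₗ[ℝ] ℝ :=
    (((innerSL ℝ (ε m.castSucc)) : Oct →ₗ[ℝ] ℝ).compAlternatingMap cross4Alt).compLinearMap L
  have hf : ∀ v, f v = psi m (L (v 0)) (L (v 1)) (L (v 2)) (L (v 3)) := fun v =>
    congrArg (fun c => ⟪ε m.castSucc, c⟫_ℝ) (cross4Alt_apply fun i => L (v i))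
  -- A four-form on a four-dimensional space vanishes once it vanishes on one basis. Two basis
  -- vectors follow the ruling and two follow the surface, as in `psi_dparam`.
  let B := ((Module.Basis.finTwoProd ℝ).prod
    (EuclideanSpace.basisFun (Fin 2) ℝ).toBasis).reindex (finSumFinEquiv (m := 2) (n := 2))
  have hB : f B = 0 := by
    have b0 : L (B 0) = e 0 σ := by
      have : B 0 = ((1, 0), 0) := by
        rw [Module.Basis.reindex_apply,
          show (finSumFinEquiv (m := 2) (n := 2)).symm 0 = Sum.inl 0 from rfl]
        simp
      rw [this]
      refine (dparam_apply hd r _ _).trans ?_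
      rw [differential_zero, differential_zero]; simp
    have b1 : L (B 1) = e 1 σ := by
      have : B 1 = ((0, 1), 0) := by
        rw [Module.Basis.reindex_apply,
          show (finSumFinEquiv (m := 2) (n := 2)).symm 1 = Sum.inl 1 from rfl]
        simp
      rw [this]
      refine (dparam_apply hd r _ _).trans ?_
      rw [differential_zero, differential_zero]; simp
    have b2 : ∃ ξ, B 2 = ((0, 0), ξ) := by
      rw [Module.Basis.reindex_apply,
        show (finSumFinEquiv (m := 2) (n := 2)).symm 2 = Sum.inr 0 from rfl]
      exact ⟨_, Prod.ext (by simp [Module.Basis.prod_apply, Prod.zero_eq_mk]) rfl⟩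
    have b3 : ∃ ξ, B 3 = ((0, 0), ξ) := by
      rw [Module.Basis.reindex_apply,
        show (finSumFinEquiv (m := 2) (n := 2)).symm 3 = Sum.inr 1 from rfl]
      exact ⟨_, Prod.ext (by simp [Module.Basis.prod_apply, Prod.zero_eq_mk]) rfl⟩
    obtain ⟨ξ, hξ⟩ := b2
    obtain ⟨η, hη⟩ := b3
    rw [hf, b0, b1, hξ, hη]
    exact (ht r ξ η m).trans (by rw [h0, mul_zero])
  have hf0 : f = 0 := (AlternatingMap.map_basis_eq_zero_iff B f).mp hB
  have h1 := hf ![X, Y, Z, W]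
  rw [hf0] at h1
  exact h1.symm

theorem isCayley_of_isPseudoholomorphic (himm : IsImmersed C.gauss)
    (hhol : IsPseudoholomorphic grass acs C.gauss) : C.IsCayley := by
  refine isCayley_of_psi_eq_zero fun σ => ?_
  obtain ⟨x, y, h, hxy⟩ := mem_grass.mp (C.gauss_mem σ)
  refine ⟨x, y, h, hxy, fun ξ η z m => ?_⟩
  obtain ⟨g, rfl, rfl⟩ := h.exists_spin7
  have hT : ∀ ξ, IsTangent _ (differential C.gauss σ ξ) :=
    fun ξ => isTangent_differential C.isSmoothInto_gauss σ ξ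
  rw [hxy] at hT ⊢
  have ho := fun ξ => (hT ξ).inner_apply_wedge h z
  refine (psi_eq_zero_iff g (ho ξ).1 (ho ξ).2 (ho η).1 (ho η).2).mpr ?_ m
  have hinj := himm σ
  set D : EuclideanSpace ℝ (Fin 2) →L[ℝ] Endo := differential C.gauss σ
  obtain ⟨ζ, hζ⟩ := hhol.2 σ hinj ξ
  rw [hxy] at hζ
  change EuclideanSpace ℝ (Fin 2) at ζ
  have hDξ : differential C.gauss σ ξ = D ξ := rfl
  have hDζ : D ζ = differential C.gauss σ ζ := rfl
  have hζ' : D ζ = acs (wedge (toEndo g (ε 0)) (toEndo g (ε 1))) (D ξ) :=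
    hDζ.trans (hζ.trans (congrArg _ hDξ))
  -- J has no real eigenvector, so ξ and the preimage ζ of J dγ(ξ) span the tangent plane. Then
  -- dγ(η) = (a + bJ)dγ(ξ), and the coordinate vectors are proportional by a + bi.
  have hξζ : ξ ≠ 0 → ∃ a b : ℝ, a • ξ + b • ζ = η := fun hξ => by
    have hli : LinearIndependent ℝ ![ξ, ζ] := by
      rw [LinearIndependent.pair_iff' hξ]
      intro a ha
      have h1 : acs (wedge (toEndo g (ε 0)) (toEndo g (ε 1))) (D ξ) = a • D ξ := by
        rw [← hζ', ← ha, map_smul]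
      have hDT : IsTangent (wedge (toEndo g (ε 0)) (toEndo g (ε 1))) (D ξ) := hT ξ
      have h2 := acs_acs (mem_grass.mpr ⟨_, _, h, rfl⟩) (hDT.mem_tangent h)
      rw [h1, map_smul, h1] at h2
      exact hξ (hinj ((eq_zero_of_smul_smul h2).trans (map_zero D).symm))
    have hsp := hli.span_eq_top_of_card_eq_finrank' (by simp)
    rw [Matrix.range_cons, Matrix.range_cons, Matrix.range_empty, Set.union_empty,
      Set.singleton_union] at hsp
    exact Submodule.mem_span_pair.mp (hsp ▸ Submodule.mem_top)
  change ∀ i j, coordAt g (D ξ _) i * coordAt g (D η _) j = coordAt g (D ξ _) j * coordAt g (D η _) i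
  rcases eq_or_ne ξ 0 with hξ | hξ
  · rw [hξ, map_zero, zero_apply, map_zero]
    simp
  · obtain ⟨a, b, rfl⟩ := hξζ hξ
    rw [map_add, map_smul, map_smul, hζ', add_apply, smul_apply, smul_apply, acs_apply_wedge,
      map_add, map_smul, map_smul, coordAt_contract]
    intro i j
    simp only [Pi.add_apply, Pi.smul_apply, smul_eq_mul, Complex.real_smul]
    ring

end RuledCone

end Surface

/-! ### The four-plane spanned by a plane and a complex line -/

/-- The orthogonal projection to the sum of the plane `q` and of the complex line of `n`. -/
noncomputable def lineProj (q : Endo) (n : Oct) : Endo :=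
  (⟪n, n⟫_ℝ)⁻¹ • (InnerProductSpace.rankOne ℝ n n +
    InnerProductSpace.rankOne ℝ (contract q n) (contract q n)) - q * q

theorem lineProj_apply (q : Endo) (n v : Oct) : lineProj q n v =
    (⟪n, n⟫_ℝ)⁻¹ • (⟪n, v⟫_ℝ • n + ⟪contract q n, v⟫_ℝ • contract q n) - q (q v) := by
  simp only [lineProj, sub_apply, smul_apply, add_apply, InnerProductSpace.rankOne_apply,
    endo_mul_apply]

section LineProj

variable {x y n : Oct} (h : IsPair x y) (hx : ⟪x, n⟫_ℝ = 0) (hy : ⟪y, n⟫_ℝ = 0) (hn : n ≠ 0)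

include h in
theorem IsPair.lineProj_apply (v : Oct) : lineProj (wedge x y) n v =
    (⟪n, n⟫_ℝ)⁻¹ • (⟪n, v⟫_ℝ • n + ⟪contract (wedge x y) n, v⟫_ℝ • contract (wedge x y) n) +
      ⟪x, v⟫_ℝ • x + ⟪y, v⟫_ℝ • y := by
  rw [CayleyCone.lineProj_apply, wedge_apply x y v, map_sub, map_smul, map_smul, h.wedge_fst,
    h.wedge_snd]
  module

include h in
theorem inner_lineProj_left (v w : Oct) :
    ⟪lineProj (wedge x y) n v, w⟫_ℝ = ⟪v, lineProj (wedge x y) n w⟫_ℝ := by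
  rw [h.lineProj_apply, h.lineProj_apply]
  simp only [inner_add_left, inner_add_right, real_inner_smul_left, real_inner_smul_right,
    real_inner_comm v]
  ring

include h hx hy hn

theorem lineProj_normal : lineProj (wedge x y) n n = n ∧
    lineProj (wedge x y) n (contract (wedge x y) n) = contract (wedge x y) n := by
  have hn' := (inner_self_pos hn).ne'
  have h1 := inner_contract_self x y n
  have h1' := (real_inner_comm _ _).trans h1
  have h2 := inner_contract_contract (v := n) h hx hy
  have h3 := inner_contract_eq_zero x y n
  rw [h.lineProj_apply, h.lineProj_apply, hx, hy, h3.1, h3.2, h2, h1, h1']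
  simp only [zero_smul, add_zero, zero_add, smul_smul, inv_mul_cancel₀ hn', one_smul, and_self]

omit hn in
theorem lineProj_wedge (z : Oct) : lineProj (wedge x y) n (wedge x y z) = wedge x y z := by
  have h0 : ∀ m, ⟪x, m⟫_ℝ = 0 → ⟪y, m⟫_ℝ = 0 → ⟪m, wedge x y z⟫_ℝ = 0 := fun m h1 h2 => by
    rw [real_inner_comm, inner_wedge_swap, wedge_apply_of_orthogonal h1 h2, inner_zero_right,
      neg_zero]
  have h3 := inner_contract_eq_zero x y n
  rw [CayleyCone.lineProj_apply, h0 n hx hy, h0 _ h3.1 h3.2,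
    apply_apply_apply (mem_grass.mpr ⟨x, y, h, rfl⟩)]
  simp

theorem lineProj_lineProj (v : Oct) :
    lineProj (wedge x y) n (lineProj (wedge x y) n v) = lineProj (wedge x y) n v := by
  obtain ⟨h1, h2⟩ := lineProj_normal h hx hy hn
  conv_lhs => rw [CayleyCone.lineProj_apply _ n v]
  rw [map_sub, map_smul, map_add, map_smul, map_smul, h1, h2, lineProj_wedge h hx hy,
    ← CayleyCone.lineProj_apply]

omit hn in
-- The four-plane and its complement are invariant under I.
theorem lineProj_contract (v : Oct) : lineProj (wedge x y) n (contract (wedge x y) v) =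
    contract (wedge x y) (lineProj (wedge x y) n v) := by
  have h1 : ∀ u, ⟪u, contract (wedge x y) v⟫_ℝ = -⟪contract (wedge x y) u, v⟫_ℝ := fun u => by
    rw [inner_contract_wedge_swap, neg_neg]
  rw [h.lineProj_apply, h.lineProj_apply, h1, h1, h1, h1, contract_fst, contract_snd,
    contract_contract h hx hy]
  simp only [map_add, map_smul, contract_fst, contract_snd, contract_contract h hx hy,
    inner_neg_left, inner_zero_left]
  module

theorem finrank_range_lineProj :
    Module.finrank ℝ (LinearMap.range (lineProj (wedge x y) n : Oct →ₗ[ℝ] Oct)) = 4 := by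
  obtain ⟨h1, h2⟩ := lineProj_normal h hx hy hn
  have hc := inner_contract_eq_zero x y n
  have hnc := inner_contract_self x y n
  have hcc := inner_contract_contract (v := n) h hx hy
  set m := contract (wedge x y) n with hm
  have hm0 : m ≠ 0 := fun h0 => by
    rw [h0, inner_zero_left] at hcc
    exact (inner_self_pos hn).ne hcc
  have hx0 : x ≠ 0 := fun h0 => by have := h.xx; rw [h0, inner_zero_left] at this; norm_num at this
  have hy0 : y ≠ 0 := fun h0 => by have := h.yy; rw [h0, inner_zero_left] at this; norm_num at this
  have hli : LinearIndependent ℝ ![x, y, n, m] := by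
    refine linearIndependent_of_ne_zero_of_inner_eq_zero (𝕜 := ℝ) ?_ ?_
    · intro i
      fin_cases i
      exacts [hx0, hy0, hn, hm0]
    · intro i j hij
      fin_cases i <;> fin_cases j <;> first | exact absurd rfl hij | skip
      exacts [h.xy, hx, hc.1, h.yx, hy, hc.2, (real_inner_comm _ _).trans hx,
        (real_inner_comm _ _).trans hy, hnc, (real_inner_comm _ _).trans hc.1,
        (real_inner_comm _ _).trans hc.2, (real_inner_comm _ _).trans hnc]
  have hr : LinearMap.range (lineProj (wedge x y) n : Oct →ₗ[ℝ] Oct) =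
      Submodule.span ℝ (Set.range ![x, y, n, m]) := by
    have hsub : ∀ i, ![x, y, n, m] i ∈ Submodule.span ℝ (Set.range ![x, y, n, m]) := fun i =>
      Submodule.subset_span ⟨i, rfl⟩
    apply le_antisymm
    · rintro _ ⟨v, rfl⟩
      rw [ContinuousLinearMap.coe_coe, h.lineProj_apply]
      exact Submodule.add_mem _ (Submodule.add_mem _ (Submodule.smul_mem _ _ (Submodule.add_mem _
        (Submodule.smul_mem _ _ (hsub 2)) (Submodule.smul_mem _ _ (hsub 3))))
        (Submodule.smul_mem _ _ (hsub 0))) (Submodule.smul_mem _ _ (hsub 1))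
    · rw [Submodule.span_le]
      rintro _ ⟨i, rfl⟩
      have hq := lineProj_wedge h hx hy
      fin_cases i
      · refine ⟨x, ?_⟩
        have := hq (-y)
        rwa [map_neg, h.wedge_snd, neg_neg] at this
      · refine ⟨y, ?_⟩
        have := hq x
        rwa [h.wedge_fst] at this
      · exact ⟨n, h1⟩
      · exact ⟨m, h2⟩
  rw [hr, finrank_span_eq_card hli, Fintype.card_fin]

/-- The four-plane is closed under the triple cross product. -/
theorem cross3_contract : ∃ a b : ℝ, cross3 (contract (wedge x y) n) y n = a • x ∧
    cross3 x (contract (wedge x y) n) n = b • y := by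
  obtain ⟨d, hdd, hd⟩ := exists_unit_orthogonal (by norm_num)
    ![x, y, unitVec n, cross3 x y (unitVec n)]
  have hf : IsSpinFrame x y (unitVec n) d := by
    refine ⟨h.xx, h.yy, inner_unitVec hn, hdd, h.xy, ?_,
      (real_inner_comm _ _).trans (hd 0), ?_, (real_inner_comm _ _).trans (hd 1),
      (real_inner_comm _ _).trans (hd 2), (real_inner_comm _ _).trans (hd 3)⟩
    · rw [unitVec, real_inner_smul_right, hx, mul_zero]
    · rw [unitVec, real_inner_smul_right, hy, mul_zero]
  obtain ⟨g, hg0, hg1, hg2, -⟩ := isSpinFrame_ε.exists_map hf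
  obtain ⟨t, ht⟩ : ∃ t : ℝ, n = t • toEndo g (ε 2) := by
    refine ⟨Real.sqrt ⟪n, n⟫_ℝ, ?_⟩
    rw [hg2, unitVec, smul_smul, mul_inv_cancel₀ (Real.sqrt_pos.mpr (inner_self_pos hn)).ne',
      one_smul]
  -- In a frame adapted to the plane and n, the four-plane is spanned by the images of ε 0, ε 1, ε
  -- 2, ε 3, and the claims are products of basis vectors.
  have hm : contract (wedge x y) n = t • toEndo g (ε 3) := by
    rw [contract_wedge, ht, ← cross3L_apply, map_smul, cross3L_apply, ← hg0, ← hg1, cross3_toEndo,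
      cross3_ε₀₁₂, map_neg, smul_neg, neg_neg]
  have e1 : cross3 (ε 3) (ε 1) (ε 2) = ε 0 := by
    refine oct_ext ?_ ?_ ?_ ?_ ?_ ?_ ?_ ?_ <;> simp [cross3_coords, octMul_coords, octConj_coords]
    norm_num
  have e2 : cross3 (ε 0) (ε 3) (ε 2) = ε 1 := by
    refine oct_ext ?_ ?_ ?_ ?_ ?_ ?_ ?_ ?_ <;> simp [cross3_coords, octMul_coords, octConj_coords]
    norm_num
  refine ⟨t * t, t * t, ?_, ?_⟩
  · rw [hm]
    conv_lhs => rw [ht]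
    simp only [← cross3L_apply, map_smul, LinearMap.smul_apply]
    rw [cross3L_apply, ← hg1, cross3_toEndo, e1, hg0]
    module
  · rw [hm]
    conv_lhs => rw [ht]
    simp only [← cross3L_apply, map_smul, LinearMap.smul_apply]
    rw [cross3L_apply, ← hg0, cross3_toEndo, e2, hg1]
    module

end LineProj

section Pencil

variable {g : Spin7} {B : Endo} {n : Oct}

local notation "X" => toEndo g (ε 0)
local notation "Y" => toEndo g (ε 1)
local notation "Q" => wedge (toEndo g (ε 0)) (toEndo g (ε 1))

/-- A tangent vector whose values on the plane lie in the complex line of `n`. -/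
theorem exists_of_coordAt_eq (hB : IsTangent Q B) (hx : ⟪X, n⟫_ℝ = 0) (hy : ⟪Y, n⟫_ℝ = 0) {z : Oct}
    {c : ℂ} (hc : coordAt g (B (Q z)) = c • coordAt g n) :
    B (Q z) = c.re • n + c.im • contract Q n := by
  have hp := isPair_ε.map g
  have h1 := hB.inner_apply_wedge hp z
  have h2 := inner_contract_eq_zero X Y n
  refine eq_of_coordAt_eq g h1.1 h1.2 ?_ ?_ ?_
  · rw [inner_add_right, real_inner_smul_right, real_inner_smul_right, hx, h2.1]; ring
  · rw [inner_add_right, real_inner_smul_right, real_inner_smul_right, hy, h2.2]; ring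
  · rw [hc, map_add, map_smul, map_smul, coordAt_contract]
    funext i
    simp only [Pi.add_apply, Pi.smul_apply, smul_eq_mul, Complex.real_smul]
    conv_lhs => rw [← Complex.re_add_im c]
    ring

/-- B sends the plane into the complex line of n, by hypothesis, and the complement into the plane;
both lie in the four-plane. -/
theorem lineProj_tangent (hB : IsTangent Q B) (hx : ⟪X, n⟫_ℝ = 0) (hy : ⟪Y, n⟫_ℝ = 0) (hn : n ≠ 0)
    (hc : ∀ z, ∃ c : ℂ, coordAt g (B (Q z)) = c • coordAt g n) (w : Oct) :
    lineProj Q n (B w) = B w := by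
  have hp := isPair_ε.map g
  obtain ⟨h1, h2⟩ := lineProj_normal hp hx hy hn
  have hq : Q ∈ grass := mem_grass.mpr ⟨_, _, hp, rfl⟩
  have hE : ∀ z, lineProj Q n (B (Q z)) = B (Q z) := fun z => by
    obtain ⟨c, hc⟩ := hc z
    rw [exists_of_coordAt_eq hB hx hy hc, map_add, map_smul, map_smul, h1, h2]
  have hN : lineProj Q n (B (w + Q (Q w))) = B (w + Q (Q w)) := by
    have e1 : ⟪X, w + Q (Q w)⟫_ℝ = 0 := by
      have := inner_add_apply_apply hq w (-Y)
      rwa [map_neg, hp.wedge_snd, neg_neg] at this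
    have e2 : ⟪Y, w + Q (Q w)⟫_ℝ = 0 := by
      have := inner_add_apply_apply hq w X
      rwa [hp.wedge_fst] at this
    rw [hB.apply_of_orthogonal e1 e2, map_neg, lineProj_wedge hp hx hy]
  have hw : w = (w + Q (Q w)) - Q (Q w) := by abel
  rw [hw, map_sub, map_sub, hE, hN]

/-- Here B = u ∧ Y + X ∧ v with u, v in the complex line of n. By `cross3_contract` the contraction
with n even falls into the plane. -/
theorem lineProj_contract_tangent (hB : IsTangent Q B) (hx : ⟪X, n⟫_ℝ = 0) (hy : ⟪Y, n⟫_ℝ = 0)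
    (hn : n ≠ 0) (hc : ∀ z, ∃ c : ℂ, coordAt g (B (Q z)) = c • coordAt g n) :
    lineProj Q n (contract B n) = contract B n := by
  have hp := isPair_ε.map g
  have hX : lineProj Q n X = X := by
    have := lineProj_wedge (n := n) hp hx hy (-Y)
    rwa [map_neg, hp.wedge_snd, neg_neg] at this
  have hY : lineProj Q n Y = Y := by
    have := lineProj_wedge (n := n) hp hx hy X
    rwa [hp.wedge_fst] at this
  obtain ⟨c₁, hc₁⟩ := hc Y
  obtain ⟨c₂, hc₂⟩ := hc X
  have e1 := exists_of_coordAt_eq hB hx hy hc₁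
  have e2 := exists_of_coordAt_eq hB hx hy hc₂
  rw [hp.wedge_snd] at e1
  rw [hp.wedge_fst] at e2
  obtain ⟨a, b, ha, hb⟩ := cross3_contract hp hx hy hn
  obtain ⟨u, v, h1, h2, h3, h4, hBuv⟩ := hp.exists_of_isTangent hB
  have hv : v = -(c₁.re • n + c₁.im • contract Q n) := by
    rw [← e1, map_neg, neg_neg, hBuv, hp.wedge_add_wedge_apply_fst h1 h3]
  have hu : u = -(c₂.re • n + c₂.im • contract Q n) := by
    rw [← e2, hBuv, hp.wedge_add_wedge_apply_snd h2 h4, neg_neg]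
  have hcu : cross3 u Y n = -(c₂.im * a) • X := by
    rw [hu]
    simp only [← cross3L_apply, map_add, map_smul, map_neg, LinearMap.add_apply,
      LinearMap.smul_apply, LinearMap.neg_apply]
    simp only [cross3L_apply, ha, cross3_self_outer]
    module
  have hcv : cross3 X v n = -(c₁.im * b) • Y := by
    rw [hv]
    simp only [← cross3L_apply, map_add, map_smul, map_neg, LinearMap.add_apply,
      LinearMap.smul_apply, LinearMap.neg_apply]
    simp only [cross3L_apply, hb, cross3_self_right]
    module
  have hcB : contract B n = (c₂.im * a) • X + (c₁.im * b) • Y := by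
    rw [hBuv, ← contractC_apply, map_add, contractC_apply, contractC_apply, add_apply,
      contract_wedge, contract_wedge, hcu, hcv]
    module
  rw [hcB, map_add, map_smul, map_smul, hX, hY]

/-- Two tangent vectors, the second of which is a complex multiple of the first on the plane. -/
theorem eq_add_acs_of_coordAt {B' : Endo} (hB : IsTangent Q B) (hB' : IsTangent Q B') {c : ℂ}
    (hc : ∀ z, coordAt g (B' (Q z)) = c • coordAt g (B (Q z))) :
    B' = c.re • B + c.im • acs Q B := by
  have hp := isPair_ε.map g
  have key : ∀ z, B' (Q z) = c.re • B (Q z) + c.im • contract Q (B (Q z)) := fun z =>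
    exists_of_coordAt_eq hB' (hB.inner_apply_wedge hp z).1 (hB.inner_apply_wedge hp z).2 (hc z)
  obtain ⟨u, v, h1, h2, h3, h4, rfl⟩ := hp.exists_of_isTangent hB
  obtain ⟨u', v', h1', h2', h3', h4', rfl⟩ := hp.exists_of_isTangent hB'
  have e1 := key (-Y)
  have e2 := key X
  rw [map_neg, hp.wedge_snd, neg_neg, hp.wedge_add_wedge_apply_fst h1 h3,
    hp.wedge_add_wedge_apply_fst h1' h3'] at e1
  rw [hp.wedge_fst, hp.wedge_add_wedge_apply_snd h2 h4, hp.wedge_add_wedge_apply_snd h2' h4',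
    map_neg] at e2
  have e2' : u' = c.re • u + c.im • contract Q u := by
    rw [← neg_neg u', e2]; module
  rw [acs_tangent, e1, e2']
  ext1 w
  simp only [add_apply, smul_apply, wedge_apply _ Y, wedge_apply X, inner_add_left,
    real_inner_smul_left]
  module

/-- The derivatives of the projection to the four-plane vanish on `n`. -/
theorem apply_eq_zero_of_pencil {B₁ B₂ A₁ A₂ : Endo} {z₀ : Oct} (hB₁ : IsTangent Q B₁)
    (hB₂ : IsTangent Q B₂) (hn : n = B₁ (Q z₀))
    (hc₁ : ∀ z, ∃ c : ℂ, coordAt g (B₁ (Q z)) = c • coordAt g n)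
    (hc₂ : ∀ z, ∃ c : ℂ, coordAt g (B₂ (Q z)) = c • coordAt g n)
    (hne : ¬ ∃ c : ℂ, ∀ z, coordAt g (B₂ (Q z)) = c • coordAt g (B₁ (Q z)))
    (hK₁ : A₁ (contract Q n) = contract Q (A₁ n)) (hK₂ : A₂ (contract Q n) = contract Q (A₂ n))
    (hA : ∀ w, A₁ (B₂ w) = A₂ (B₁ w)) : coordAt g (A₁ n) = 0 ∧ coordAt g (A₂ n) = 0 := by
  have hp := isPair_ε.map g
  have ho : ⟪X, n⟫_ℝ = 0 ∧ ⟪Y, n⟫_ℝ = 0 := by rw [hn]; exact hB₁.inner_apply_wedge hp z₀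
  have key : ∀ {A B : Endo} {z : Oct} {c : ℂ}, IsTangent Q B →
      A (contract Q n) = contract Q (A n) → coordAt g (B (Q z)) = c • coordAt g n →
      coordAt g (A (B (Q z))) = c • coordAt g (A n) := fun {A B z c} hB hK hc => by
    rw [exists_of_coordAt_eq hB ho.1 ho.2 hc, map_add, map_smul, map_smul, hK, map_add, map_smul,
      map_smul, coordAt_contract]
    funext i
    simp only [Pi.add_apply, Pi.smul_apply, smul_eq_mul, Complex.real_smul]
    conv_rhs => rw [← Complex.re_add_im c]
    ring
  choose c₁ hc₁ using hc₁
  choose c₂ hc₂ using hc₂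
  -- On the line of n both maps are complex linear modulo the plane, so A₁ B₂ = A₂ B₁ becomes a
  -- scalar relation.
  have hsym : ∀ z, c₂ z • coordAt g (A₁ n) = c₁ z • coordAt g (A₂ n) := fun z => by
    rw [← key hB₂ hK₁ (hc₂ z), ← key hB₁ hK₂ (hc₁ z), hA]
  have h0 : coordAt g (A₂ n) = c₂ z₀ • coordAt g (A₁ n) := by
    rw [← key hB₂ hK₁ (hc₂ z₀), hA, ← hn]
  -- At z₀ the first coefficient may be taken as 1, so A₂ n = c₂(z₀) A₁ n in coordinates. If A₁ n
  -- were nonzero there, c₂ = c₂(z₀) c₁ throughout, which would make B₂ proportional to B₁.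
  have h1 : coordAt g (A₁ n) = 0 := by
    by_contra hne0
    refine hne ⟨c₂ z₀, fun z => ?_⟩
    have h2 := hsym z
    rw [h0, smul_smul] at h2
    have h3 := smul_left_injective ℂ hne0 h2
    rw [hc₂ z, hc₁ z, h3, smul_smul, mul_comm]
  exact ⟨h1, by rw [h0, h1, smul_zero]⟩

end Pencil

/-! ### Pencils of real lines in a complex line -/

/-- The values on the plane of two tangent vectors span a single complex line, and the second
tangent vector is not a complex multiple of the first. -/
structure IsPencil (g : Spin7) (B₁ B₂ : Endo) (n : Oct) : Prop where
  tangent₁ : IsTangent (wedge (toEndo g (ε 0)) (toEndo g (ε 1))) B₁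
  tangent₂ : IsTangent (wedge (toEndo g (ε 0)) (toEndo g (ε 1))) B₂
  ne_zero : n ≠ 0
  inner₀ : ⟪toEndo g (ε 0), n⟫_ℝ = 0
  inner₁ : ⟪toEndo g (ε 1), n⟫_ℝ = 0
  line₁ : ∀ z, ∃ c : ℂ,
    coordAt g (B₁ (wedge (toEndo g (ε 0)) (toEndo g (ε 1)) z)) = c • coordAt g n
  line₂ : ∀ z, ∃ c : ℂ,
    coordAt g (B₂ (wedge (toEndo g (ε 0)) (toEndo g (ε 1)) z)) = c • coordAt g n
  ne_smul : ¬ ∃ c : ℂ, ∀ z, coordAt g (B₂ (wedge (toEndo g (ε 0)) (toEndo g (ε 1)) z)) =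
    c • coordAt g (B₁ (wedge (toEndo g (ε 0)) (toEndo g (ε 1)) z))

theorem isPencil_of_psi {g : Spin7} {B₁ B₂ : Endo} {z₀ : Oct}
    (h₁ : IsTangent (wedge (toEndo g (ε 0)) (toEndo g (ε 1))) B₁)
    (h₂ : IsTangent (wedge (toEndo g (ε 0)) (toEndo g (ε 1))) B₂)
    (hn : B₁ (wedge (toEndo g (ε 0)) (toEndo g (ε 1)) z₀) ≠ 0)
    (hpsi : ∀ z m, psi m (toEndo g (ε 0)) (toEndo g (ε 1))
      (B₁ (wedge (toEndo g (ε 0)) (toEndo g (ε 1)) z))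
      (B₂ (wedge (toEndo g (ε 0)) (toEndo g (ε 1)) z)) = 0)
    (hli : LinearIndependent ℝ
      ![acs (wedge (toEndo g (ε 0)) (toEndo g (ε 1))) B₁, B₁, B₂]) :
    IsPencil g B₁ B₂ (B₁ (wedge (toEndo g (ε 0)) (toEndo g (ε 1)) z₀)) := by
  have hp := isPair_ε.map g
  have hne : ¬ ∃ c : ℂ, ∀ z, coordAt g (B₂ (wedge (toEndo g (ε 0)) (toEndo g (ε 1)) z)) =
      c • coordAt g (B₁ (wedge (toEndo g (ε 0)) (toEndo g (ε 1)) z)) := by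
    rintro ⟨c, hc⟩
    -- Proportionality by c means B₂ = (Re c) B₁ + (Im c) J B₁, contradicting independence.
    have h := eq_add_acs_of_coordAt h₁ h₂ hc
    have h0 := Fintype.linearIndependent_iff.mp hli ![c.im, c.re, -1] (by
      simp only [Fin.sum_univ_three, Matrix.cons_val_zero, Matrix.cons_val_one, Matrix.cons_val]
      conv_lhs => rw [h]
      module) 2
    exact absurd (show (-1 : ℝ) = 0 from h0) (by norm_num)
  have h0 : coordAt g (B₁ (wedge (toEndo g (ε 0)) (toEndo g (ε 1)) z₀)) ≠ 0 := fun h0 => by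
    refine hn (eq_of_coordAt_eq g (h₁.inner_apply_wedge hp z₀).1 (h₁.inner_apply_wedge hp z₀).2
      (inner_zero_right _) (inner_zero_right _) ?_)
    rw [h0, map_zero]
  let b : Endo → Oct →ₗ[ℝ] Fin 3 → ℂ := fun B => coordAt g ∘ₗ (B : Oct →ₗ[ℝ] Oct) ∘ₗ
    (wedge (toEndo g (ε 0)) (toEndo g (ε 1)) : Oct →ₗ[ℝ] Oct)
  obtain ⟨l1, l2⟩ := exists_smul_of_pencil (b B₁) (b B₂) (s₀ := z₀) (fun z =>
    (psi_eq_zero_iff g (h₁.inner_apply_wedge hp z).1 (h₁.inner_apply_wedge hp z).2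
      (h₂.inner_apply_wedge hp z).1 (h₂.inner_apply_wedge hp z).2).mp (hpsi z)) h0 hne
  exact ⟨h₁, h₂, hn, (h₁.inner_apply_wedge hp z₀).1, (h₁.inner_apply_wedge hp z₀).2, l1, l2, hne⟩

/-- The hypotheses are those satisfied by the derivatives of the projection P to the four-plane.
Each A kills the plane and, by the pencil argument and symmetry, also n and I n; so A P = 0. -/
theorem IsPencil.eq_zero {g : Spin7} {B₁ B₂ A₁ A₂ : Endo} {n z₀ : Oct} (h : IsPencil g B₁ B₂ n)
    (hn : n = B₁ (wedge (toEndo g (ε 0)) (toEndo g (ε 1)) z₀))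
    (hq : ∀ A ∈ ({A₁, A₂} : Set Endo), ∀ w, A (wedge (toEndo g (ε 0)) (toEndo g (ε 1)) w) = 0)
    (hK : ∀ A ∈ ({A₁, A₂} : Set Endo), A (contract (wedge (toEndo g (ε 0)) (toEndo g (ε 1))) n) =
      contract (wedge (toEndo g (ε 0)) (toEndo g (ε 1))) (A n))
    (hs : ∀ A ∈ ({A₁, A₂} : Set Endo), ∀ v w, ⟪A v, w⟫_ℝ = ⟪v, A w⟫_ℝ)
    (hi : ∀ A ∈ ({A₁, A₂} : Set Endo), ∀ v,
      A (lineProj (wedge (toEndo g (ε 0)) (toEndo g (ε 1))) n v) +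
        lineProj (wedge (toEndo g (ε 0)) (toEndo g (ε 1))) n (A v) = A v)
    (hA : ∀ w, A₁ (B₂ w) = A₂ (B₁ w)) : A₁ = 0 ∧ A₂ = 0 := by
  have hp := isPair_ε.map g
  have m₁ : A₁ ∈ ({A₁, A₂} : Set Endo) := Set.mem_insert _ _
  have m₂ : A₂ ∈ ({A₁, A₂} : Set Endo) := Set.mem_insert_of_mem _ rfl
  obtain ⟨c1, c2⟩ := apply_eq_zero_of_pencil h.tangent₁ h.tangent₂ hn h.line₁ h.line₂ h.ne_smul
    (hK _ m₁) (hK _ m₂) hA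
  have key : ∀ A ∈ ({A₁, A₂} : Set Endo), coordAt g (A n) = 0 → A = 0 := fun A hA c => by
    have hA0 : A n = 0 := by
      have ho : ∀ w, ⟪wedge (toEndo g (ε 0)) (toEndo g (ε 1)) w, A n⟫_ℝ = 0 := fun w => by
        rw [← hs A hA, hq A hA, inner_zero_left]
      refine eq_of_coordAt_eq g ?_ ?_ (inner_zero_right _) (inner_zero_right _)
        (c.trans (map_zero _).symm)
      · have := ho (-toEndo g (ε 1))
        rwa [map_neg, hp.wedge_snd, neg_neg] at this
      · have := ho (toEndo g (ε 0))
        rwa [hp.wedge_fst] at this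
    have hAP : ∀ v, A (lineProj (wedge (toEndo g (ε 0)) (toEndo g (ε 1))) n v) = 0 := fun v => by
      rw [lineProj_apply, map_sub, map_smul, map_add, map_smul, map_smul, hK A hA, hA0, hq A hA,
        map_zero, smul_zero, smul_zero, add_zero, smul_zero, sub_zero]
    ext1 v
    -- From A P + P A = A and A P = 0 follows A = P A, whose adjoint A P vanishes.
    refine ext_inner_right ℝ fun w => ?_
    have h1 := hi A hA v
    rw [hAP, zero_add] at h1
    rw [← h1, inner_lineProj_left hp, hs A hA, hAP, inner_zero_right, zero_apply, inner_zero_left]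
  exact ⟨key _ m₁ c1, key _ m₂ c2⟩

/-! ### Constancy of the four-plane along a smooth family -/

section Family

variable {E : Type*} [NormedAddCommGroup E] [NormedSpace ℝ E]

theorem contDiffOn_lineProj {q : E → Endo} {n : E → Oct} {N : Set E} (hq : ContDiffOn ℝ ∞ q N)
    (hn : ContDiffOn ℝ ∞ n N) (h0 : ∀ τ ∈ N, n τ ≠ 0) :
    ContDiffOn ℝ ∞ (fun τ => lineProj (q τ) (n τ)) N := by
  have hr : ∀ {a : E → Oct}, ContDiffOn ℝ ∞ a N →
      ContDiffOn ℝ ∞ (fun τ => InnerProductSpace.rankOne ℝ (a τ) (a τ)) N := fun {a} ha => by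
    have h1 : ContDiffOn ℝ ∞ (fun τ => innerSL ℝ (a τ)) N :=
      (innerSL ℝ).contDiff.comp_contDiffOn ha
    exact h1.smulRight ha
  have hc : ContDiffOn ℝ ∞ (fun τ => contract (q τ) (n τ)) N := by
    have h1 : ContDiffOn ℝ ∞ (fun τ => contractC (q τ)) N :=
      (contDiff_clm contractC).comp_contDiffOn hq
    exact h1.clm_apply hn
  exact (((hn.inner ℝ hn).inv fun τ hτ => (inner_self_pos (h0 τ hτ)).ne').smul
    ((hr hn).add (hr hc))).sub (hq.clm_comp hq)

theorem tendsto_line (τ η : E) : Filter.Tendsto (fun t : ℝ => τ + t • η) (𝓝 0) (𝓝 τ) := by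
  have h : ContinuousAt (fun t : ℝ => τ + t • η) 0 := by fun_prop
  simpa [ContinuousAt] using h

theorem hasDerivAt_line {F : Type*} [NormedAddCommGroup F] [NormedSpace ℝ F] {f : E → F} {τ : E}
    (hf : DifferentiableAt ℝ f τ) (η : E) :
    HasDerivAt (fun t : ℝ => f (τ + t • η)) (fderiv ℝ f τ η) 0 :=
  hf.hasFDerivAt.hasLineDerivAt η

theorem hasDerivAt_apply {F G : Type*} [NormedAddCommGroup F] [NormedSpace ℝ F]
    [NormedAddCommGroup G] [NormedSpace ℝ G] {f : ℝ → F →L[ℝ] G} {f' : F →L[ℝ] G} {t : ℝ}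
    (hf : HasDerivAt f f' t) (w : F) : HasDerivAt (fun t => f t w) (f' w) t :=
  (ContinuousLinearMap.apply ℝ G w).hasFDerivAt.comp_hasDerivAt t hf

set_option maxHeartbeats 1000000 in
/-- The four-plane of a pencil of tangent vectors is constant. -/
theorem fderiv_lineProj_eq_zero {Γ : E → Endo} {n : E → Oct} {N : Set E} (hN : IsOpen N)
    (hΓ : ContDiffOn ℝ ∞ Γ N) {e₁ e₂ : E} {z₀ : Oct}
    (hn : ∀ τ, n τ = fderiv ℝ Γ τ e₁ (Γ τ z₀))
    (hg : ∀ τ ∈ N, ∃ g : Spin7, Γ τ = wedge (toEndo g (ε 0)) (toEndo g (ε 1)) ∧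
      IsPencil g (fderiv ℝ Γ τ e₁) (fderiv ℝ Γ τ e₂) (n τ))
    {τ : E} (hτ : τ ∈ N) : fderiv ℝ (fun τ => lineProj (Γ τ) (n τ)) τ e₁ = 0 ∧
      fderiv ℝ (fun τ => lineProj (Γ τ) (n τ)) τ e₂ = 0 := by
  have hdΓ : ContDiffOn ℝ ∞ (fderiv ℝ Γ) N := hΓ.fderiv_of_isOpen hN (by simp)
  have hnN : ContDiffOn ℝ ∞ n N := by
    have hn' : n = fun τ => fderiv ℝ Γ τ e₁ (Γ τ z₀) := funext hn
    rw [hn']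
    exact (hdΓ.clm_apply contDiffOn_const).clm_apply (hΓ.clm_apply contDiffOn_const)
  have hP : ContDiffOn ℝ ∞ (fun τ => lineProj (Γ τ) (n τ)) N :=
    contDiffOn_lineProj hΓ hnN fun τ hτ => (hg τ hτ).choose_spec.2.ne_zero
  have hdiff : ∀ {F : Type _} [NormedAddCommGroup F] [NormedSpace ℝ F] {f : E → F},
      ContDiffOn ℝ ∞ f N → DifferentiableAt ℝ f τ := fun hf =>
    (hf.contDiffAt (hN.mem_nhds hτ)).differentiableAt (by simp)
  have hev : ∀ η, ∀ᶠ t : ℝ in 𝓝 0, τ + t • η ∈ N := fun η =>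
    (tendsto_line τ η).eventually (hN.mem_nhds hτ)
  set P : E → Endo := fun τ => lineProj (Γ τ) (n τ) with hPdef
  obtain ⟨g, hgτ, hpen⟩ := hg τ hτ
  have hp := isPair_ε.map g
  have t0 : ∀ η : E, τ + (0 : ℝ) • η = τ := fun η => by rw [zero_smul, add_zero]
  have dP : ∀ η, HasDerivAt (fun t : ℝ => P (τ + t • η)) (fderiv ℝ P τ η) 0 :=
    hasDerivAt_line (hdiff hP)
  have dΓ : ∀ η, HasDerivAt (fun t : ℝ => Γ (τ + t • η)) (fderiv ℝ Γ τ η) 0 :=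
    hasDerivAt_line (hdiff hΓ)
  have dB : ∀ ξ η, HasDerivAt (fun t : ℝ => fderiv ℝ Γ (τ + t • η) ξ)
      (fderiv ℝ (fderiv ℝ Γ) τ η ξ) 0 := fun ξ η =>
    hasDerivAt_apply (hasDerivAt_line ((hdΓ.contDiffAt (hN.mem_nhds hτ)).differentiableAt
      (by simp)) η) ξ
  have hsymm : fderiv ℝ (fderiv ℝ Γ) τ e₁ e₂ = fderiv ℝ (fderiv ℝ Γ) τ e₂ e₁ :=
    (hΓ.contDiffAt (hN.mem_nhds hτ)).isSymmSndFDerivAt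
      (by simp; exact WithTop.coe_le_coe.mpr le_top) e₁ e₂
  have hPτ : P τ = lineProj (wedge (toEndo g (ε 0)) (toEndo g (ε 1))) (n τ) := by rw [← hgτ]
  have hPB : ∀ ξ ∈ ({e₁, e₂} : Set E), ∀ σ ∈ N, ∀ w, P σ (fderiv ℝ Γ σ ξ w) = fderiv ℝ Γ σ ξ w := by
    intro ξ hξ σ hσ w
    obtain ⟨k, hk, hkp⟩ := hg σ hσ
    simp only [hPdef]
    rw [hk]
    rcases hξ with rfl | rfl
    · exact lineProj_tangent hkp.tangent₁ hkp.inner₀ hkp.inner₁ hkp.ne_zero hkp.line₁ w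
    · exact lineProj_tangent hkp.tangent₂ hkp.inner₀ hkp.inner₁ hkp.ne_zero hkp.line₂ w
  -- The product rule for P ∂Γ = ∂Γ, which says that the first derivatives of Γ take values in the
  -- four-plane.
  have hAB : ∀ ξ ∈ ({e₁, e₂} : Set E), ∀ η w, fderiv ℝ P τ η (fderiv ℝ Γ τ ξ w) +
      P τ (fderiv ℝ (fderiv ℝ Γ) τ η ξ w) = fderiv ℝ (fderiv ℝ Γ) τ η ξ w := by
    intro ξ hξ η w
    have h1 := (dP η).clm_apply (hasDerivAt_apply (dB ξ η) w)
    have h2 := h1.unique ((hasDerivAt_apply (dB ξ η) w).congr_of_eventuallyEq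
      ((hev η).mono fun t ht => hPB ξ hξ _ ht w))
    rwa [t0] at h2
  have m₁ : e₁ ∈ ({e₁, e₂} : Set E) := Set.mem_insert _ _
  have m₂ : e₂ ∈ ({e₁, e₂} : Set E) := Set.mem_insert_of_mem _ rfl
  have hmem : ∀ A ∈ ({fderiv ℝ P τ e₁, fderiv ℝ P τ e₂} : Set Endo), ∃ ξ ∈ ({e₁, e₂} : Set E),
      fderiv ℝ P τ ξ = A := by
    rintro A (rfl | rfl)
    exacts [⟨e₁, m₁, rfl⟩, ⟨e₂, m₂, rfl⟩]
  refine hpen.eq_zero (z₀ := z₀) (by rw [← hgτ]; exact hn τ) ?_ ?_ ?_ ?_ ?_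
  -- From P Γ = Γ: the derivative is A Γ + P ∂Γ = ∂Γ, and P ∂Γ = ∂Γ leaves A Γ = 0.
  · rintro A hA w
    obtain ⟨ξ, hξ, rfl⟩ := hmem A hA
    have h1 := (dP ξ).clm_apply (hasDerivAt_apply (dΓ ξ) w)
    have h2 := h1.unique ((hasDerivAt_apply (dΓ ξ) w).congr_of_eventuallyEq
      ((hev ξ).mono fun t ht => by
        obtain ⟨k, hk, hkp⟩ := hg _ ht
        simp only [hPdef]
        rw [hk]
        exact lineProj_wedge (isPair_ε.map k) hkp.inner₀ hkp.inner₁ w))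
    rw [t0, hPB ξ hξ τ hτ w, add_eq_right, hgτ] at h2
    exact h2
  · rintro A hA
    obtain ⟨ξ, hξ, rfl⟩ := hmem A hA
    have dK : HasDerivAt (fun t : ℝ => contract (Γ (τ + t • ξ))) (contract (fderiv ℝ Γ τ ξ)) 0 :=
      hasDerivAt_clm_comp contractC (dΓ ξ)
    have h1 := (dP ξ).clm_apply (hasDerivAt_apply dK (n τ))
    have h2 := h1.unique ((dK.clm_apply (hasDerivAt_apply (dP ξ) (n τ))).congr_of_eventuallyEq
      ((hev ξ).mono fun t ht => by
        obtain ⟨k, hk, hkp⟩ := hg _ ht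
        simp only [hPdef]
        rw [hk]
        exact lineProj_contract (isPair_ε.map k) hkp.inner₀ hkp.inner₁ (n τ)))
    -- In the differentiated relation P K = K P, where K = `contract Γ`, the terms with ∂K cancel at
    -- n because P fixes both n and (∂K)n.
    have h3 : P τ (contract (fderiv ℝ Γ τ ξ) (n τ)) = contract (fderiv ℝ Γ τ ξ) (n τ) := by
      rw [hPτ]
      rcases hξ with rfl | rfl
      · exact lineProj_contract_tangent hpen.tangent₁ hpen.inner₀ hpen.inner₁ hpen.ne_zero hpen.line₁
      · exact lineProj_contract_tangent hpen.tangent₂ hpen.inner₀ hpen.inner₁ hpen.ne_zero hpen.line₂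
    have h4 : P τ (n τ) = n τ := by
      rw [hPτ]
      exact (lineProj_normal hp hpen.inner₀ hpen.inner₁ hpen.ne_zero).1
    rw [t0, h3, h4, add_comm, add_right_inj, hgτ] at h2
    exact h2
  · rintro A hA v w
    obtain ⟨ξ, hξ, rfl⟩ := hmem A hA
    have h1 := (hasDerivAt_apply (dP ξ) v).inner ℝ (hasDerivAt_const (0 : ℝ) w)
    have h2 := h1.unique (((hasDerivAt_const (0 : ℝ) v).inner ℝ
      (hasDerivAt_apply (dP ξ) w)).congr_of_eventuallyEq ((hev ξ).mono fun t ht => by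
        obtain ⟨k, hk, hkp⟩ := hg _ ht
        simp only [hPdef]
        rw [hk]
        exact inner_lineProj_left (isPair_ε.map k) v w))
    simpa only [inner_zero_right, inner_zero_left, zero_add, add_zero] using h2
  · rintro A hA v
    obtain ⟨ξ, hξ, rfl⟩ := hmem A hA
    have h1 := (dP ξ).clm_apply (hasDerivAt_apply (dP ξ) v)
    have h2 := h1.unique ((hasDerivAt_apply (dP ξ) v).congr_of_eventuallyEq
      ((hev ξ).mono fun t ht => by
        obtain ⟨k, hk, hkp⟩ := hg _ ht
        simp only [hPdef]
        rw [hk]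
        exact lineProj_lineProj (isPair_ε.map k) hkp.inner₀ hkp.inner₁ hkp.ne_zero v))
    rw [t0, hPτ] at h2
    exact h2
  -- Two instances of `hAB` with the directions exchanged share their second derivative, so A₁ B₂ =
  -- A₂ B₁.
  · intro w
    have h1 := hAB e₂ m₂ e₁ w
    have h2 := hAB e₁ m₁ e₂ w
    rw [hsymm, ← h2] at h1
    rw [h2] at h1
    exact add_right_cancel (h1.trans h2.symm)

end Family

/-! ### Planarity of cones with a noncomplex tangent plane -/

theorem IsTangent.zero (q : Endo) : IsTangent q 0 :=
  ⟨fun v w => by simp, fun v => by simp⟩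

theorem isTangent_fderiv {E : Type*} [NormedAddCommGroup E] [NormedSpace ℝ E] {Γ : E → Endo}
    {T : Set E} (hT : IsOpen T) (hΓ : ContDiffOn ℝ ∞ Γ T) (hm : ∀ τ ∈ T, Γ τ ∈ grass) {τ : E}
    (hτ : τ ∈ T) (ξ : E) : IsTangent (Γ τ) (fderiv ℝ Γ τ ξ) := by
  have h := isTangent_of_hasDerivAt
    (hasDerivAt_line ((hΓ.contDiffAt (hT.mem_nhds hτ)).differentiableAt (by simp)) ξ)
    (((tendsto_line τ ξ).eventually (hT.mem_nhds hτ)).mono fun t ht => hm _ ht)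
  rwa [zero_smul, add_zero] at h

theorem contDiffOn_apply_fderiv {E V W : Type*} [NormedAddCommGroup E] [NormedSpace ℝ E]
    [NormedAddCommGroup V] [NormedSpace ℝ V] [NormedAddCommGroup W] [NormedSpace ℝ W]
    {J : V → V →L[ℝ] W} {f : E → V} {T : Set E} (hJ : ContDiff ℝ ∞ J) (hT : IsOpen T)
    (hf : ContDiffOn ℝ ∞ f T) (ξ : E) : ContDiffOn ℝ ∞ (fun τ => J (f τ) (fderiv ℝ f τ ξ)) T :=
  (hJ.comp_contDiffOn hf).clm_apply
    ((hf.fderiv_of_isOpen hT (by simp)).clm_apply contDiffOn_const)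

theorem continuousAt_vecCons {X V : Type*} [TopologicalSpace X] [TopologicalSpace V]
    {f₀ f₁ f₂ : X → V} {p : X} (h₀ : ContinuousAt f₀ p) (h₁ : ContinuousAt f₁ p)
    (h₂ : ContinuousAt f₂ p) : ContinuousAt (fun τ => ![f₀ τ, f₁ τ, f₂ τ]) p := by
  rw [continuousAt_pi]
  intro i
  fin_cases i
  exacts [h₀, h₁, h₂]

/-- A family of planes whose tangent plane is not complex lies in a fixed four-plane. -/
theorem exists_four_plane {Γ : EuclideanSpace ℝ (Fin 2) → Endo} {T : Set (EuclideanSpace ℝ (Fin 2))}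
    (hT : IsOpen T) (hΓ : ContDiffOn ℝ ∞ Γ T) (hm : ∀ τ ∈ T, Γ τ ∈ grass)
    (hpsi : ∀ τ ∈ T, ∀ x y, IsPair x y → Γ τ = wedge x y → ∀ ξ η z m,
      psi m x y (fderiv ℝ Γ τ ξ (Γ τ z)) (fderiv ℝ Γ τ η (Γ τ z)) = 0)
    {τ₀ : EuclideanSpace ℝ (Fin 2)} (h₀ : τ₀ ∈ T)
    (hli : LinearIndependent ℝ ![acs (Γ τ₀) (fderiv ℝ Γ τ₀ (EuclideanSpace.single 0 1)),
      fderiv ℝ Γ τ₀ (EuclideanSpace.single 0 1), fderiv ℝ Γ τ₀ (EuclideanSpace.single 1 1)]) :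
    ∃ W : Submodule ℝ Oct, Module.finrank ℝ W = 4 ∧ ∀ᶠ τ in 𝓝 τ₀, ∀ w, Γ τ w ∈ W := by
  set e₁ : EuclideanSpace ℝ (Fin 2) := EuclideanSpace.single 0 1
  set e₂ : EuclideanSpace ℝ (Fin 2) := EuclideanSpace.single 1 1
  have htan : ∀ τ ∈ T, ∀ ξ, IsTangent (Γ τ) (fderiv ℝ Γ τ ξ) := fun τ hτ ξ =>
    isTangent_fderiv hT hΓ hm hτ ξ
  -- The tangent vector in direction e₁ is nonzero by independence, and a tangent vector is
  -- determined by its values on the plane.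
  obtain ⟨z₀, hz₀⟩ : ∃ z₀, fderiv ℝ Γ τ₀ e₁ (Γ τ₀ z₀) ≠ 0 := by
    by_contra! hz
    obtain ⟨x, y, hxy, hq⟩ := mem_grass.mp (hm τ₀ h₀)
    have h1 := htan τ₀ h₀ e₁
    rw [hq] at h1 hz
    exact hli.ne_zero 1 (h1.eq_of_apply_wedge hxy (IsTangent.zero _) fun z =>
      (hz z).trans (zero_apply _).symm)
  have hdΓ : ContDiffOn ℝ ∞ (fderiv ℝ Γ) T := hΓ.fderiv_of_isOpen hT (by simp)
  have hB : ∀ ξ, ContDiffOn ℝ ∞ (fun τ => fderiv ℝ Γ τ ξ) T := fun ξ =>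
    hdΓ.clm_apply contDiffOn_const
  have hn : ContDiffOn ℝ ∞ (fun τ => fderiv ℝ Γ τ e₁ (Γ τ z₀)) T :=
    (hB e₁).clm_apply (hΓ.clm_apply contDiffOn_const)
  have hJ : ContDiffOn ℝ ∞ (fun τ => acs (Γ τ) (fderiv ℝ Γ τ e₁)) T :=
    contDiffOn_apply_fderiv contDiff_acs hT hΓ e₁
  have hcont : ContinuousAt (fun τ =>
      ![acs (Γ τ) (fderiv ℝ Γ τ e₁), fderiv ℝ Γ τ e₁, fderiv ℝ Γ τ e₂]) τ₀ := by
    exact continuousAt_vecCons (hJ.continuousOn.continuousAt (hT.mem_nhds h₀))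
      ((hB e₁).continuousOn.continuousAt (hT.mem_nhds h₀))
      ((hB e₂).continuousOn.continuousAt (hT.mem_nhds h₀))
  -- Linear independence and n ≠ 0 are open conditions. A ball is taken so that a vanishing
  -- derivative gives constancy.
  have hev := ((hT.eventually_mem h₀).and ((hcont.eventually hli.eventually).and
    ((hn.continuousOn.continuousAt (hT.mem_nhds h₀)).eventually_ne hz₀)))
  obtain ⟨r, hr, hball⟩ := Metric.eventually_nhds_iff_ball.mp hev
  have hN : ∀ τ ∈ Metric.ball τ₀ r, ∃ g : Spin7,
      Γ τ = wedge (toEndo g (ε 0)) (toEndo g (ε 1)) ∧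
      IsPencil g (fderiv ℝ Γ τ e₁) (fderiv ℝ Γ τ e₂) (fderiv ℝ Γ τ e₁ (Γ τ z₀)) := by
    intro τ hτ
    obtain ⟨h1, h2, h3⟩ := hball τ hτ
    obtain ⟨x, y, hxy, hq⟩ := mem_grass.mp (hm τ h1)
    obtain ⟨g, rfl, rfl⟩ := hxy.exists_spin7
    refine ⟨g, hq, ?_⟩
    have t1 := htan τ h1 e₁
    have t2 := htan τ h1 e₂
    have hp := fun z m => hpsi τ h1 _ _ hxy hq e₁ e₂ z m
    rw [hq] at t1 t2 h2 h3 hp ⊢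
    exact isPencil_of_psi t1 t2 h3 hp h2
  set P : EuclideanSpace ℝ (Fin 2) → Endo := fun τ =>
    lineProj (Γ τ) (fderiv ℝ Γ τ e₁ (Γ τ z₀)) with hP
  have hsub : Metric.ball τ₀ r ⊆ T := fun τ hτ => (hball τ hτ).1
  have hPd : DifferentiableOn ℝ P (Metric.ball τ₀ r) :=
    (contDiffOn_lineProj (hΓ.mono hsub) (hn.mono hsub) fun τ hτ =>
      (hball τ hτ).2.2).differentiableOn (by simp)
  have hP0 : Set.EqOn (fderiv ℝ P) 0 (Metric.ball τ₀ r) := fun τ hτ => by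
    have h := fderiv_lineProj_eq_zero Metric.isOpen_ball (hΓ.mono hsub) (fun _ => rfl) hN hτ
    have hb : ((fderiv ℝ P τ : EuclideanSpace ℝ (Fin 2) →L[ℝ] Endo) :
        EuclideanSpace ℝ (Fin 2) →ₗ[ℝ] Endo) = 0 := by
      refine (EuclideanSpace.basisFun (Fin 2) ℝ).toBasis.ext fun i => ?_
      rw [OrthonormalBasis.coe_toBasis, EuclideanSpace.basisFun_apply]
      fin_cases i
      exacts [h.1, h.2]
    ext1 ξ
    exact LinearMap.congr_fun hb ξ
  have hconst : ∀ τ ∈ Metric.ball τ₀ r, P τ = P τ₀ := fun τ hτ =>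
    Metric.isOpen_ball.is_const_of_fderiv_eq_zero (convex_ball τ₀ r).isPreconnected hPd hP0 hτ
      (Metric.mem_ball_self hr)
  refine ⟨LinearMap.range (P τ₀ : Oct →ₗ[ℝ] Oct), ?_, ?_⟩
  · obtain ⟨g, hg, hpen⟩ := hN τ₀ (Metric.mem_ball_self hr)
    have h1 : P τ₀ = lineProj (wedge (toEndo g (ε 0)) (toEndo g (ε 1)))
      (fderiv ℝ Γ τ₀ e₁ (Γ τ₀ z₀)) := by rw [← hg]
    rw [h1]
    exact finrank_range_lineProj (isPair_ε.map g) hpen.inner₀ hpen.inner₁ hpen.ne_zero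
  · filter_upwards [Metric.ball_mem_nhds τ₀ hr] with τ hτ w
    obtain ⟨g, hg, hpen⟩ := hN τ hτ
    refine ⟨Γ τ w, ?_⟩
    rw [ContinuousLinearMap.coe_coe, ← hconst τ hτ]
    simp only [hP]
    rw [hg] at hpen ⊢
    exact lineProj_wedge (isPair_ε.map g) hpen.inner₀ hpen.inner₁ w

/-- Turns failure of J-invariance into an open condition: if J D e₁ lies in the image plane, then so
does J D e₂, and the plane is invariant. -/
theorem linearIndependent_of_not_complex {J : Endo →L[ℝ] Endo}
    {D : EuclideanSpace ℝ (Fin 2) →L[ℝ] Endo} (hD : Function.Injective D)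
    (hJ : ∀ ξ, J (J (D ξ)) = -D ξ) (h : ¬ ∀ ξ, ∃ η, D η = J (D ξ)) :
    LinearIndependent ℝ ![J (D (EuclideanSpace.single 0 1)), D (EuclideanSpace.single 0 1),
      D (EuclideanSpace.single 1 1)] := by
  have hli : LinearIndependent ℝ ![D (EuclideanSpace.single 0 1), D (EuclideanSpace.single 1 1)] := by
    have h1 := (EuclideanSpace.basisFun (Fin 2) ℝ).toBasis.linearIndependent.map'
      (D : EuclideanSpace ℝ (Fin 2) →ₗ[ℝ] Endo) (LinearMap.ker_eq_bot.mpr hD)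
    have h2 : ![D (EuclideanSpace.single 0 1), D (EuclideanSpace.single 1 1)] =
        (D : EuclideanSpace ℝ (Fin 2) →ₗ[ℝ] Endo) ∘ (EuclideanSpace.basisFun (Fin 2) ℝ).toBasis := by
      funext i
      rw [Function.comp_apply, OrthonormalBasis.coe_toBasis, EuclideanSpace.basisFun_apply]
      fin_cases i <;> rfl
    rwa [h2]
  refine linearIndependent_finCons.mpr ⟨hli, fun hmem => h ?_⟩
  have hr : Set.range ![D (EuclideanSpace.single 0 1), D (EuclideanSpace.single 1 1)] =
      {D (EuclideanSpace.single 0 1), D (EuclideanSpace.single 1 1)} := by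
    rw [Matrix.range_cons, Matrix.range_cons, Matrix.range_empty, Set.union_empty,
      Set.singleton_union]
  change _ ∈ Submodule.span ℝ (Set.range ![_, _]) at hmem
  rw [hr] at hmem
  obtain ⟨a, b, hab⟩ := Submodule.mem_span_pair.mp hmem
  set e₁ : EuclideanSpace ℝ (Fin 2) := EuclideanSpace.single 0 1
  set e₂ : EuclideanSpace ℝ (Fin 2) := EuclideanSpace.single 1 1
  have h1 : J (D e₁) = D (a • e₁ + b • e₂) := by rw [map_add, map_smul, map_smul, hab]
  -- Otherwise D e₁ would be a real eigenvector of J. Hence D e₂ is a combination of D e₁ and J D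
  -- e₁, which gives J D e₂.
  have hb : b ≠ 0 := fun hb => by
    have h2 : J (D e₁) = a • D e₁ := by rw [h1, hb, zero_smul, add_zero, map_smul]
    have h3 := hJ e₁
    rw [h2, map_smul, h2] at h3
    exact hli.ne_zero 0 (eq_zero_of_smul_smul h3)
  have h2 : J (D e₂) = D (b⁻¹ • (-e₁ - a • (a • e₁ + b • e₂))) := by
    have h3 : e₂ = b⁻¹ • ((a • e₁ + b • e₂) - a • e₁) := by
      rw [add_sub_cancel_left, smul_smul, inv_mul_cancel₀ hb, one_smul]
    conv_lhs => rw [h3]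
    rw [map_smul, map_sub, ← h1, map_smul, map_smul, map_sub, hJ, map_smul, h1, map_smul, map_sub,
      map_smul, map_neg]
  intro ξ
  have hξ : ξ = ξ 0 • e₁ + ξ 1 • e₂ := by
    ext i
    fin_cases i <;> simp [e₁, e₂]
  refine ⟨ξ 0 • (a • e₁ + b • e₂) + ξ 1 • (b⁻¹ • (-e₁ - a • (a • e₁ + b • e₂))), ?_⟩
  have h3 : J (D ξ) = ξ 0 • J (D e₁) + ξ 1 • J (D e₂) := by
    conv_lhs => rw [hξ]
    rw [map_add, map_smul, map_smul, map_add, map_smul, map_smul]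
  rw [h3, h1, h2, map_add, map_smul D (ξ 0), map_smul D (ξ 1)]

theorem fderiv_extChartAt {E H M F : Type*} [NormedAddCommGroup E] [NormedSpace ℝ E]
    [TopologicalSpace H] {I : ModelWithCorners ℝ E H} [TopologicalSpace M] [ChartedSpace H M]
    [NormedAddCommGroup F] [NormedSpace ℝ F] [I.Boundaryless] {f : M → F} {p : M}
    (hf : MDifferentiableAt I 𝓘(ℝ, F) f p) :
    fderiv ℝ (f ∘ (extChartAt I p).symm) (extChartAt I p p) =
      (mfderiv I 𝓘(ℝ, F) f p : E →L[ℝ] F) := by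
  have key : ∀ L : E →L[ℝ] F, HasFDerivAt (f ∘ (extChartAt I p).symm) L (extChartAt I p p) →
      fderiv ℝ (f ∘ (extChartAt I p).symm) (extChartAt I p p) = L := fun L h => h.fderiv
  exact key _ (hasFDerivAt_extChartAt hf)

namespace RuledCone

variable {S : Type*} [TopologicalSpace S] [ChartedSpace (EuclideanSpace ℝ (Fin 2)) S]
  [IsManifold (𝓡 2) ∞ S]

/-- By contraposition: if the tangent plane at σ is not complex, reading the cone in the chart at σ
and applying `exists_four_plane` produces a fixed four-plane. -/
theorem hasComplexTangent_of_isCayley {C : RuledCone S} (hnd : C.Nondegenerate) (hC : C.IsCayley)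
    {σ : S} (hσ : ¬ C.IsPlanarNear σ) : HasComplexTangent acs C.gauss σ := by
  by_contra hcx
  apply hσ
  set φ := extChartAt (𝓡 2) σ
  set Γ : EuclideanSpace ℝ (Fin 2) → Endo := C.gauss ∘ φ.symm with hΓdef
  have hT : IsOpen φ.target := isOpen_extChartAt_target σ
  have hsymm : ContMDiffOn 𝓘(ℝ, EuclideanSpace ℝ (Fin 2)) (𝓡 2) ∞ φ.symm φ.target :=
    contMDiffOn_extChartAt_symm σ
  have hΓ : ContDiffOn ℝ ∞ Γ φ.target :=
    (C.contMDiff_gauss.comp_contMDiffOn hsymm).contDiffOn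
  -- At other points of the chart only the existence of a matching tangent vector is needed, since
  -- the Cayley condition holds for all tangent vectors.
  have hfd : ∀ τ ∈ φ.target, ∀ ξ, ∃ ζ : EuclideanSpace ℝ (Fin 2),
      fderiv ℝ Γ τ ξ = differential C.gauss (φ.symm τ) ζ := fun τ hτ ξ => by
    have h1 : MDifferentiableAt 𝓘(ℝ, EuclideanSpace ℝ (Fin 2)) (𝓡 2) φ.symm τ :=
      (hsymm.contMDiffAt (hT.mem_nhds hτ)).mdifferentiableAt (by simp)
    have h2 : MDifferentiableAt (𝓡 2) 𝓘(ℝ, Endo) C.gauss (φ.symm τ) :=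
      (C.contMDiff_gauss _).mdifferentiableAt (by simp)
    have h3 := mfderiv_comp τ h2 h1
    rw [mfderiv_eq_fderiv] at h3
    exact ⟨(mfderiv 𝓘(ℝ, EuclideanSpace ℝ (Fin 2)) (𝓡 2) φ.symm τ :
      EuclideanSpace ℝ (Fin 2) →L[ℝ] EuclideanSpace ℝ (Fin 2)) ξ,
      congrArg (fun L : EuclideanSpace ℝ (Fin 2) →L[ℝ] Endo => L ξ) h3⟩
  have h₀ : φ σ ∈ φ.target := mem_extChartAt_target σ
  have hσ₀ : φ.symm (φ σ) = σ := extChartAt_to_inv σ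
  have hd : ∀ ξ : EuclideanSpace ℝ (Fin 2), fderiv ℝ Γ (φ σ) ξ = differential C.gauss σ ξ := by
    intro ξ
    exact congrArg (fun L : EuclideanSpace ℝ (Fin 2) →L[ℝ] Endo => L ξ)
      (fderiv_extChartAt ((C.contMDiff_gauss σ).mdifferentiableAt (by simp)))
  have hΓ₀ : Γ (φ σ) = C.gauss σ := congrArg C.gauss hσ₀
  have htan : ∀ ξ, fderiv ℝ Γ (φ σ) ξ ∈ tangent grass (Γ (φ σ)) := fun ξ => by
    have h1 := isTangent_fderiv hT hΓ (fun τ _ => C.gauss_mem _) h₀ ξ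
    obtain ⟨x, y, hxy, hq⟩ := mem_grass.mp (C.gauss_mem (φ.symm (φ σ)))
    change Γ (φ σ) = _ at hq
    rw [hq] at h1 ⊢
    exact h1.mem_tangent hxy
  have hli := linearIndependent_of_not_complex (J := acs (Γ (φ σ))) (D := fderiv ℝ Γ (φ σ))
    (fun ξ η h => hnd σ ((hd ξ).symm.trans (h.trans (hd η))))
    (fun ξ => acs_acs (C.gauss_mem _) (htan ξ)) (fun h => hcx fun ξ => by
      obtain ⟨η, hη⟩ := h ξ
      refine ⟨η, ?_⟩
      have h1 := (hd η).symm.trans hη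
      rw [hΓ₀] at h1
      exact h1.trans (congrArg _ (hd ξ)))
  obtain ⟨W, hW, hev⟩ := exists_four_plane hT hΓ (fun τ _ => C.gauss_mem _)
    (fun τ hτ x y hxy hq ξ η z m => by
      obtain ⟨ξ', hξ'⟩ := hfd τ hτ ξ
      obtain ⟨η', hη'⟩ := hfd τ hτ η
      rw [hξ', hη']
      exact hC.psi_eq_zero hxy hq ξ' η' z m) h₀ hli
  have hev' := ((continuousAt_extChartAt (I := 𝓡 2) σ).eventually hev).and
    (extChartAt_source_mem_nhds (I := 𝓡 2) σ)
  refine ⟨_, hev', W, hW, fun τ hτ => ?_⟩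
  rw [← C.range_gauss]
  rintro _ ⟨w, rfl⟩
  have h1 := hτ.1 w
  change C.gauss (φ.symm (φ τ)) w ∈ W at h1
  rwa [φ.left_inv hτ.2] at h1

omit [IsManifold (𝓡 2) ∞ S] in
theorem nondegenerate_and_isCayley {C : RuledCone S} (himm : IsImmersed C.gauss)
    (hhol : IsPseudoholomorphic grass acs C.gauss) : C.Nondegenerate ∧ C.IsCayley :=
  ⟨himm, isCayley_of_isPseudoholomorphic himm hhol⟩

theorem nondegenerate_isCayley_iff {C : RuledCone S} (hC : ∀ σ, ¬ C.IsPlanarNear σ) :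
    C.Nondegenerate ∧ C.IsCayley ↔
      IsImmersed C.gauss ∧ IsPseudoholomorphic grass acs C.gauss :=
  ⟨fun h => ⟨h.1, C.isSmoothInto_gauss, fun σ _ =>
    hasComplexTangent_of_isCayley h.1 h.2 (hC σ)⟩, fun h => nondegenerate_and_isCayley h.1 h.2⟩

end RuledCone

theorem acs_smul (g : Spin7) (p : grass) (B : Endo) :
    acs (g • p : grass) (conjAct g B) = conjAct g (acs p B) :=
  acs_conjAct g p.2 B

end CayleyCone

theorem mainTheorem4 :
    -- `G(2,𝕆)` is a twelve-dimensional manifold, and it is the homogeneous space `Spin(7)/U(3)`: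
    IsSubmanifold 12 grass ∧
    (∃ h : (Spin7 ⧸ MulAction.stabilizer Spin7 basePoint) ≃ₜ grass,
      ∀ g : Spin7, h (QuotientGroup.mk g) = g • basePoint) ∧
    (∀ p : grass, ∃ (U : Set Endo) (s : Endo → Endo), IsOpen U ∧ (p : Endo) ∈ U ∧
      ContDiffOn ℝ ∞ s U ∧
      ∀ q : grass, (q : Endo) ∈ U → ∃ g : Spin7, toEndo g = s q ∧ g • basePoint = q) ∧
    (∃ χ : MulAction.stabilizer Spin7 basePoint ≃ₜ* Matrix.unitaryGroup (Fin 3) ℂ,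
      ∀ (g : MulAction.stabilizer Spin7 basePoint) (x : Oct), complexCoord (toEndo g x) =
        (χ g : Matrix (Fin 3) (Fin 3) ℂ).mulVec (complexCoord x)) ∧
    -- the almost complex structure, for which the forms `ζ` span the forms of type `(1,0)`:
    IsAlmostComplex grass acs ∧
    (∀ g : Spin7, ∀ X ∈ tangent spin7Set (toEndo g), ∀ Y ∈ tangent spin7Set (toEndo g),
      (acs (g • basePoint : grass) (dOrbit g X) = dOrbit g Y ↔
        ∀ a, zeta g a Y = Complex.I • zeta g a X)) ∧
    (∀ (g : Spin7) (p : grass), ∀ B ∈ tangent grass (p : Endo),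
      acs (g • p : grass) (conjAct g B) = conjAct g (acs p B)) ∧
    ¬ IsIntegrable 6 grass acs ∧
    -- ruled Cayley cones and pseudoholomorphic curves:
    ∀ (S : Type*) [TopologicalSpace S] [ChartedSpace (EuclideanSpace ℝ (Fin 2)) S]
      [IsManifold (𝓡 2) ∞ S],
      Set.BijOn (RuledCone.gauss (S := S)) Set.univ {γ | IsSmoothInto grass γ} ∧
      (∀ C : RuledCone S, (∀ σ, ¬ C.IsPlanarNear σ) →
        (C.Nondegenerate ∧ C.IsCayley ↔
          IsImmersed C.gauss ∧ IsPseudoholomorphic grass acs C.gauss)) ∧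
      (∀ C : RuledCone S, IsImmersed C.gauss → IsPseudoholomorphic grass acs C.gauss →
        C.Nondegenerate ∧ C.IsCayley) ∧
      ∀ C : RuledCone S, C.Nondegenerate → C.IsCayley →
        ∀ σ, ¬ C.IsPlanarNear σ → HasComplexTangent acs C.gauss σ := by
  exact ⟨isSubmanifold_grass, exists_homeomorph_quotient, exists_local_section,
    exists_stabilizer_equiv, isAlmostComplex_acs, fun g X hX Y hY => zeta_type g hX hY,
    fun g p B _ => acs_smul g p B, not_isIntegrable, fun S _ _ _ =>
    ⟨RuledCone.bijOn_gauss, fun C hC => RuledCone.nondegenerate_isCayley_iff hC,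
      fun C h₁ h₂ => RuledCone.nondegenerate_and_isCayley h₁ h₂,
      fun C h₁ h₂ σ hσ => RuledCone.hasComplexTangent_of_isCayley h₁ h₂ hσ⟩⟩
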